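/- **Setting.** Let $K$ be a field of characteristic zero and let $q\in K^\times$ not be a root of unity (for instance $K=\mathbb C(q)$ with $q$ an indeterminate). Let $m,n\ge 2$, $N=m+n$. Put $p(a)=0$ for $1\le a\le m$, $p(a)=1$ for $m<a\le N$, and let $V=\bigoplus_{a=1}^N Kv_a$. *Lattice.* On $\bigoplus_{a=1}^N\mathbb Z\varepsilon_a\oplus\mathbb Z\delta$ let $(\varepsilon_a,\varepsilon_b)=(-1)^{p(a)}\delta_{ab}$, with $\delta$ in the radical. Put $\alpha_i=\varepsilon_i-\varepsilon_{i+1}$ $(1\le i<N)$, $\alpha_0=\delta+\varepsilon_N-\varepsilon_1$. The parity of the vertex $i$ is $p(\alpha_i)=1$ for $i\in\{0,m\}$ and $0$ otherwise; $d_i=1$ for $1\le i\le m$, $d_i=-1$ for $m<i\le N$ and for $i=0$; $q_i=q^{d_i}$. Let $\Gamma$ be any lattice with $\bigoplus_{i=0}^{N-1}\mathbb Z\alpha_i\subseteq\Gamma\subseteq\bigoplus_a\mathbb Z\varepsilon_a\oplus\mathbb Z\delta$. *Quantum algebra.* For elements $X,Y$ of parities $p(X),p(Y)$ and weights $v,w$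 let $[X,Y]=XY-(-1)^{p(X)p(Y)}YX$ and $[\![X,Y]\!]=XY-(-1)^{p(X)p(Y)}q^{-(v,w)}YX$. $U=U^\sigma_{q,a}(\mathrm{sl}(m,n))$ is the associative unital $K$-algebra with generators $\sigma$, $K_\gamma$ $(\gamma\in\Gamma)$, $E_i,F_i$ $(i\in\mathbb Z/N)$ and relations $\sigma^2=1$, $\sigma K_\gamma=K_\gamma\sigma$, $\sigma E_i=(-1)^{p(\alpha_i)}E_i\sigma$, $\sigma F_i=(-1)^{p(\alpha_i)}F_i\sigma$; $K_0=1$ (for $0\in\Gamma$), $K_\gamma K_{\gamma'}=K_{\gamma+\gamma'}$; $K_\gamma E_iK_\gamma^{-1}=q^{(\gamma,\alpha_i)}E_i$, $K_\gamma F_iK_\gamma^{-1}=q^{-(\gamma,\alpha_i)}F_i$; $[E_i,F_j]=\delta_{ij}\frac{K_{\alpha_i}-K_{\alpha_i}^{-1}}{q_i-q_i^{-1}}$; $[E_i,E_j]=0$ if $i\ne j$ and $(\alpha_i,\alpha_j)=0$; $E_0^2=0=E_m^2$; $[\![E_i,[\![E_i,E_{i\pm1}]\!]]\!]=0$ for $i\neq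 0,m$; $[[\![[\![E_{i-1},E_i]\!],E_{i+1}]\!],E_i]=0$ for $i\in\{0,m\}$ (indices modulo $N$); and the same relations among the $F_i$. The tensor product of two $U$-modules is formed through the comultiplication $\Delta(\sigma)=\sigma\otimes\sigma$, $\Delta(K_\gamma)=K_\gamma\otimes K_\gamma$, $\Delta(E_i)=E_i\otimes1+K_{\alpha_i}\sigma^{p(\alpha_i)}\otimes E_i$, $\Delta(F_i)=F_i\otimes K_{\alpha_i}^{-1}+\sigma^{p(\alpha_i)}\otimes F_i$. *Hecke algebras.* $H^a_d=H^a_d(q^2)$ is the $K$-algebra with generators $\widehat T_i$ $(1\le i<d)$, $y_j^{\pm1}$ $(1\le j\le d)$ and relations $\widehat T_i\widehat T_{i+1}\widehat T_i=\widehat T_{i+1}\widehat T_i\widehat T_{i+1}$, $\widehat T_i\widehat T_j=\widehat T_j\widehat T_i$ $(|i-j|>1)$, $(\widehat T_i+q^{-1})(\widehat T_i-q)=0$, $y_jy_j^{-1}=1=y_j^{-1}y_j$, $y_jy_k=y_ky_j$, $y_j\widehat T_i=\widehat T_iy_j$ $(j\ne i,i+1)$, $\widehat T_iy_i\widehat T_i=y_{i+1}$;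 $H_d$ is the algebra with generators $\widehat T_i$ and the relations among them. $H_d$ acts on $V^{\otimes d}$ from the left, $\widehat T_i$ acting on the factors $i,i+1$ by $v_a\otimes v_a\mapsto(-1)^{p(a)}q^{(-1)^{p(a)}}v_a\otimes v_a$ and, for $a\neq b$, $v_a\otimes v_b\mapsto(-1)^{p(a)p(b)}v_b\otimes v_a+c_{ab}\,v_a\otimes v_b$, with $c_{ab}=q-q^{-1}$ if $a<b$ and $c_{ab}=0$ if $a>b$. For a right $H^a_{d_1}$-module $M_1$ and a right $H^a_{d_2}$-module $M_2$ put $I^a(M_1,M_2)=(M_1\otimes_K M_2)\otimes_{H^a_{d_1}\otimes H^a_{d_2}}H^a_{d_1+d_2}$, where $H^a_{d_1}\otimes H^a_{d_2}\to H^a_{d_1+d_2}$ is $\widehat T_i\otimes1\mapsto\widehat T_i$, $y_j\otimes1\mapsto y_j$, $1\otimes\widehat T_i\mapsto\widehat T_{i+d_1}$, $1\otimes y_j\mapsto y_{j+d_1}$. *The functor.* On $V$ let $\rho(\sigma)v_a=(-1)^{p(a)}v_a$, $\rho(K_\gamma)v_a=q^{(\gamma,\varepsilon_a)}v_a$, and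 for $1\le i<N$ let $\rho(E_i)v_a=\delta_{a,i+1}q^{-(-1)^{p(i+1)}}v_i$ and $\rho(F_i)v_a=\delta_{a,i}q^{(-1)^{p(i+1)}}v_{i+1}$. Put $E_\Pi=\rho(E_1)\cdots\rho(E_{N-1})$, $F_\Pi=\rho(F_{N-1})\cdots\rho(F_1)$, $K_\Pi=\rho(K_{\alpha_1+\cdots+\alpha_{N-1}})$. For a right $H^a_d$-module $M$, $\mathcal F(M)$ is the space $M\otimes_{H_d}V^{\otimes d}$ on which $\sigma$ and $K_\gamma$ act by $1\otimes\rho(\sigma)^{\otimes d}$ and $1\otimes\rho(K_\gamma)^{\otimes d}$; $E_i$ and $F_i$, $1\le i<N$, act by $1\otimes\sum_k\rho(\sigma^{p(\alpha_i)}K_{\alpha_i})^{\otimes(k-1)}\otimes\rho(E_i)\otimes1^{\otimes(d-k)}$ and $1\otimes\sum_k\rho(\sigma^{p(\alpha_i)})^{\otimes(k-1)}\otimes\rho(F_i)\otimes\rho(K_{\alpha_i}^{-1})^{\otimes(d-k)}$; and $$E_0(x\otimes v)=\sum_{j=1}^d xy_j^{-1}\otimes\bigl((\rho(\sigma)K_\Pi^{-1})^{\otimes(j-1)}\otimes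 F_\Pi\otimes1^{\otimes(d-j)}\bigr)v,$$ $$F_0(x\otimes v)=\sum_{j=1}^d xy_j\otimes\bigl(\rho(\sigma)^{\otimes(j-1)}\otimes E_\Pi\otimes K_\Pi^{\otimes(d-j)}\bigr)v.$$ **Proposition 17.1.** For every $d\ge1$ and every right $H^a_d(q^2)$-module $M$ these formulas are well defined and define a unique $U$-module structure on $\mathcal F(M)$. Let $d_1,d_2\ge1$. For all finite-dimensional right $H^a_{d_i}(q^2)$-modules $M_i$ $(i=1,2)$, the comultiplication formulas define a $U$-module structure on $\mathcal F(M_1)\otimes_K\mathcal F(M_2)$, and there is an isomorphism of $U$-modules $$\mathcal F(I^a(M_1,M_2))\;\cong\;\mathcal F(M_1)\otimes\mathcal F(M_2),$$ natural in $M_1$ and $M_2$. -/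

import Mathlib

open scoped TensorProduct

universe u

namespace SuperSchurWeyl

noncomputable section

/-! ### Combinatorial data of affine `sl(m, n)`

The basis vectors of the superspace `V` of dimension `(m, n)` are indexed by `Fin (m + n)`, counted
from `0`; the vertices `0, …, m + n - 1` of the affine Dynkin diagram are also indexed by
`Fin (m + n)`. The vertex `i ≠ 0` joins the basis vectors number `i - 1` and `i` (counted from `0`),
the vertex `0` joins the last basis vector and the first one. -/

/-- The cyclic predecessor `i - 1`. -/
def prev {N : ℕ} (i : Fin N) : Fin N := ⟨(i.val + N - 1) % N, Nat.mod_lt _ i.pos⟩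

/-- The cyclic successor `i + 1`. -/
def next {N : ℕ} (i : Fin N) : Fin N := ⟨(i.val + 1) % N, Nat.mod_lt _ i.pos⟩

/-- Parity of a basis vector of `V`: the first `m` are even, the last `n` are odd. -/
def parity (m n : ℕ) (a : Fin (m + n)) : ℕ := if a.val < m then 0 else 1

/-- The sign `(-1) ^ p(a)`, which is the square length of the weight `ε_a`. -/
def sign (m n : ℕ) (a : Fin (m + n)) : ℤ := (-1) ^ parity m n a

/-- The lattice `⊕ ℤ ε_a ⊕ ℤ δ`: the first component holds the coordinates along the `ε_a`, the
second one the coordinate along the null vector `δ`. -/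
abbrev WeightLattice (m n : ℕ) : Type := (Fin (m + n) → ℤ) × ℤ

/-- The symmetric form with `(ε_a, ε_b) = ± δ_{ab}` (sign of `a`) and `δ` in its radical. -/
def form {m n : ℕ} (v w : WeightLattice m n) : ℤ := ∑ a, sign m n a * v.1 a * w.1 a

/-- The weight `ε_a`. -/
def eps (m n : ℕ) (a : Fin (m + n)) : WeightLattice m n := (Pi.single a 1, 0)

/-- The simple roots: `α_i = ε_{i-1} - ε_i` for `i ≠ 0` (indices from `0`), and
`α_0 = δ + ε_last - ε_first`. -/
def root (m n : ℕ) (i : Fin (m + n)) : WeightLattice m n :=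
  eps m n (prev i) - eps m n i + (0, if i.val = 0 then 1 else 0)

/-- Parity of a vertex: exactly the vertices `0` and `m` are odd. -/
def nodeParity (m n : ℕ) (i : Fin (m + n)) : ℕ := if i.val = 0 ∨ i.val = m then 1 else 0

/-- The integers `d_i`, with `q_i = q ^ d_i`: `d_i = 1` for `1 ≤ i ≤ m` and `d_i = -1` otherwise,
including `d_0 = -1`. -/
def nodeSign (m n : ℕ) (i : Fin (m + n)) : ℤ := if 1 ≤ i.val ∧ i.val ≤ m then 1 else -1

/-! ### The affine quantum superalgebra -/

/-- Generators `σ`, `K_γ` (`γ ∈ Γ`), `E_i`, `F_i`. -/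
inductive Gen {m n : ℕ} (Γ : AddSubgroup (WeightLattice m n)) : Type
  | sigma : Gen Γ
  | K (γ : Γ) : Gen Γ
  | E (i : Fin (m + n)) : Gen Γ
  | F (i : Fin (m + n)) : Gen Γ

/-- Superbracket `[x, y]` of elements of parities `a`, `b`. -/
def superBracket {A : Type u} [Ring A] (a b : ℕ) (x y : A) : A := x * y - (-1) ^ (a * b) * (y * x)

/-- Quantum superbracket `x y - (-1)^{ab} q^{-(v, w)} y x` of elements `x` of parity `a` and weight
`v`, and `y` of parity `b` and weight `w`. It is the same for weights `-v`, `-w`. -/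
def quantumBracket {K : Type u} [Field K] {A : Type u} [Ring A] [Algebra K A] {m n : ℕ} (q : K)
    (a b : ℕ) (v w : WeightLattice m n) (x y : A) : A :=
  x * y - ((-1) ^ (a * b) * q ^ (-form v w)) • (y * x)

/-- The quantum Serre elements in a family `x` (`x = E` or `x = F`). -/
inductive SerreElement {K : Type u} [Field K] {A : Type u} [Ring A] [Algebra K A] {m n : ℕ}
    (q : K) (x : Fin (m + n) → A) : A → Prop
  | orthogonal (i j : Fin (m + n)) (hij : i ≠ j) (h : form (root m n i) (root m n j) = 0) :
      SerreElement q x (superBracket (nodeParity m n i) (nodeParity m n j) (x i) (x j))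
  | odd (i : Fin (m + n)) (hi : nodeParity m n i = 1) : SerreElement q x (x i * x i)
  | cubic (i j : Fin (m + n)) (hi : nodeParity m n i = 0) (hj : j = prev i ∨ j = next i) :
      SerreElement q x
        (quantumBracket q (nodeParity m n i) (nodeParity m n i + nodeParity m n j)
          (root m n i) (root m n i + root m n j) (x i)
          (quantumBracket q (nodeParity m n i) (nodeParity m n j) (root m n i) (root m n j)
            (x i) (x j)))
  | quartic (i : Fin (m + n)) (hi : nodeParity m n i = 1) :
      SerreElement q x
        (superBracket
          (nodeParity m n (prev i) + nodeParity m n i + nodeParity m n (next i)) (nodeParity m n i)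
          (quantumBracket q (nodeParity m n (prev i) + nodeParity m n i) (nodeParity m n (next i))
            (root m n (prev i) + root m n i) (root m n (next i))
            (quantumBracket q (nodeParity m n (prev i)) (nodeParity m n i)
              (root m n (prev i)) (root m n i) (x (prev i)) (x i))
            (x (next i)))
          (x i))

/-- The defining relations of the affine quantum superalgebra, extended by `σ`. -/
inductive QuantumRel {K : Type u} [Field K] {m n : ℕ} (q : K)
    (Γ : AddSubgroup (WeightLattice m n)) (hΓ : ∀ i, root m n i ∈ Γ) :
    FreeAlgebra K (Gen Γ) → FreeAlgebra K (Gen Γ) → Prop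
  | sigma_sq : QuantumRel q Γ hΓ (FreeAlgebra.ι K .sigma * FreeAlgebra.ι K .sigma) 1
  | sigma_K (γ : Γ) : QuantumRel q Γ hΓ
      (FreeAlgebra.ι K .sigma * FreeAlgebra.ι K (.K γ))
      (FreeAlgebra.ι K (.K γ) * FreeAlgebra.ι K .sigma)
  | sigma_E (i : Fin (m + n)) : QuantumRel q Γ hΓ
      (FreeAlgebra.ι K .sigma * FreeAlgebra.ι K (.E i))
      ((-1) ^ nodeParity m n i * (FreeAlgebra.ι K (.E i) * FreeAlgebra.ι K .sigma))
  | sigma_F (i : Fin (m + n)) : QuantumRel q Γ hΓ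
      (FreeAlgebra.ι K .sigma * FreeAlgebra.ι K (.F i))
      ((-1) ^ nodeParity m n i * (FreeAlgebra.ι K (.F i) * FreeAlgebra.ι K .sigma))
  | K_zero : QuantumRel q Γ hΓ (FreeAlgebra.ι K (.K 0)) 1
  | K_add (γ γ' : Γ) : QuantumRel q Γ hΓ
      (FreeAlgebra.ι K (.K γ) * FreeAlgebra.ι K (.K γ')) (FreeAlgebra.ι K (.K (γ + γ')))
  | K_E (γ : Γ) (i : Fin (m + n)) : QuantumRel q Γ hΓ
      (FreeAlgebra.ι K (.K γ) * FreeAlgebra.ι K (.E i))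
      (q ^ form γ.1 (root m n i) • (FreeAlgebra.ι K (.E i) * FreeAlgebra.ι K (.K γ)))
  | K_F (γ : Γ) (i : Fin (m + n)) : QuantumRel q Γ hΓ
      (FreeAlgebra.ι K (.K γ) * FreeAlgebra.ι K (.F i))
      (q ^ (-form γ.1 (root m n i)) • (FreeAlgebra.ι K (.F i) * FreeAlgebra.ι K (.K γ)))
  | E_F_same (i : Fin (m + n)) : QuantumRel q Γ hΓ
      (superBracket (nodeParity m n i) (nodeParity m n i)
        (FreeAlgebra.ι K (.E i)) (FreeAlgebra.ι K (.F i)))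
      ((q ^ nodeSign m n i - q ^ (-nodeSign m n i))⁻¹ •
        (FreeAlgebra.ι K (.K ⟨root m n i, hΓ i⟩) - FreeAlgebra.ι K (.K (-⟨root m n i, hΓ i⟩))))
  | E_F_ne (i j : Fin (m + n)) (h : i ≠ j) : QuantumRel q Γ hΓ
      (superBracket (nodeParity m n i) (nodeParity m n j)
        (FreeAlgebra.ι K (.E i)) (FreeAlgebra.ι K (.F j))) 0
  | serre_E (z : FreeAlgebra K (Gen Γ))
      (hz : SerreElement q (fun i => FreeAlgebra.ι K (Gen.E i)) z) : QuantumRel q Γ hΓ z 0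
  | serre_F (z : FreeAlgebra K (Gen Γ))
      (hz : SerreElement q (fun i => FreeAlgebra.ι K (Gen.F i)) z) : QuantumRel q Γ hΓ z 0

/-- The affine quantum superalgebra of `sl(m, n)` extended by `σ`, with Cartan part the group
algebra of the lattice `Γ`. -/
def AffineQuantum {K : Type u} [Field K] {m n : ℕ} (q : K)
    (Γ : AddSubgroup (WeightLattice m n)) (hΓ : ∀ i, root m n i ∈ Γ) : Type u :=
  RingQuot (QuantumRel q Γ hΓ)

instance {K : Type u} [Field K] {m n : ℕ} (q : K) (Γ : AddSubgroup (WeightLattice m n))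
    (hΓ : ∀ i, root m n i ∈ Γ) : Ring (AffineQuantum q Γ hΓ) :=
  inferInstanceAs (Ring (RingQuot (QuantumRel q Γ hΓ)))

instance {K : Type u} [Field K] {m n : ℕ} (q : K) (Γ : AddSubgroup (WeightLattice m n))
    (hΓ : ∀ i, root m n i ∈ Γ) : Algebra K (AffineQuantum q Γ hΓ) :=
  inferInstanceAs (Algebra K (RingQuot (QuantumRel q Γ hΓ)))

/-- The generators as elements of the algebra. -/
def AffineQuantum.gen {K : Type u} [Field K] {m n : ℕ} (q : K)
    (Γ : AddSubgroup (WeightLattice m n)) (hΓ : ∀ i, root m n i ∈ Γ) (g : Gen Γ) :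
    AffineQuantum q Γ hΓ :=
  RingQuot.mkAlgHom K (QuantumRel q Γ hΓ) (FreeAlgebra.ι K g)

/-- The operator by which a generator acts on the tensor product of two representations, through the
comultiplication `Δ(σ) = σ ⊗ σ`, `Δ(K_γ) = K_γ ⊗ K_γ`,
`Δ(E_i) = E_i ⊗ 1 + K_{α_i} σ^{p(i)} ⊗ E_i`, `Δ(F_i) = F_i ⊗ K_{α_i}⁻¹ + σ^{p(i)} ⊗ F_i`. -/
def tensorOperator {K : Type u} [Field K] {m n : ℕ} (q : K)
    (Γ : AddSubgroup (WeightLattice m n)) (hΓ : ∀ i, root m n i ∈ Γ)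
    {W₁ W₂ : Type u} [AddCommGroup W₁] [Module K W₁] [AddCommGroup W₂] [Module K W₂]
    (ρ₁ : AffineQuantum q Γ hΓ →ₐ[K] Module.End K W₁)
    (ρ₂ : AffineQuantum q Γ hΓ →ₐ[K] Module.End K W₂) : Gen Γ → Module.End K (W₁ ⊗[K] W₂)
  | .sigma => TensorProduct.map (ρ₁ (.gen q Γ hΓ .sigma)) (ρ₂ (.gen q Γ hΓ .sigma))
  | .K γ => TensorProduct.map (ρ₁ (.gen q Γ hΓ (.K γ))) (ρ₂ (.gen q Γ hΓ (.K γ)))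
  | .E i => TensorProduct.map (ρ₁ (.gen q Γ hΓ (.E i))) 1 +
      TensorProduct.map
        (ρ₁ (.gen q Γ hΓ (.K ⟨root m n i, hΓ i⟩) * .gen q Γ hΓ .sigma ^ nodeParity m n i))
        (ρ₂ (.gen q Γ hΓ (.E i)))
  | .F i => TensorProduct.map (ρ₁ (.gen q Γ hΓ (.F i)))
        (ρ₂ (.gen q Γ hΓ (.K (-⟨root m n i, hΓ i⟩)))) +
      TensorProduct.map (ρ₁ (.gen q Γ hΓ .sigma ^ nodeParity m n i)) (ρ₂ (.gen q Γ hΓ (.F i)))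

/-- `τ` is the tensor product of the representations `ρ₁` and `ρ₂`. -/
def IsTensorAction {K : Type u} [Field K] {m n : ℕ} (q : K)
    (Γ : AddSubgroup (WeightLattice m n)) (hΓ : ∀ i, root m n i ∈ Γ)
    {W₁ W₂ : Type u} [AddCommGroup W₁] [Module K W₁] [AddCommGroup W₂] [Module K W₂]
    (ρ₁ : AffineQuantum q Γ hΓ →ₐ[K] Module.End K W₁)
    (ρ₂ : AffineQuantum q Γ hΓ →ₐ[K] Module.End K W₂)
    (τ : AffineQuantum q Γ hΓ →ₐ[K] Module.End K (W₁ ⊗[K] W₂)) : Prop :=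
  ∀ g : Gen Γ, τ (.gen q Γ hΓ g) = tensorOperator q Γ hΓ ρ₁ ρ₂ g

/-! ### Hecke algebras

The generators `T_i`, `1 ≤ i < d`, are indexed by `Fin (d - 1)`; the generator with index `i`
(from `0`) concerns the positions `i` and `i + 1` (from `0`). -/

/-- First of the two neighbouring positions `i`, `i + 1`. -/
def lower {d : ℕ} (i : Fin (d - 1)) : Fin d := ⟨i.val, by omega⟩

/-- Second of the two neighbouring positions `i`, `i + 1`. -/
def upper {d : ℕ} (i : Fin (d - 1)) : Fin d := ⟨i.val + 1, by omega⟩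

/-- The relations of the finite Hecke algebra in a family `T`. -/
inductive FiniteRel {K : Type u} [Field K] {A : Type u} [Ring A] [Algebra K A] (q : K) {d : ℕ}
    (T : Fin (d - 1) → A) : A → A → Prop
  | braid (i j : Fin (d - 1)) (h : j.val = i.val + 1) :
      FiniteRel q T (T i * T j * T i) (T j * T i * T j)
  | comm (i j : Fin (d - 1)) (h : i.val + 1 < j.val) : FiniteRel q T (T i * T j) (T j * T i)
  | quad (i : Fin (d - 1)) :
      FiniteRel q T ((T i + algebraMap K A q⁻¹) * (T i - algebraMap K A q)) 0

/-- The finite Hecke algebra `H_d(q²)`. -/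
def FiniteHecke {K : Type u} [Field K] (q : K) (d : ℕ) : Type u :=
  RingQuot (FiniteRel q (fun i : Fin (d - 1) => FreeAlgebra.ι K i))

instance {K : Type u} [Field K] (q : K) (d : ℕ) : Ring (FiniteHecke q d) :=
  inferInstanceAs (Ring (RingQuot (FiniteRel q (fun i : Fin (d - 1) => FreeAlgebra.ι K i))))

instance {K : Type u} [Field K] (q : K) (d : ℕ) : Algebra K (FiniteHecke q d) :=
  inferInstanceAs (Algebra K (RingQuot (FiniteRel q (fun i : Fin (d - 1) => FreeAlgebra.ι K i))))

/-- The quotient map from the free algebra. -/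
def FiniteHecke.mk {K : Type u} [Field K] (q : K) (d : ℕ) :
    FreeAlgebra K (Fin (d - 1)) →ₐ[K] FiniteHecke q d :=
  RingQuot.mkAlgHom K (FiniteRel q (fun i : Fin (d - 1) => FreeAlgebra.ι K i))

/-- The generator `T_i` of the finite Hecke algebra. -/
def FiniteHecke.T {K : Type u} [Field K] (q : K) {d : ℕ} (i : Fin (d - 1)) : FiniteHecke q d :=
  FiniteHecke.mk q d (FreeAlgebra.ι K i)

theorem FiniteRel.map {K : Type u} [Field K] {A B : Type u} [Ring A] [Algebra K A] [Ring B]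
    [Algebra K B] {q : K} {d : ℕ} {T : Fin (d - 1) → A} {a b : A} (h : FiniteRel q T a b)
    (f : A →ₐ[K] B) : FiniteRel q (fun i => f (T i)) (f a) (f b) := by
  cases h with
  | braid i j h => simpa only [map_mul] using FiniteRel.braid (T := fun i => f (T i)) i j h
  | comm i j h => simpa only [map_mul] using FiniteRel.comm (T := fun i => f (T i)) i j h
  | quad i =>
    simpa only [map_mul, map_add, map_sub, AlgHom.commutes, map_zero] using
      FiniteRel.quad (q := q) (T := fun i => f (T i)) i

/-- A family satisfying the relations of the finite Hecke algebra defines a homomorphism. -/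
def FiniteHecke.lift {K : Type u} [Field K] {q : K} {d : ℕ} {A : Type u} [Ring A] [Algebra K A]
    (T : Fin (d - 1) → A) (hT : ∀ a b, FiniteRel q T a b → a = b) : FiniteHecke q d →ₐ[K] A :=
  RingQuot.liftAlgHom K ⟨FreeAlgebra.lift K T, fun _ _ h => hT _ _ (by
    simpa only [FreeAlgebra.lift_ι_apply] using h.map (FreeAlgebra.lift K T))⟩

theorem FiniteHecke.lift_T {K : Type u} [Field K] {q : K} {d : ℕ} {A : Type u} [Ring A]
    [Algebra K A] (T : Fin (d - 1) → A) (hT : ∀ a b, FiniteRel q T a b → a = b)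
    (i : Fin (d - 1)) : FiniteHecke.lift T hT (FiniteHecke.T q i) = T i :=
  (RingQuot.liftAlgHom_mkAlgHom_apply K _ _ _).trans (FreeAlgebra.lift_ι_apply _ _)

/-- Generators `T_i`, `y_j`, `y_j⁻¹` of the affine Hecke algebra. -/
inductive HeckeGen (d : ℕ) : Type
  | T (i : Fin (d - 1)) : HeckeGen d
  | y (j : Fin d) : HeckeGen d
  | yInv (j : Fin d) : HeckeGen d

/-- The relations of the affine Hecke algebra in families `T`, `y`, `y'`. -/
inductive AffineRel {K : Type u} [Field K] {A : Type u} [Ring A] [Algebra K A] (q : K) {d : ℕ}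
    (T : Fin (d - 1) → A) (y y' : Fin d → A) : A → A → Prop
  | finite (a b : A) (h : FiniteRel q T a b) : AffineRel q T y y' a b
  | mul_inv (j : Fin d) : AffineRel q T y y' (y j * y' j) 1
  | inv_mul (j : Fin d) : AffineRel q T y y' (y' j * y j) 1
  | y_comm (j k : Fin d) : AffineRel q T y y' (y j * y k) (y k * y j)
  | y_T (j : Fin d) (i : Fin (d - 1)) (h₁ : j ≠ lower i) (h₂ : j ≠ upper i) :
      AffineRel q T y y' (y j * T i) (T i * y j)
  | T_y_T (i : Fin (d - 1)) : AffineRel q T y y' (T i * y (lower i) * T i) (y (upper i))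

/-- The affine Hecke algebra `H^a_d(q²)`. -/
def AffineHecke {K : Type u} [Field K] (q : K) (d : ℕ) : Type u :=
  RingQuot (AffineRel q (fun i : Fin (d - 1) => FreeAlgebra.ι K (HeckeGen.T i))
    (fun j => FreeAlgebra.ι K (HeckeGen.y j)) (fun j => FreeAlgebra.ι K (HeckeGen.yInv j)))

instance {K : Type u} [Field K] (q : K) (d : ℕ) : Ring (AffineHecke q d) :=
  inferInstanceAs (Ring (RingQuot (AffineRel q
    (fun i : Fin (d - 1) => FreeAlgebra.ι K (HeckeGen.T i))
    (fun j => FreeAlgebra.ι K (HeckeGen.y j)) (fun j => FreeAlgebra.ι K (HeckeGen.yInv j)))))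

instance {K : Type u} [Field K] (q : K) (d : ℕ) : Algebra K (AffineHecke q d) :=
  inferInstanceAs (Algebra K (RingQuot (AffineRel q
    (fun i : Fin (d - 1) => FreeAlgebra.ι K (HeckeGen.T i))
    (fun j => FreeAlgebra.ι K (HeckeGen.y j)) (fun j => FreeAlgebra.ι K (HeckeGen.yInv j)))))

/-- The quotient map from the free algebra. -/
def AffineHecke.mk {K : Type u} [Field K] (q : K) (d : ℕ) :
    FreeAlgebra K (HeckeGen d) →ₐ[K] AffineHecke q d :=
  RingQuot.mkAlgHom K (AffineRel q
    (fun i : Fin (d - 1) => FreeAlgebra.ι K (HeckeGen.T i))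
    (fun j => FreeAlgebra.ι K (HeckeGen.y j)) (fun j => FreeAlgebra.ι K (HeckeGen.yInv j)))

/-- The generators as elements of the affine Hecke algebra. -/
def AffineHecke.gen {K : Type u} [Field K] (q : K) {d : ℕ} (g : HeckeGen d) : AffineHecke q d :=
  AffineHecke.mk q d (FreeAlgebra.ι K g)

theorem AffineRel.map {K : Type u} [Field K] {A B : Type u} [Ring A] [Algebra K A] [Ring B]
    [Algebra K B] {q : K} {d : ℕ} {T : Fin (d - 1) → A} {y y' : Fin d → A} {a b : A}
    (h : AffineRel q T y y' a b) (f : A →ₐ[K] B) :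
    AffineRel q (fun i => f (T i)) (fun j => f (y j)) (fun j => f (y' j)) (f a) (f b) := by
  cases h with
  | finite _ _ h => exact .finite _ _ (h.map f)
  | mul_inv j => rw [map_mul, map_one]; exact .mul_inv j
  | inv_mul j => rw [map_mul, map_one]; exact .inv_mul j
  | y_comm j k => rw [map_mul, map_mul]; exact .y_comm j k
  | y_T j i h₁ h₂ => rw [map_mul, map_mul]; exact .y_T j i h₁ h₂
  | T_y_T i => rw [map_mul, map_mul]; exact .T_y_T i

theorem AffineHecke.rel {K : Type u} [Field K] {q : K} {d : ℕ} {a b : AffineHecke q d}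
    (h : AffineRel q (fun i => AffineHecke.gen q (.T i)) (fun j => AffineHecke.gen q (.y j))
      (fun j => AffineHecke.gen q (.yInv j)) a b) : a = b := by
  have key : ∀ {a b : FreeAlgebra K (HeckeGen d)}, AffineRel q
      (fun i : Fin (d - 1) => FreeAlgebra.ι K (HeckeGen.T i))
      (fun j => FreeAlgebra.ι K (HeckeGen.y j)) (fun j => FreeAlgebra.ι K (HeckeGen.yInv j)) a b →
      AffineHecke.mk q d a = AffineHecke.mk q d b :=
    fun h => RingQuot.mkAlgHom_rel K h
  cases h with
  | finite _ _ h =>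
    cases h with
    | braid i j h => simpa only [map_mul, AffineHecke.gen] using key (.finite _ _ (.braid i j h))
    | comm i j h => simpa only [map_mul, AffineHecke.gen] using key (.finite _ _ (.comm i j h))
    | quad i =>
      simpa only [map_mul, map_add, map_sub, AlgHom.commutes, map_zero, AffineHecke.gen] using
        key (.finite _ _ (.quad i))
  | mul_inv j => simpa only [map_mul, map_one, AffineHecke.gen] using key (.mul_inv j)
  | inv_mul j => simpa only [map_mul, map_one, AffineHecke.gen] using key (.inv_mul j)
  | y_comm j k => simpa only [map_mul, AffineHecke.gen] using key (.y_comm j k)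
  | y_T j i h₁ h₂ => simpa only [map_mul, AffineHecke.gen] using key (.y_T j i h₁ h₂)
  | T_y_T i => simpa only [map_mul, AffineHecke.gen] using key (.T_y_T i)

/-- Families satisfying the relations of the affine Hecke algebra define a homomorphism. -/
def AffineHecke.lift {K : Type u} [Field K] {q : K} {d : ℕ} {A : Type u} [Ring A] [Algebra K A]
    (f : HeckeGen d → A) (hf : ∀ a b, AffineRel q (fun i => f (.T i)) (fun j => f (.y j))
      (fun j => f (.yInv j)) a b → a = b) : AffineHecke q d →ₐ[K] A :=
  RingQuot.liftAlgHom K ⟨FreeAlgebra.lift K f, fun _ _ h => hf _ _ (by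
    simpa only [FreeAlgebra.lift_ι_apply] using h.map (FreeAlgebra.lift K f))⟩

theorem AffineHecke.lift_gen {K : Type u} [Field K] {q : K} {d : ℕ} {A : Type u} [Ring A]
    [Algebra K A] (f : HeckeGen d → A) (hf : ∀ a b, AffineRel q (fun i => f (.T i))
      (fun j => f (.y j)) (fun j => f (.yInv j)) a b → a = b) (g : HeckeGen d) :
    AffineHecke.lift f hf (AffineHecke.gen q g) = f g :=
  (RingQuot.liftAlgHom_mkAlgHom_apply K _ _ _).trans (FreeAlgebra.lift_ι_apply _ _)

/-- The homomorphism `H_d(q²) → H^a_d(q²)` with `T_i ↦ T_i`. -/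
def finiteToAffine {K : Type u} [Field K] (q : K) (d : ℕ) : FiniteHecke q d →ₐ[K] AffineHecke q d :=
  FiniteHecke.lift (fun i => AffineHecke.gen q (.T i))
    fun _ _ h => AffineHecke.rel (.finite _ _ h)

/-- The shifted generators: `T_i ↦ T_{i+s}`, `y_j ↦ y_{j+s}`, `y_j⁻¹ ↦ y_{j+s}⁻¹`. -/
def shiftGen {s d D : ℕ} (h : s + d ≤ D) : HeckeGen d → HeckeGen D
  | .T i => .T ⟨s + i.val, by omega⟩
  | .y j => .y ⟨s + j.val, by omega⟩
  | .yInv j => .yInv ⟨s + j.val, by omega⟩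

/-- The homomorphism `H^a_d(q²) → H^a_D(q²)` with `T_i ↦ T_{i+s}`, `y_j ↦ y_{j+s}`. -/
def shiftHom {K : Type u} [Field K] (q : K) {s d D : ℕ} (h : s + d ≤ D) :
    AffineHecke q d →ₐ[K] AffineHecke q D :=
  AffineHecke.lift (fun g => AffineHecke.gen q (shiftGen h g)) fun a b hab => by
    apply AffineHecke.rel
    cases hab with
    | finite _ _ hab =>
      refine .finite _ _ ?_
      cases hab with
      | braid i j hij =>
        exact .braid (T := fun i => AffineHecke.gen q (HeckeGen.T i)) _ _ (by simp; omega)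
      | comm i j hij =>
        exact .comm (T := fun i => AffineHecke.gen q (HeckeGen.T i)) _ _ (by simp; omega)
      | quad i => exact .quad (T := fun i => AffineHecke.gen q (HeckeGen.T i)) _
    | mul_inv j => exact .mul_inv _
    | inv_mul j => exact .inv_mul _
    | y_comm j k => exact .y_comm _ _
    | y_T j i h₁ h₂ =>
      refine .y_T (T := fun i => AffineHecke.gen q (HeckeGen.T i))
        (y := fun j => AffineHecke.gen q (HeckeGen.y j)) _ _ ?_ ?_
      · simpa [lower, Fin.ext_iff] using h₁
      · simp only [upper, ne_eq, Fin.ext_iff] at h₂ ⊢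
        omega
    | T_y_T i =>
      exact .T_y_T (T := fun i => AffineHecke.gen q (HeckeGen.T i))
        (y := fun j => AffineHecke.gen q (HeckeGen.y j)) ⟨s + i.val, by omega⟩

/-! ### Tensor powers of the natural representation, and the Hecke action on them -/

/-- The tensor power `V^{⊗ d}` of `V = K^N`. -/
abbrev TensorPower (K : Type u) [Field K] (N d : ℕ) : Type u := ⨂[K] _ : Fin d, (Fin N → K)

/-- The basis of `V^{⊗ d}` formed by the tensors `v_{f 0} ⊗ ⋯ ⊗ v_{f (d-1)}`. -/
def tensorBasis (K : Type u) [Field K] (N d : ℕ) :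
    Module.Basis (Fin d → Fin N) K (TensorPower K N d) :=
  Basis.piTensorProduct fun _ => Pi.basisFun K (Fin N)

/-- The operator `Ř` on the tensor factors `x` and `y`:
`v_a ⊗ v_a ↦ (-1)^{p(a)} q^{(-1)^{p(a)}} v_a ⊗ v_a`, and for `a ≠ b`,
`v_a ⊗ v_b ↦ (-1)^{p(a) p(b)} v_b ⊗ v_a + [a < b] (q - q⁻¹) v_a ⊗ v_b`. -/
def braiding {K : Type u} [Field K] (m n : ℕ) (q : K) {d : ℕ} (x y : Fin d) :
    Module.End K (TensorPower K (m + n) d) :=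
  (tensorBasis K (m + n) d).constr K fun f =>
    if f x = f y then
      ((-1) ^ parity m n (f x) * q ^ sign m n (f x)) • tensorBasis K (m + n) d f
    else (-1 : K) ^ (parity m n (f x) * parity m n (f y)) •
        tensorBasis K (m + n) d (f ∘ Equiv.swap x y) +
      (if f x < f y then q - q⁻¹ else 0) • tensorBasis K (m + n) d f

theorem braiding_basis {K : Type u} [Field K] (m n : ℕ) (q : K) {d : ℕ} (x y : Fin d) (f : Fin d → Fin (m + n)) :
    braiding m n q x y (tensorBasis K (m + n) d f) =
      if f x = f y then ((-1) ^ parity m n (f x) * q ^ sign m n (f x)) • tensorBasis K (m + n) d f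
      else (-1 : K) ^ (parity m n (f x) * parity m n (f y)) • tensorBasis K (m + n) d (f ∘ Equiv.swap x y) +
        (if f x < f y then q - q⁻¹ else 0) • tensorBasis K (m + n) d f := by
  rw [braiding, Module.Basis.constr_basis]

set_option linter.unusedSimpArgs false in
theorem braiding_sq {K : Type u} [Field K] (m n : ℕ) {q : K} (hq : q ≠ 0) {d : ℕ} (x y : Fin d) :
    braiding m n q x y * braiding m n q x y = (q - q⁻¹) • braiding m n q x y + 1 := by
  refine (tensorBasis K (m + n) d).ext fun f => ?_
  rw [Module.End.mul_apply, LinearMap.add_apply, LinearMap.smul_apply, Module.End.one_apply]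
  have hs : (f ∘ Equiv.swap x y) ∘ Equiv.swap x y = f := by ext k; simp
  have hx : (f ∘ Equiv.swap x y) x = f y := by simp
  have hy : (f ∘ Equiv.swap x y) y = f x := by simp
  have e1 : ∀ a b : ℕ, (-1 : K) ^ (a * b) * (-1) ^ (b * a) = 1 := fun a b => by
    rw [mul_comm b a, ← mul_pow]; simp
  rcases lt_trichotomy (f x) (f y) with h | h | h
  · simp only [braiding_basis, h.ne, h.ne', h, h.not_gt, if_false, if_true, map_add, map_smul, hx, hy, hs,
      smul_add, smul_smul, e1, zero_smul, add_zero]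
    module
  · simp only [braiding_basis, h, if_true, map_smul, smul_smul]
    have : (((-1) ^ parity m n (f y) * q ^ sign m n (f y)) * ((-1) ^ parity m n (f y) * q ^ sign m n (f y)) : K)
        = (q - q⁻¹) * ((-1) ^ parity m n (f y) * q ^ sign m n (f y)) + 1 := by
      unfold sign parity
      split_ifs <;> simp <;> field_simp <;> ring
    rw [this]; module
  · simp only [braiding_basis, h.ne, h.ne', h, h.not_gt, if_false, if_true, map_add, map_smul, hx, hy, hs,
      smul_add, smul_smul, e1, zero_smul, add_zero]
    module

theorem braiding_comm {K : Type u} [Field K] (m n : ℕ) (q : K) {d : ℕ} {x y z w : Fin d} (hxz : x ≠ z) (hxw : x ≠ w)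
    (hyz : y ≠ z) (hyw : y ≠ w) :
    braiding m n q x y * braiding m n q z w = braiding m n q z w * braiding m n q x y := by
  refine (tensorBasis K (m + n) d).ext fun f => ?_
  rw [Module.End.mul_apply, Module.End.mul_apply]
  have h1 : (f ∘ Equiv.swap x y) z = f z := by simp [Equiv.swap_apply_of_ne_of_ne hxz.symm hyz.symm]
  have h2 : (f ∘ Equiv.swap x y) w = f w := by simp [Equiv.swap_apply_of_ne_of_ne hxw.symm hyw.symm]
  have h3 : (f ∘ Equiv.swap z w) x = f x := by simp [Equiv.swap_apply_of_ne_of_ne hxz hxw]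
  have h4 : (f ∘ Equiv.swap z w) y = f y := by simp [Equiv.swap_apply_of_ne_of_ne hyz hyw]
  have hc : (f ∘ Equiv.swap z w) ∘ Equiv.swap x y = (f ∘ Equiv.swap x y) ∘ Equiv.swap z w := by
    ext k
    simp only [Function.comp_apply, Equiv.swap_apply_def]
    split_ifs <;> simp_all
  by_cases hxy : f x = f y <;> by_cases hzw : f z = f w <;>
    simp only [braiding_basis, h1, h2, h3, h4, hxy, hzw, if_true, if_false, map_add, map_smul, hc] <;>
    module

set_option linter.unusedSimpArgs false in
set_option maxHeartbeats 2000000 in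
theorem braiding_braid {K : Type u} [Field K] (m n : ℕ) {q : K} (hq : q ≠ 0) {d : ℕ} {x y z : Fin d} (hxy : x ≠ y)
    (hxz : x ≠ z) (hyz : y ≠ z) :
    braiding m n q x y * braiding m n q y z * braiding m n q x y =
      braiding m n q y z * braiding m n q x y * braiding m n q y z := by
  refine (tensorBasis K (m + n) d).ext fun f => ?_
  simp only [Module.End.mul_apply]
  have s1 : Equiv.swap x y z = z := Equiv.swap_apply_of_ne_of_ne hxz.symm hyz.symm
  have s2 : Equiv.swap y z x = x := Equiv.swap_apply_of_ne_of_ne hxy hxz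
  have hxx : ∀ g : Fin d → Fin (m + n), (g ∘ Equiv.swap x y) ∘ Equiv.swap x y = g := fun g => by
    ext k; simp
  have hyy : ∀ g : Fin d → Fin (m + n), (g ∘ Equiv.swap y z) ∘ Equiv.swap y z = g := fun g => by
    ext k; simp
  have hbr : ((f ∘ Equiv.swap x y) ∘ Equiv.swap y z) ∘ Equiv.swap x y =
      ((f ∘ Equiv.swap y z) ∘ Equiv.swap x y) ∘ Equiv.swap y z := by
    ext k
    simp only [Function.comp_apply, Equiv.swap_apply_def]
    split_ifs <;> simp_all
  have hu : ∀ a b : Fin (m + n), ((-1 : K) ^ (parity m n a * parity m n b)) ^ 2 = 1 := fun a b => by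
    rw [← pow_mul, mul_comm _ 2, pow_mul]; simp
  have hS : ∀ a : Fin (m + n), ((-1 : K) ^ parity m n a * q ^ sign m n a) ^ 2 =
      (q - q⁻¹) * ((-1) ^ parity m n a * q ^ sign m n a) + 1 := fun a => by
    unfold sign parity
    split_ifs <;> simp <;> field_simp <;> ring
  have hc : ∀ a b : Fin (m + n), (-1 : K) ^ (parity m n a * parity m n b) = (-1 : K) ^ (parity m n b * parity m n a) :=
    fun a b => by rw [mul_comm]
  generalize hcc : q - q⁻¹ = c at *
  obtain ⟨u, hub⟩ : ∃ u : Fin (m + n) → Fin (m + n) → K,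
    ∀ a b, (-1 : K) ^ (parity m n a * parity m n b) = u a b := ⟨_, fun _ _ => rfl⟩
  obtain ⟨S, hSb⟩ : ∃ S : Fin (m + n) → K,
    ∀ a, (-1 : K) ^ parity m n a * q ^ sign m n a = S a := ⟨_, fun _ => rfl⟩
  simp only [hub, hSb] at hu hS hc
  rcases lt_trichotomy (f x) (f y) with h1 | h1 | h1 <;>
  rcases lt_trichotomy (f y) (f z) with h2 | h2 | h2 <;>
  rcases lt_trichotomy (f x) (f z) with h3 | h3 | h3 <;>
  first
  | (exfalso; omega)
  | skip
  all_goals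
    first
    | have g1 := h1.ne
      have g1' := h1.ne'
      have k1 := h1.not_gt
    | skip
    first
    | have g2 := h2.ne
      have g2' := h2.ne'
      have k2 := h2.not_gt
    | skip
    first
    | have g3 := h3.ne
      have g3' := h3.ne'
      have k3 := h3.not_gt
    | skip
    simp only [braiding_basis, hcc, Function.comp_apply, Equiv.swap_apply_left, Equiv.swap_apply_right, s1, s2,
      hxx, hyy, hbr, map_add, map_smul, smul_add, smul_smul, if_true, if_false, hub, hSb, *] <;>
    (have v1 := hu (f x) (f y)
     have v2 := hu (f y) (f z)
     have v3 := hu (f x) (f z)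
     have w1 := hS (f x)
     have w2 := hS (f y)
     have w3 := hS (f z)
     clear hxx hyy hbr hu hS hc hub hSb
     match_scalars <;> grind)

theorem quad_of_sq {K : Type u} [Field K] {A : Type u} [Ring A] [Algebra K A] {q : K} (hq : q ≠ 0)
    (t : A) (ht : t * t = (q - q⁻¹) • t + 1) :
    (t + algebraMap K A q⁻¹) * (t - algebraMap K A q) = 0 := by
  have h3 : algebraMap K A q⁻¹ * algebraMap K A q = 1 := by
    rw [← map_mul, inv_mul_cancel₀ hq, map_one]
  rw [add_mul, mul_sub, mul_sub, ht, h3, ← Algebra.commutes, ← Algebra.smul_def,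
    ← Algebra.smul_def]
  module

/-- The left action of `H_d(q²)` on `V^{⊗ d}`: `T_i` acts by `Ř` on the factors `i`, `i + 1`. -/
def heckeAction {K : Type u} [Field K] (m n : ℕ) {q : K} (hq : q ≠ 0) (d : ℕ) :
    FiniteHecke q d →ₐ[K] Module.End K (TensorPower K (m + n) d) :=
  FiniteHecke.lift (fun i => braiding m n q (lower i) (upper i)) fun a b h => by
    cases h with
    | braid i j h =>
      have e : lower j = upper i := Fin.ext h
      rw [e]
      refine braiding_braid m n hq ?_ ?_ ?_ <;> simp [lower, upper, Fin.ext_iff] <;> omega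
    | comm i j h =>
      refine braiding_comm m n q ?_ ?_ ?_ ?_ <;> simp [lower, upper, Fin.ext_iff] <;> omega
    | quad i =>
      exact quad_of_sq (A := Module.End K (TensorPower K (m + n) d)) hq _
        (braiding_sq m n hq (lower i) (upper i))

/-! ### Right modules, induction and the functor

Right modules over an algebra `H` are modules over `Hᵐᵒᵖ`. -/

/-- The relations of the tensor product over `H^a_{d₁}(q²) ⊗ H^a_{d₂}(q²)` in
`H^a_{d₁+d₂}(q²) ⊗ (M₁ ⊗ M₂)`; the homomorphism `H^a_{d₁}(q²) ⊗ H^a_{d₂}(q²) → H^a_{d₁+d₂}(q²)`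
sends `a ⊗ b` to the product of `a` and of `b` shifted by `d₁`. The set of generators is stable
under right multiplication on `H^a_{d₁+d₂}(q²)`. -/
def inductionRelations {K : Type u} [Field K] (q : K) (d₁ d₂ : ℕ) (M₁ M₂ : Type u)
    [AddCommGroup M₁] [Module K M₁] [Module (AffineHecke q d₁)ᵐᵒᵖ M₁]
    [AddCommGroup M₂] [Module K M₂] [Module (AffineHecke q d₂)ᵐᵒᵖ M₂] :
    Submodule (AffineHecke q (d₁ + d₂))ᵐᵒᵖ (AffineHecke q (d₁ + d₂) ⊗[K] (M₁ ⊗[K] M₂)) :=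
  Submodule.span _ {t | ∃ (a : AffineHecke q d₁) (b : AffineHecke q d₂)
    (h : AffineHecke q (d₁ + d₂)) (x : M₁) (y : M₂),
    t = h ⊗ₜ[K] ((MulOpposite.op a • x) ⊗ₜ[K] (MulOpposite.op b • y)) -
      (shiftHom q (show 0 + d₁ ≤ d₁ + d₂ by omega) a * shiftHom q (le_refl (d₁ + d₂)) b * h) ⊗ₜ[K]
        (x ⊗ₜ[K] y)}

/-- The induced (Zelevinsky) product `I^a(M₁, M₂)`, a right `H^a_{d₁+d₂}(q²)`-module: the tensor
product `(M₁ ⊗ M₂) ⊗_{H^a_{d₁} ⊗ H^a_{d₂}} H^a_{d₁+d₂}`, with the two factors written in the other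
order; `H^a_{d₁+d₂}` acts by right multiplication on itself. -/
abbrev Induced {K : Type u} [Field K] (q : K) (d₁ d₂ : ℕ) (M₁ M₂ : Type u)
    [AddCommGroup M₁] [Module K M₁] [Module (AffineHecke q d₁)ᵐᵒᵖ M₁]
    [AddCommGroup M₂] [Module K M₂] [Module (AffineHecke q d₂)ᵐᵒᵖ M₂] : Type u :=
  (AffineHecke q (d₁ + d₂) ⊗[K] (M₁ ⊗[K] M₂)) ⧸ inductionRelations q d₁ d₂ M₁ M₂

/-- The map induced by two homomorphisms of right modules. -/
def Induced.map {K : Type u} [Field K] (q : K) (d₁ d₂ : ℕ) {M₁ M₂ N₁ N₂ : Type u}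
    [AddCommGroup M₁] [Module K M₁] [Module (AffineHecke q d₁)ᵐᵒᵖ M₁]
    [IsScalarTower K (AffineHecke q d₁)ᵐᵒᵖ M₁]
    [AddCommGroup M₂] [Module K M₂] [Module (AffineHecke q d₂)ᵐᵒᵖ M₂]
    [IsScalarTower K (AffineHecke q d₂)ᵐᵒᵖ M₂]
    [AddCommGroup N₁] [Module K N₁] [Module (AffineHecke q d₁)ᵐᵒᵖ N₁]
    [IsScalarTower K (AffineHecke q d₁)ᵐᵒᵖ N₁]
    [AddCommGroup N₂] [Module K N₂] [Module (AffineHecke q d₂)ᵐᵒᵖ N₂]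
    [IsScalarTower K (AffineHecke q d₂)ᵐᵒᵖ N₂]
    (f₁ : M₁ →ₗ[(AffineHecke q d₁)ᵐᵒᵖ] N₁) (f₂ : M₂ →ₗ[(AffineHecke q d₂)ᵐᵒᵖ] N₂) :
    Induced q d₁ d₂ M₁ M₂ →ₗ[(AffineHecke q (d₁ + d₂))ᵐᵒᵖ] Induced q d₁ d₂ N₁ N₂ :=
  Submodule.mapQ _ _
    (TensorProduct.AlgebraTensorModule.map LinearMap.id
      (TensorProduct.map (f₁.restrictScalars K) (f₂.restrictScalars K))) <| by
    rw [inductionRelations, Submodule.span_le]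
    rintro _ ⟨a, b, h, x, y, rfl⟩
    refine Submodule.subset_span ⟨a, b, h, f₁ x, f₂ y, ?_⟩
    simp

/-- The relations of the tensor product over `H_d(q²)` in `M ⊗ V^{⊗ d}`. -/
def balancedRelations {K : Type u} [Field K] (m n : ℕ) {q : K} (hq : q ≠ 0) (d : ℕ) (M : Type u)
    [AddCommGroup M] [Module K M] [Module (AffineHecke q d)ᵐᵒᵖ M] :
    Submodule K (M ⊗[K] TensorPower K (m + n) d) :=
  Submodule.span K {t | ∃ (h : FiniteHecke q d) (x : M) (v : TensorPower K (m + n) d),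
    t = (MulOpposite.op (finiteToAffine q d h) • x) ⊗ₜ[K] v - x ⊗ₜ[K] heckeAction m n hq d h v}

/-- The vector space `M ⊗_{H_d(q²)} V^{⊗ d}` underlying `ℱ(M)`. -/
abbrev SchurWeyl {K : Type u} [Field K] (m n : ℕ) {q : K} (hq : q ≠ 0) (d : ℕ) (M : Type u)
    [AddCommGroup M] [Module K M] [Module (AffineHecke q d)ᵐᵒᵖ M] : Type u :=
  (M ⊗[K] TensorPower K (m + n) d) ⧸ balancedRelations m n hq d M

/-- The map `ℱ(f)` for a homomorphism `f` of right modules. -/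
def SchurWeyl.map {K : Type u} [Field K] (m n : ℕ) {q : K} (hq : q ≠ 0) (d : ℕ) {M N : Type u}
    [AddCommGroup M] [Module K M] [Module (AffineHecke q d)ᵐᵒᵖ M]
    [IsScalarTower K (AffineHecke q d)ᵐᵒᵖ M]
    [AddCommGroup N] [Module K N] [Module (AffineHecke q d)ᵐᵒᵖ N]
    [IsScalarTower K (AffineHecke q d)ᵐᵒᵖ N] (f : M →ₗ[(AffineHecke q d)ᵐᵒᵖ] N) :
    SchurWeyl m n hq d M →ₗ[K] SchurWeyl m n hq d N :=
  Submodule.mapQ _ _ (TensorProduct.map (f.restrictScalars K) LinearMap.id) <| by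
    rw [balancedRelations, Submodule.span_le]
    rintro _ ⟨h, x, v, rfl⟩
    refine Submodule.subset_span ⟨h, f x, v, ?_⟩
    simp

/-! The natural representation `ρ` on `V`, by matrices. -/

/-- `ρ(σ)`. -/
def natSigma (K : Type u) [Field K] (m n : ℕ) : Matrix (Fin (m + n)) (Fin (m + n)) K :=
  Matrix.diagonal fun a => (-1) ^ parity m n a

/-- `ρ(K_γ)`, the diagonal matrix with entries `q ^ (γ, ε_a)`. -/
def natK {K : Type u} [Field K] {m n : ℕ} (q : K) (γ : WeightLattice m n) :
    Matrix (Fin (m + n)) (Fin (m + n)) K :=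
  Matrix.diagonal fun a => q ^ form γ (eps m n a)

/-- `ρ(E_i)` for a vertex `i ≠ 0`. -/
def natE {K : Type u} [Field K] (m n : ℕ) (q : K) (i : Fin (m + n)) :
    Matrix (Fin (m + n)) (Fin (m + n)) K :=
  Matrix.single (prev i) i (q ^ (-sign m n i))

/-- `ρ(F_i)` for a vertex `i ≠ 0`. -/
def natF {K : Type u} [Field K] (m n : ℕ) (q : K) (i : Fin (m + n)) :
    Matrix (Fin (m + n)) (Fin (m + n)) K :=
  Matrix.single i (prev i) (q ^ sign m n i)

/-- `ρ(E_1 E_2 ⋯ E_{m+n-1})`. -/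
def natEProd {K : Type u} [Field K] (m n : ℕ) (q : K) : Matrix (Fin (m + n)) (Fin (m + n)) K :=
  ((List.finRange (m + n)).tail.map (natE m n q)).prod

/-- `ρ(F_{m+n-1} ⋯ F_2 F_1)`. -/
def natFProd {K : Type u} [Field K] (m n : ℕ) (q : K) : Matrix (Fin (m + n)) (Fin (m + n)) K :=
  ((List.finRange (m + n)).tail.reverse.map (natF m n q)).prod

/-- The sum of the simple roots `α_i`, `i ≠ 0`, so that `K_{α_1} ⋯ K_{α_{m+n-1}}` is `K` of it. -/
def finiteRootSum (m n : ℕ) : WeightLattice m n :=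
  ∑ i : Fin (m + n) with i.val ≠ 0, root m n i

/-- The operator `A ⊗ ⋯ ⊗ A ⊗ B ⊗ C ⊗ ⋯ ⊗ C` on `V^{⊗ d}`, with `B` at position `k`. -/
def strand {K : Type u} [Field K] {N d : ℕ} (k : Fin d) (A B C : Matrix (Fin N) (Fin N) K) :
    Module.End K (TensorPower K N d) :=
  PiTensorProduct.map fun l =>
    Matrix.toLin' (if l < k then A else if l = k then B else C)

/-- The operator `A ⊗ ⋯ ⊗ A` on `V^{⊗ d}`. -/
def diagonalOperator {K : Type u} [Field K] {N : ℕ} (d : ℕ) (A : Matrix (Fin N) (Fin N) K) :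
    Module.End K (TensorPower K N d) :=
  PiTensorProduct.map fun _ => Matrix.toLin' A

/-- Right multiplication by `h` on a right module. -/
def rightMul {K : Type u} [Field K] {q : K} {d : ℕ} (M : Type u)
    [AddCommGroup M] [Module K M] [Module (AffineHecke q d)ᵐᵒᵖ M]
    [IsScalarTower K (AffineHecke q d)ᵐᵒᵖ M] (h : AffineHecke q d) : Module.End K M :=
  Algebra.lsmul K K M (MulOpposite.op h)

/-- The formulas for the action of the generators on `ℱ(M)`, written as operators on
`M ⊗ V^{⊗ d}`: `σ`, `K_γ`, and `E_i`, `F_i` for `i ≠ 0` act on `V^{⊗ d}` alone, through the iterated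
comultiplication, while
`E_0 = ∑ⱼ yⱼ⁻¹ ⊗ (σ K_∏⁻¹)^{⊗ (j-1)} ⊗ F_∏ ⊗ 1^{⊗ (d-j)}` and
`F_0 = ∑ⱼ yⱼ ⊗ σ^{⊗ (j-1)} ⊗ E_∏ ⊗ K_∏^{⊗ (d-j)}`. -/
def schurWeylOperator {K : Type u} [Field K] {m n : ℕ} (q : K)
    (Γ : AddSubgroup (WeightLattice m n)) (d : ℕ) (M : Type u)
    [AddCommGroup M] [Module K M] [Module (AffineHecke q d)ᵐᵒᵖ M]
    [IsScalarTower K (AffineHecke q d)ᵐᵒᵖ M] :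
    Gen Γ → Module.End K (M ⊗[K] TensorPower K (m + n) d)
  | .sigma => TensorProduct.map 1 (diagonalOperator d (natSigma K m n))
  | .K γ => TensorProduct.map 1 (diagonalOperator d (natK q γ.1))
  | .E i =>
    if i.val = 0 then
      ∑ j : Fin d, TensorProduct.map (rightMul M (AffineHecke.gen q (.yInv j)))
        (strand j (natSigma K m n * natK q (-finiteRootSum m n)) (natFProd m n q) 1)
    else
      ∑ k : Fin d, TensorProduct.map 1
        (strand k (natSigma K m n ^ nodeParity m n i * natK q (root m n i)) (natE m n q i) 1)
  | .F i =>
    if i.val = 0 then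
      ∑ j : Fin d, TensorProduct.map (rightMul M (AffineHecke.gen q (.y j)))
        (strand j (natSigma K m n) (natEProd m n q) (natK q (finiteRootSum m n)))
    else
      ∑ k : Fin d, TensorProduct.map 1
        (strand k (natSigma K m n ^ nodeParity m n i) (natF m n q i) (natK q (-root m n i)))

/-- `ρ` is the representation `ℱ(M)` of the affine quantum superalgebra on `M ⊗_{H_d(q²)} V^{⊗ d}`,
that is, every generator acts by the formula above. -/
def IsSchurWeylAction {K : Type u} [Field K] {m n : ℕ} {q : K} (hq : q ≠ 0)
    (Γ : AddSubgroup (WeightLattice m n)) (hΓ : ∀ i, root m n i ∈ Γ) (d : ℕ) (M : Type u)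
    [AddCommGroup M] [Module K M] [Module (AffineHecke q d)ᵐᵒᵖ M]
    [IsScalarTower K (AffineHecke q d)ᵐᵒᵖ M]
    (ρ : AffineQuantum q Γ hΓ →ₐ[K] Module.End K (SchurWeyl m n hq d M)) : Prop :=
  ∀ (g : Gen Γ) (w : M ⊗[K] TensorPower K (m + n) d),
    ρ (.gen q Γ hΓ g) (Submodule.Quotient.mk w) =
      Submodule.Quotient.mk (schurWeylOperator q Γ d M g w)

end

end SuperSchurWeyl

open SuperSchurWeyl

/-!
Two facts carry the theorem: the formulas for the action are an iterated comultiplication, and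
the space `ℱ(I^a(M₁, M₂))` can be mapped back to `ℱ(M₁) ⊗ ℱ(M₂)` by letting the affine Hecke algebra
act on Laurent polynomials.

**The action.** `IsRep` says that a family of elements of an algebra satisfies the defining relations
of the quantum superalgebra. If two families satisfy them and commute with each other, then so does
the family formed by the comultiplication (`IsRep.coprod`). The point is the Serre relations: the
two summands of the image of `E_i` skew-commute with the scalars `(-1)^{p(i)p(j)} q^{(α_i, α_j)}`, and
the Serre elements of such a sum are the sums of the Serre elements (`serre_add`). The natural
representation satisfies the relations because its `E_i` and `F_i` are multiples of the matrix units
that run once around the cycle of vertices, so that nearly all products vanish (`isRep_natRep`), and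
it may be twisted by a spectral parameter at the vertex `0` (`IsRep.twist`). Hence for commuting
invertible operators `y_1, …, y_d` on `M` the iterated comultiplication with spectral parameters `y_j`
satisfies the relations on `M ⊗ V^{⊗ d}` (`isRep_iteratedRep`), and these are the operators that
define the functor (`schurWeylOperator_eq`).

These operators descend to `M ⊗_{H_d} V^{⊗ d}`. For a vertex `i ≠ 0` the operators of `E_i` and `F_i` on
`V^{⊗ d}` commute with the braiding (`braiding_comm_E`, `braiding_comm_F`). At the vertex `0` the
braiding only exchanges two neighbouring summands (`braiding_E_zero`, `braiding_F_zero`), which is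
matched by the relation between `T_i` and the lattice elements `y_j^{±1}` (`balanced_of_exchange`). An
action is determined by the images of the generators, hence uniqueness.

**The isomorphism.** The map `(x ⊗ v) ⊗ (y ⊗ w) ↦ (1 ⊗ (x ⊗ y)) ⊗ (v ⊗ w)` from `ℱ(M₁) ⊗ ℱ(M₂)` to
`ℱ(I^a(M₁, M₂))` (`tensorToInduced`) is natural and compatible with the actions, as a comparison of
formulas shows. It is surjective because every element of the affine Hecke algebra is a combination
of products of a Laurent monomial in the `y_j` by a product of `T_i` (`AffineHecke.isNormal`): the
monomial acts on `M₁ ⊗ M₂`, the `T_i` on tensors. No linear independence of these products is used.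
Instead, injectivity comes from a left inverse. The affine Hecke algebra acts on Laurent polynomials
with values in `V^{⊗ (d₁ + d₂)}` from the left, the `T_i` by Demazure-Lusztig operators
`f ⊗ v ↦ s_i f ⊗ T_i v + (q - q⁻¹) D_i f ⊗ v` (`polyAction`). Evaluation of the polynomials at the
commuting operators `y_j` on `M₁ ⊗ M₂`, followed by projection to `ℱ(M₁) ⊗ ℱ(M₂)`, gives a pairing that
is balanced over `H^a_{d₁} ⊗ H^a_{d₂}` (`joint_left`, `joint_right`); this is the Bernstein relation
(`bernstein`). So `(h ⊗ μ) ⊗ v ↦ μ · h (1 ⊗ v)` is well defined on `ℱ(I^a(M₁, M₂))`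
(`exists_inducedToTensor`); it is balanced over `H_{d₁ + d₂}` since `D_i 1 = 0`.
-/

namespace SuperSchurWeyl

noncomputable section

/-! ### Representations given by the images of the generators -/

section Rep
variable {K : Type u} [Field K] {m n : ℕ} {q : K} {Γ : AddSubgroup (WeightLattice m n)}
  {hΓ : ∀ i, root m n i ∈ Γ} {A : Type u} [Ring A] [Algebra K A]

/-- The elements `X g` of the algebra `A` satisfy the defining relations of the affine quantum
superalgebra. -/
structure IsRep (q : K) (Γ : AddSubgroup (WeightLattice m n)) (hΓ : ∀ i, root m n i ∈ Γ)
    (X : Gen Γ → A) : Prop where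
  sigma_sq : X .sigma * X .sigma = 1
  sigma_K (γ : Γ) : X .sigma * X (.K γ) = X (.K γ) * X .sigma
  sigma_E (i : Fin (m + n)) :
    X .sigma * X (.E i) = (-1 : K) ^ nodeParity m n i • (X (.E i) * X .sigma)
  sigma_F (i : Fin (m + n)) :
    X .sigma * X (.F i) = (-1 : K) ^ nodeParity m n i • (X (.F i) * X .sigma)
  K_zero : X (.K 0) = 1
  K_add (γ γ' : Γ) : X (.K γ) * X (.K γ') = X (.K (γ + γ'))
  K_E (γ : Γ) (i : Fin (m + n)) :
    X (.K γ) * X (.E i) = q ^ form γ.1 (root m n i) • (X (.E i) * X (.K γ))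
  K_F (γ : Γ) (i : Fin (m + n)) :
    X (.K γ) * X (.F i) = q ^ (-form γ.1 (root m n i)) • (X (.F i) * X (.K γ))
  E_F_same (i : Fin (m + n)) :
    superBracket (nodeParity m n i) (nodeParity m n i) (X (.E i)) (X (.F i)) =
      (q ^ nodeSign m n i - q ^ (-nodeSign m n i))⁻¹ •
        (X (.K ⟨root m n i, hΓ i⟩) - X (.K (-⟨root m n i, hΓ i⟩)))
  E_F_ne (i j : Fin (m + n)) (h : i ≠ j) :
    superBracket (nodeParity m n i) (nodeParity m n j) (X (.E i)) (X (.F j)) = 0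
  serre_E (z : A) (hz : SerreElement q (fun i => X (.E i)) z) : z = 0
  serre_F (z : A) (hz : SerreElement q (fun i => X (.F i)) z) : z = 0

theorem map_superBracket {B : Type u} [Ring B] [Algebra K B] (f : A →ₐ[K] B) (a b : ℕ) (x y : A) :
    f (superBracket a b x y) = superBracket a b (f x) (f y) := by
  simp [superBracket]

theorem map_quantumBracket {B : Type u} [Ring B] [Algebra K B] (f : A →ₐ[K] B) (a b : ℕ)
    (v w : WeightLattice m n) (x y : A) :
    f (quantumBracket q a b v w x y) = quantumBracket q a b v w (f x) (f y) := by
  simp [quantumBracket]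

theorem SerreElement.map {B : Type u} [Ring B] [Algebra K B] {x : Fin (m + n) → A} {z : A}
    (h : SerreElement q x z) (f : A →ₐ[K] B) : SerreElement q (fun i => f (x i)) (f z) := by
  cases h with
  | orthogonal i j hij h =>
    rw [map_superBracket]; exact .orthogonal (x := fun i => f (x i)) i j hij h
  | odd i hi => rw [map_mul]; exact .odd (x := fun i => f (x i)) i hi
  | cubic i j hi hj =>
    rw [map_quantumBracket, map_quantumBracket]
    exact .cubic (x := fun i => f (x i)) i j hi hj
  | quartic i hi =>
    rw [map_superBracket, map_quantumBracket, map_quantumBracket]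
    exact .quartic (x := fun i => f (x i)) i hi

/-- The relations need only be checked on the images of the generators. -/
theorem IsRep.lift_eq {X : Gen Γ → A} (hX : IsRep q Γ hΓ X) {a b : FreeAlgebra K (Gen Γ)}
    (h : QuantumRel q Γ hΓ a b) : FreeAlgebra.lift K X a = FreeAlgebra.lift K X b := by
  -- the relations carry their signs as elements of the algebra
  have hs : ∀ (k : ℕ) (z : A), (-1 : A) ^ k * z = (-1 : K) ^ k • z := fun k z => by
    rw [Algebra.smul_def]; simp
  cases h with
  | sigma_sq => simpa using hX.sigma_sq
  | sigma_K γ => simpa using hX.sigma_K γ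
  | sigma_E i => simpa [hs] using hX.sigma_E i
  | sigma_F i => simpa [hs] using hX.sigma_F i
  | K_zero => simpa using hX.K_zero
  | K_add γ γ' => simpa using hX.K_add γ γ'
  | K_E γ i => simpa using hX.K_E γ i
  | K_F γ i => simpa using hX.K_F γ i
  | E_F_same i => simpa [map_superBracket] using hX.E_F_same i
  | E_F_ne i j h => simpa [map_superBracket] using hX.E_F_ne i j h
  | serre_E z hz =>
    rw [map_zero]
    exact hX.serre_E _ (by simpa using hz.map (FreeAlgebra.lift K X))
  | serre_F z hz =>
    rw [map_zero]
    exact hX.serre_F _ (by simpa using hz.map (FreeAlgebra.lift K X))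

/-- The homomorphism defined by elements that satisfy the defining relations. -/
def IsRep.toAlgHom {X : Gen Γ → A}
    (h : ∀ a b, QuantumRel q Γ hΓ a b → FreeAlgebra.lift K X a = FreeAlgebra.lift K X b) :
    AffineQuantum q Γ hΓ →ₐ[K] A :=
  RingQuot.liftAlgHom K ⟨FreeAlgebra.lift K X, fun _ _ => h _ _⟩

theorem IsRep.toAlgHom_gen {X : Gen Γ → A}
    (h : ∀ a b, QuantumRel q Γ hΓ a b → FreeAlgebra.lift K X a = FreeAlgebra.lift K X b)
    (g : Gen Γ) : IsRep.toAlgHom h (.gen q Γ hΓ g) = X g :=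
  (RingQuot.liftAlgHom_mkAlgHom_apply K _ _ _).trans (FreeAlgebra.lift_ι_apply _ _)

theorem AffineQuantum.hom_ext {f f' : AffineQuantum q Γ hΓ →ₐ[K] A}
    (h : ∀ g, f (.gen q Γ hΓ g) = f' (.gen q Γ hΓ g)) : f = f' :=
  RingQuot.ringQuot_ext' K f f' (FreeAlgebra.hom_ext (funext h))

end Rep

/-! ### Cartan data -/

section Cartan
variable {m n : ℕ}

theorem form_add_left (v v' w : WeightLattice m n) : form (v + v') w = form v w + form v' w := by
  simp [form, mul_add, add_mul, Finset.sum_add_distrib]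

theorem form_add_right (v w w' : WeightLattice m n) : form v (w + w') = form v w + form v w' := by
  simp [form, mul_add, Finset.sum_add_distrib]

theorem form_neg_left (v w : WeightLattice m n) : form (-v) w = -form v w := by
  simp [form]

theorem form_sub_right (v w w' : WeightLattice m n) : form v (w - w') = form v w - form v w' := by
  simp [form, mul_sub, Finset.sum_sub_distrib]

theorem form_comm (v w : WeightLattice m n) : form v w = form w v := by
  simp only [form]
  exact Finset.sum_congr rfl fun a _ => by ring

theorem form_null_right (v : WeightLattice m n) (c : ℤ) : form v (0, c) = 0 := by
  simp [form]

theorem form_eps (v : WeightLattice m n) (a : Fin (m + n)) :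
    form v (eps m n a) = sign m n a * v.1 a := by
  rw [form, Finset.sum_eq_single a]
  · simp [eps]
  · intro b _ hb
    simp [eps, hb]
  · simp

/-- The pairing of a weight with a simple root. It only sees the coordinates at the two ends of the
vertex, since `δ` lies in the radical; `prev` is cyclic, so that the vertex `0` is no exception. -/
theorem form_root (v : WeightLattice m n) (i : Fin (m + n)) :
    form v (root m n i) = sign m n (prev i) * v.1 (prev i) - sign m n i * v.1 i := by
  rw [root, form_add_right, form_sub_right, form_eps, form_eps, form_null_right, add_zero]

theorem val_prev (i : Fin (m + n)) :
    (prev i).val + 1 = i.val ∨ i.val = 0 ∧ (prev i).val + 1 = m + n := by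
  have := i.isLt
  by_cases h : i.val = 0
  · simp [prev, h, Nat.mod_eq_of_lt (show m + n - 1 < m + n by omega)]
    omega
  · have h' : i.val + (m + n) - 1 = (i.val - 1) + (m + n) := by omega
    simp [prev, h', Nat.mod_eq_of_lt (show i.val - 1 < m + n by omega)]
    omega

theorem val_next (i : Fin (m + n)) :
    (next i).val = i.val + 1 ∧ i.val + 1 < m + n ∨ (next i).val = 0 ∧ i.val + 1 = m + n := by
  have := i.isLt
  by_cases h : i.val + 1 = m + n
  · simp [next, h]
  · simp [next, Nat.mod_eq_of_lt (show i.val + 1 < m + n by omega)]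
    omega

theorem prev_next (i : Fin (m + n)) : prev (next i) = i := by
  have := i.isLt
  have h1 := val_next i
  have h2 := val_prev (next i)
  ext; omega

theorem next_prev (i : Fin (m + n)) : next (prev i) = i := by
  have := i.isLt
  have h1 := val_prev i
  have h2 := val_next (prev i)
  ext; omega

theorem prev_injective : Function.Injective (prev : Fin (m + n) → Fin (m + n)) :=
  Function.LeftInverse.injective next_prev

theorem prev_eq_iff {i j : Fin (m + n)} : prev j = i ↔ j = next i :=
  ⟨fun h => by rw [← h, next_prev], fun h => by rw [h, prev_next]⟩

theorem prev_ne (h : 2 ≤ m) (i : Fin (m + n)) : prev i ≠ i := by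
  have h1 := val_prev i
  intro h; rw [h] at h1; omega

theorem next_ne (h : 2 ≤ m) (i : Fin (m + n)) : next i ≠ i := by
  have h1 := val_next i
  intro h; rw [h] at h1; omega

theorem prev_ne_next (hm : 2 ≤ m) (hn : 2 ≤ n) (i : Fin (m + n)) : prev i ≠ next i := by
  have h1 := val_prev i
  have h2 := val_next i
  intro h; rw [h] at h1; omega

theorem root_apply (i a : Fin (m + n)) :
    (root m n i).1 a = (if a = prev i then 1 else 0) - (if a = i then 1 else 0) := by
  simp [root, eps, Pi.single_apply]

theorem sign_eq (a : Fin (m + n)) : sign m n a = if a.val < m then 1 else -1 := by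
  unfold sign parity; split_ifs <;> simp

theorem nodeSign_eq (hm : 2 ≤ m) (hn : 2 ≤ n) (i : Fin (m + n)) :
    nodeSign m n i = sign m n (prev i) := by
  have := i.isLt
  have h1 := val_prev i
  rw [sign_eq, nodeSign]; split_ifs <;> first | rfl | omega

/-- The form on two simple roots. -/
theorem form_root_root (hm : 2 ≤ m) (hn : 2 ≤ n) (i j : Fin (m + n)) :
    form (root m n i) (root m n j) =
      if i = j then sign m n (prev i) + sign m n i
      else if j = prev i then -sign m n (prev i)
      else if j = next i then -sign m n i else 0 := by
  rw [form_root, root_apply, root_apply]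
  simp only [prev_injective.eq_iff, prev_eq_iff]
  have h1 := prev_ne (n := n) hm i
  have h2 := next_ne (n := n) hm i
  have h3 := prev_ne_next hm hn i
  by_cases h : i = j
  · subst h
    simp [h1.symm, h2.symm]
  · by_cases h4 : j = prev i
    · subst h4
      simp [h1, h1.symm, h3]
    · by_cases h5 : j = next i
      · subst h5
        simp [h2, h2.symm, h3.symm, prev_next]
      · simp [h, h4, h5, Ne.symm h]

theorem nodeParity_eq_zero_or_one (i : Fin (m + n)) :
    nodeParity m n i = 0 ∨ nodeParity m n i = 1 := by
  unfold nodeParity; split_ifs <;> simp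

theorem sign_eq_of_nodeParity_zero (i : Fin (m + n))
    (hi : nodeParity m n i = 0) : sign m n i = sign m n (prev i) := by
  have := i.isLt
  have h1 := val_prev i
  unfold nodeParity at hi
  rw [sign_eq, sign_eq]
  split_ifs at * <;> first | rfl | omega

theorem sign_eq_of_nodeParity_one (hm : 2 ≤ m) (hn : 2 ≤ n) (i : Fin (m + n))
    (hi : nodeParity m n i = 1) : sign m n i = -sign m n (prev i) := by
  have := i.isLt
  have h1 := val_prev i
  unfold nodeParity at hi
  rw [sign_eq, sign_eq]
  split_ifs at * <;> first | rfl | omega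

theorem nodeParity_prev_of_one (hm : 2 ≤ m) (hn : 2 ≤ n) (i : Fin (m + n))
    (hi : nodeParity m n i = 1) : nodeParity m n (prev i) = 0 := by
  have := i.isLt
  have h1 := val_prev i
  unfold nodeParity at *
  split_ifs at * <;> first | rfl | omega

theorem nodeParity_next_of_one (hm : 2 ≤ m) (hn : 2 ≤ n) (i : Fin (m + n))
    (hi : nodeParity m n i = 1) : nodeParity m n (next i) = 0 := by
  have := i.isLt
  have h1 := val_next i
  unfold nodeParity at *
  split_ifs at * <;> first | rfl | omega

end Cartan

/-! ### Serre elements of a sum of two skew-commuting families -/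

section SkewSum
variable {K : Type u} [Field K] {A : Type u} [Ring A] [Algebra K A]

theorem mul_rule {x y : A} {c : K} (h : y * x = c • (x * y)) (z : A) :
    y * (x * z) = c • (x * (y * z)) := by
  rw [← mul_assoc, h, smul_mul_assoc, mul_assoc]

/-- The cubic Serre relation for `a i + b i`, `a j + b j`. -/
theorem cubic_add {t : K} (ht : t ≠ 0) {a₁ a₂ b₁ b₂ : A}
    (h11 : b₁ * a₁ = (t * t) • (a₁ * b₁)) (h12 : b₁ * a₂ = t⁻¹ • (a₂ * b₁))
    (h21 : b₂ * a₁ = t⁻¹ • (a₁ * b₂))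
    (ha : a₁ * (a₁ * a₂ - t • (a₂ * a₁)) - t⁻¹ • ((a₁ * a₂ - t • (a₂ * a₁)) * a₁) = 0)
    (hb : b₁ * (b₁ * b₂ - t • (b₂ * b₁)) - t⁻¹ • ((b₁ * b₂ - t • (b₂ * b₁)) * b₁) = 0) :
    (a₁ + b₁) * ((a₁ + b₁) * (a₂ + b₂) - t • ((a₂ + b₂) * (a₁ + b₁))) -
      t⁻¹ • (((a₁ + b₁) * (a₂ + b₂) - t • ((a₂ + b₂) * (a₁ + b₁))) * (a₁ + b₁)) = 0 := by
  rw [← add_zero (0 : A)]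
  nth_rw 1 [← ha]
  rw [← hb]
  simp only [mul_add, add_mul, mul_sub, sub_mul, mul_assoc, smul_mul_assoc, mul_smul_comm,
    h11, h12, h21, mul_rule h11, mul_rule h12, mul_rule h21, smul_add, smul_sub, smul_smul]
  match_scalars <;> field_simp <;> ring

/-- The quartic Serre relation for `a + b`, the index `2` being the odd vertex. -/
theorem quartic_add {t : K} (ht : t ≠ 0) {a₁ a₂ a₃ b₁ b₂ b₃ : A}
    (h11 : a₂ * a₂ = 0) (h12 : b₂ * b₂ = 0) (hb13 : b₃ * b₁ = b₁ * b₃)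
    (h21 : b₂ * a₁ = t • (a₁ * b₂)) (h12' : b₁ * a₂ = t • (a₂ * b₁))
    (h22 : b₂ * a₂ = (-1 : K) • (a₂ * b₂))
    (h23 : b₂ * a₃ = t⁻¹ • (a₃ * b₂)) (h32 : b₃ * a₂ = t⁻¹ • (a₂ * b₃))
    (h13 : b₁ * a₃ = a₃ * b₁) (h31 : b₃ * a₁ = a₁ * b₃)
    (ha : ((a₁ * a₂ - t⁻¹ • (a₂ * a₁)) * a₃ - t • (a₃ * (a₁ * a₂ - t⁻¹ • (a₂ * a₁)))) * a₂ +
      a₂ * ((a₁ * a₂ - t⁻¹ • (a₂ * a₁)) * a₃ - t • (a₃ * (a₁ * a₂ - t⁻¹ • (a₂ * a₁)))) = 0)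
    (hb : ((b₁ * b₂ - t⁻¹ • (b₂ * b₁)) * b₃ - t • (b₃ * (b₁ * b₂ - t⁻¹ • (b₂ * b₁)))) * b₂ +
      b₂ * ((b₁ * b₂ - t⁻¹ • (b₂ * b₁)) * b₃ - t • (b₃ * (b₁ * b₂ - t⁻¹ • (b₂ * b₁)))) = 0) :
    (((a₁ + b₁) * (a₂ + b₂) - t⁻¹ • ((a₂ + b₂) * (a₁ + b₁))) * (a₃ + b₃) -
        t • ((a₃ + b₃) * ((a₁ + b₁) * (a₂ + b₂) - t⁻¹ • ((a₂ + b₂) * (a₁ + b₁))))) * (a₂ + b₂) +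
      (a₂ + b₂) * (((a₁ + b₁) * (a₂ + b₂) - t⁻¹ • ((a₂ + b₂) * (a₁ + b₁))) * (a₃ + b₃) -
        t • ((a₃ + b₃) * ((a₁ + b₁) * (a₂ + b₂) - t⁻¹ • ((a₂ + b₂) * (a₁ + b₁))))) = 0 := by
  have e1 : ∀ z, a₂ * (a₂ * z) = 0 := fun z => by rw [← mul_assoc, h11, zero_mul]
  have e2 : ∀ z, b₂ * (b₂ * z) = 0 := fun z => by rw [← mul_assoc, h12, zero_mul]
  have e3 : ∀ z, b₃ * (b₁ * z) = b₁ * (b₃ * z) := fun z => by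
    rw [← mul_assoc, hb13, mul_assoc]
  have e4 : ∀ z, b₁ * (a₃ * z) = a₃ * (b₁ * z) := fun z => by
    rw [← mul_assoc, h13, mul_assoc]
  have e5 : ∀ z, b₃ * (a₁ * z) = a₁ * (b₃ * z) := fun z => by
    rw [← mul_assoc, h31, mul_assoc]
  rw [← add_zero (0 : A)]
  nth_rw 1 [← ha]
  rw [← hb]
  simp only [mul_add, add_mul, mul_sub, sub_mul, mul_assoc, smul_mul_assoc, mul_smul_comm,
    h11, h12, hb13, h21, h12', h22, h23, h32, h13, h31, mul_rule h21, mul_rule h12', mul_rule h22,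
    mul_rule h23, mul_rule h32, e1, e2, e3, e4, e5, smul_add, smul_sub, smul_smul, smul_zero,
    mul_zero]
  match_scalars <;> field_simp <;> ring

variable {m n : ℕ} {q : K}

theorem superBracket_eq (a b : ℕ) (x y : A) :
    superBracket a b x y = x * y - (-1 : K) ^ (a * b) • (y * x) := by
  rw [superBracket, Algebra.smul_def]; simp

/-- The scalar by which the two tensor factors skew-commute: `(-1)^{p(i)p(j)} q^{(α_i, α_j)}`. -/
def skew (q : K) (i j : Fin (m + n)) : K :=
  (-1) ^ (nodeParity m n i * nodeParity m n j) * q ^ form (root m n i) (root m n j)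

/-- The sum of two skew-commuting families satisfies the Serre relations if both families do: this
is the fact that the Serre elements are skew-primitive for the comultiplication. -/
theorem serre_add (hq : q ≠ 0) (hm : 2 ≤ m) (hn : 2 ≤ n) {a b : Fin (m + n) → A}
    (hab : ∀ i j, b i * a j = skew q i j • (a j * b i))
    (ha : ∀ z, SerreElement q a z → z = 0) (hb : ∀ z, SerreElement q b z → z = 0)
    (z : A) (hz : SerreElement q (fun i => a i + b i) z) : z = 0 := by
  cases hz with
  | orthogonal i j hij h =>
    have h1 := ha _ (.orthogonal i j hij h)
    have h2 := hb _ (.orthogonal i j hij h)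
    have h3 := hab i j
    have h4 := hab j i
    rw [skew, h] at h3
    rw [skew, form_comm, h, mul_comm (nodeParity m n j)] at h4
    rw [superBracket_eq (K := K)] at *
    set s : K := (-1) ^ (nodeParity m n i * nodeParity m n j) with hs
    have hss : s * s = 1 := by rw [hs, ← mul_pow]; simp
    rw [← add_zero (0 : A)]
    nth_rw 1 [← h1]
    rw [← h2]
    simp only [zpow_zero, mul_one] at h3 h4
    simp only [mul_add, add_mul, h3, h4, smul_add, smul_smul, hss]
    module
  | odd i hi =>
    have h1 := ha _ (.odd i hi)
    have h2 := hb _ (.odd i hi)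
    have h3 := hab i i
    have h0 : form (root m n i) (root m n i) = 0 := by
      rw [form_root_root hm hn, if_pos rfl, sign_eq_of_nodeParity_one hm hn i hi]; ring
    rw [skew, hi, h0] at h3
    simp only [mul_add, add_mul, h1, h2, h3]
    simp
  | cubic i j hi hj =>
    have hs := sign_eq_of_nodeParity_zero i hi
    have hii : form (root m n i) (root m n i) = 2 * sign m n i := by
      rw [form_root_root hm hn, if_pos rfl, ← hs]; ring
    have hij : form (root m n i) (root m n j) = -sign m n i := by
      rw [form_root_root hm hn]
      rcases hj with rfl | rfl
      · rw [if_neg (prev_ne hm i).symm, if_pos rfl, ← hs]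
      · rw [if_neg (next_ne hm i).symm, if_neg (prev_ne_next hm hn i).symm, if_pos rfl]
    have h1 := ha _ (.cubic i j hi hj)
    have h2 := hb _ (.cubic i j hi hj)
    have h3 := hab i i
    have h4 := hab i j
    have h5 := hab j i
    rw [skew, form_comm, hij] at h5
    rw [skew, hii] at h3
    rw [skew, hij] at h4
    have e1 : form (root m n i) (root m n i + root m n j) = sign m n i := by
      rw [form_add_right, hii, hij]; ring
    simp only [quantumBracket, hi, e1, hij, zero_mul, mul_zero, pow_zero, one_mul,
      neg_neg, zpow_neg, two_mul, zpow_add₀ hq] at *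
    exact cubic_add (zpow_ne_zero _ hq) h3 h4 h5 h1 h2
  | quartic i hi =>
    have hs := sign_eq_of_nodeParity_one hm hn i hi
    have hp := nodeParity_prev_of_one hm hn i hi
    have hx := nodeParity_next_of_one hm hn i hi
    have n1 := prev_ne (n := n) hm i
    have n2 := next_ne (n := n) hm i
    have n3 := prev_ne_next hm hn i
    have hii : form (root m n i) (root m n i) = 0 := by
      rw [form_root_root hm hn, if_pos rfl, hs]; ring
    have hip : form (root m n i) (root m n (prev i)) = sign m n i := by
      rw [form_root_root hm hn, if_neg n1.symm, if_pos rfl, hs]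
    have hix : form (root m n i) (root m n (next i)) = -sign m n i := by
      rw [form_root_root hm hn, if_neg n2.symm, if_neg n3.symm, if_pos rfl]
    have hpx : form (root m n (prev i)) (root m n (next i)) = 0 := by
      have h1 := val_prev i
      have h2 := val_next i
      have h3 := val_prev (prev i)
      rw [form_root_root hm hn, if_neg n3, if_neg, if_neg]
      · rw [next_prev]; exact n2
      · intro h; rw [← h] at h3; omega
    have hpi := (form_comm (root m n (prev i)) (root m n i)).trans hip
    have hxi := (form_comm (root m n (next i)) (root m n i)).trans hix
    have hxp := (form_comm (root m n (next i)) (root m n (prev i))).trans hpx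
    have h1 := ha _ (.quartic i hi)
    have h2 := hb _ (.quartic i hi)
    have ho := hb _ (.orthogonal (prev i) (next i) n3 hpx)
    have hoa := ha _ (.odd i hi)
    have hob := hb _ (.odd i hi)
    have r1 := hab i (prev i)
    have r2 := hab (prev i) i
    have r3 := hab i i
    have r4 := hab i (next i)
    have r5 := hab (next i) i
    have r6 := hab (prev i) (next i)
    have r7 := hab (next i) (prev i)
    simp only [superBracket_eq (K := K), quantumBracket, skew, hi, hp, hx, form_add_left, hii, hip,
      hix, hpx, hpi, hxi, hxp, mul_zero, add_zero, zero_add, pow_zero, one_mul, mul_one,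
      neg_neg, zpow_neg, zpow_zero, pow_one, one_smul] at *
    have h1' := quartic_add (zpow_ne_zero _ hq) hoa hob (sub_eq_zero.mp ho).symm r1 r2 r3 r4 r5 r6 r7
      (by simpa using h1) (by simpa using h2)
    simpa using h1'

end SkewSum

/-! ### The comultiplication on commuting representations -/

section Coproduct
variable {K : Type u} [Field K] {m n : ℕ} {q : K} {Γ : AddSubgroup (WeightLattice m n)}
  {hΓ : ∀ i, root m n i ∈ Γ} {A : Type u} [Ring A] [Algebra K A]

/-- The images of the generators under the comultiplication, for two families `X`, `Y` in one
algebra; a tensor product of representations is the case where `X` and `Y` act on different tensor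
factors. -/
def coprod (hΓ : ∀ i, root m n i ∈ Γ) (X Y : Gen Γ → A) : Gen Γ → A
  | .sigma => X .sigma * Y .sigma
  | .K γ => X (.K γ) * Y (.K γ)
  | .E i => X (.E i) + X (.K ⟨root m n i, hΓ i⟩) * X .sigma ^ nodeParity m n i * Y (.E i)
  | .F i => X (.F i) * Y (.K (-⟨root m n i, hΓ i⟩)) + X .sigma ^ nodeParity m n i * Y (.F i)

theorem IsRep.sigma_pow_K {X : Gen Γ → A} (hX : IsRep q Γ hΓ X) (k : ℕ) (γ : Γ) :
    X .sigma ^ k * X (.K γ) = X (.K γ) * X .sigma ^ k :=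
  (Commute.pow_left (hX.sigma_K γ) k)

theorem IsRep.sigma_pow_E {X : Gen Γ → A} (hX : IsRep q Γ hΓ X) (k : ℕ) (i : Fin (m + n)) :
    X .sigma ^ k * X (.E i) = (-1 : K) ^ (k * nodeParity m n i) • (X (.E i) * X .sigma ^ k) := by
  induction k with
  | zero => simp
  | succ k ih =>
    rw [pow_succ, mul_assoc, hX.sigma_E, mul_smul_comm, ← mul_assoc, ih, smul_mul_assoc, smul_smul,
      mul_assoc, add_mul, one_mul, pow_add, mul_comm ((-1 : K) ^ _)]

theorem IsRep.sigma_pow_F {X : Gen Γ → A} (hX : IsRep q Γ hΓ X) (k : ℕ) (i : Fin (m + n)) :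
    X .sigma ^ k * X (.F i) = (-1 : K) ^ (k * nodeParity m n i) • (X (.F i) * X .sigma ^ k) := by
  induction k with
  | zero => simp
  | succ k ih =>
    rw [pow_succ, mul_assoc, hX.sigma_F, mul_smul_comm, ← mul_assoc, ih, smul_mul_assoc, smul_smul,
      mul_assoc, add_mul, one_mul, pow_add, mul_comm ((-1 : K) ^ _)]

theorem IsRep.K_comm {X : Gen Γ → A} (hX : IsRep q Γ hΓ X) (γ γ' : Γ) :
    X (.K γ) * X (.K γ') = X (.K γ') * X (.K γ) := by
  rw [hX.K_add, hX.K_add, add_comm]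

theorem neg_one_pow_mul_self (k : ℕ) : (-1 : K) ^ k * (-1) ^ k = 1 := by
  rw [← mul_pow]; simp

/-- The Serre relations are preserved when each element is multiplied by a factor that commutes with
all elements and factors. -/
theorem SerreElement.scale {x c : Fin (m + n) → A} (hcx : ∀ i j, c i * x j = x j * c i)
    (hcc : ∀ i j, c i * c j = c j * c i) (hx : ∀ z, SerreElement q x z → z = 0)
    (z : A) (hz : SerreElement q (fun i => c i * x i) z) : z = 0 := by
  have hxc : ∀ i j z, x i * (c j * z) = c j * (x i * z) := fun i j z => by
    rw [← mul_assoc, ← hcx, mul_assoc]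
  have hq : ∀ (a b : ℕ) (v w : WeightLattice m n) (c c' x x' : A), c * c' = c' * c →
      x * c' = c' * x → c * x' = x' * c → quantumBracket q a b v w (c * x) (c' * x') =
        (c * c') * quantumBracket q a b v w x x' := by
    intro a b v w c c' x x' h1 h2 h3
    simp only [quantumBracket, mul_sub, mul_smul_comm]
    congr 1
    · rw [mul_assoc, ← mul_assoc x, h2]; simp only [mul_assoc]
    · rw [mul_assoc, ← mul_assoc x', ← h3, ← mul_assoc, ← mul_assoc, ← h1]
      simp only [mul_assoc]
  have hs : ∀ (a b : ℕ) (c c' x x' : A), c * c' = c' * c →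
      x * c' = c' * x → c * x' = x' * c → superBracket a b (c * x) (c' * x') =
        (c * c') * superBracket a b x x' := by
    intro a b c c' x x' h1 h2 h3
    simp only [superBracket_eq (K := K), mul_sub, mul_smul_comm]
    congr 1
    · rw [mul_assoc, ← mul_assoc x, h2]; simp only [mul_assoc]
    · rw [mul_assoc, ← mul_assoc x', ← h3, ← mul_assoc, ← mul_assoc, ← h1]
      simp only [mul_assoc]
  have hc : ∀ i j, Commute (c i) (x j) := hcx
  have hc' : ∀ i j, Commute (c i) (c j) := hcc
  have hb : ∀ (c : A) (a b : ℕ) (v w : WeightLattice m n) (x x' : A), Commute c x → Commute c x' →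
      Commute c (quantumBracket q a b v w x x') := fun c a b v w x x' h1 h2 =>
    (h1.mul_right h2).sub_right ((h2.mul_right h1).smul_right _)
  cases hz with
  | orthogonal i j hij h =>
    rw [hs _ _ _ _ _ _ (hcc i j) (hcx j i).symm (hcx i j), hx _ (.orthogonal i j hij h), mul_zero]
  | odd i hi =>
    rw [mul_assoc, hxc, hx _ (.odd i hi), mul_zero, mul_zero]
  | cubic i j hi hj =>
    rw [hq _ _ _ _ _ _ _ _ (hcc i j) (hcx j i).symm (hcx i j),
      hq _ _ _ _ _ _ _ _ ((hc' i i).mul_right (hc' i j))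
        ((hc i i).mul_left (hc j i)).symm (hb _ _ _ _ _ _ _ (hc i i) (hc i j)),
      hx _ (.cubic i j hi hj), mul_zero]
  | quartic i hi =>
    rw [hq _ _ _ _ _ _ _ _ (hcc _ _) (hcx _ _).symm (hcx _ _),
      hq _ _ _ _ _ _ _ _ ((hc' _ _).mul_left (hc' _ _))
        (hb _ _ _ _ _ _ _ (hc _ _) (hc _ _)).symm ((hc _ _).mul_left (hc _ _)),
      hs _ _ _ _ _ _ (((hc' _ _).mul_left (hc' _ _)).mul_left (hc' _ _))
        (hb _ _ _ _ _ _ _ (hb _ _ _ _ _ _ _ (hc _ _) (hc _ _)) (hc _ _)).symm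
        (((hc _ _).mul_left (hc _ _)).mul_left (hc _ _)),
      hx _ (.quartic i hi), mul_zero]

/-- The comultiplication respects the defining relations. -/
theorem IsRep.coprod (hq : q ≠ 0) (hm : 2 ≤ m) (hn : 2 ≤ n) {X Y : Gen Γ → A}
    (hX : IsRep q Γ hΓ X) (hY : IsRep q Γ hΓ Y) (hXY : ∀ g h, Commute (X g) (Y h)) :
    IsRep q Γ hΓ (coprod hΓ X Y) := by
  have c1 : ∀ g h, Y h * X g = X g * Y h := fun g h => (hXY g h).symm
  have c2 : ∀ g h z, Y h * (X g * z) = X g * (Y h * z) := fun g h z => by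
    rw [← mul_assoc, c1, mul_assoc]
  have c3 : ∀ (k : ℕ) h, Y h * X .sigma ^ k = X .sigma ^ k * Y h := fun k h =>
    ((hXY .sigma h).pow_left k).symm
  have c4 : ∀ (k : ℕ) h z, Y h * (X .sigma ^ k * z) = X .sigma ^ k * (Y h * z) := fun k h z => by
    rw [← mul_assoc, c3, mul_assoc]
  have σX : ∀ k (x : A), X .sigma * (X .sigma ^ k * x) = X .sigma ^ k * (X .sigma * x) :=
    fun k x => by rw [← mul_assoc, ← pow_succ', pow_succ, mul_assoc]
  have key : ∀ i j, superBracket (nodeParity m n i) (nodeParity m n j)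
      (SuperSchurWeyl.coprod hΓ X Y (.E i)) (SuperSchurWeyl.coprod hΓ X Y (.F j)) =
      superBracket (nodeParity m n i) (nodeParity m n j) (X (.E i)) (X (.F j)) *
        Y (.K (-⟨root m n j, hΓ j⟩)) +
      X (.K ⟨root m n i, hΓ i⟩) * (X .sigma ^ nodeParity m n j * X .sigma ^ nodeParity m n i) *
        superBracket (nodeParity m n i) (nodeParity m n j) (Y (.E i)) (Y (.F j)) := by
    intro i j
    have e1 := hY.K_E (-⟨root m n j, hΓ j⟩) i
    have e2 := hX.K_F ⟨root m n i, hΓ i⟩ j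
    have e3 := hX.sigma_pow_F (nodeParity m n i) j
    have e4 := hX.sigma_pow_E (nodeParity m n j) i
    have e5 := hX.sigma_pow_K (nodeParity m n j) ⟨root m n i, hΓ i⟩
    have e6 : ∀ z, X .sigma ^ nodeParity m n j * (X (.K ⟨root m n i, hΓ i⟩) * z) =
        X (.K ⟨root m n i, hΓ i⟩) * (X .sigma ^ nodeParity m n j * z) := fun z => by
      rw [← mul_assoc, e5, mul_assoc]
    have e7 : ∀ z, X .sigma ^ nodeParity m n i * (X .sigma ^ nodeParity m n j * z) =
        X .sigma ^ nodeParity m n j * (X .sigma ^ nodeParity m n i * z) := fun z => by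
      rw [← mul_assoc, ← pow_add, add_comm, pow_add, mul_assoc]
    have e8 : form (-root m n j) (root m n i) = -form (root m n i) (root m n j) := by
      rw [form_neg_left, form_comm]
    simp only [NegMemClass.coe_neg, e8] at e1 e2
    simp only [SuperSchurWeyl.coprod, superBracket_eq (K := K), mul_assoc, c2, c1, c4, mul_add,
      add_mul, mul_sub, sub_mul, e1, mul_rule e2, mul_rule e3, mul_rule e4, e6, e7,
      mul_smul_comm, smul_mul_assoc, smul_smul, smul_add]
    have hs := neg_one_pow_mul_self (K := K) (nodeParity m n i * nodeParity m n j)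
    rw [mul_comm (nodeParity m n j) (nodeParity m n i), hs]
    module
  constructor
  · simp only [SuperSchurWeyl.coprod, mul_assoc, c2, hY.sigma_sq, mul_one, hX.sigma_sq]
  · intro γ
    simp only [SuperSchurWeyl.coprod, mul_assoc, c2, hY.sigma_K]
    rw [← mul_assoc, hX.sigma_K, mul_assoc]
  · intro i
    simp only [SuperSchurWeyl.coprod, mul_assoc, c2, c1, c4, mul_add, add_mul, hY.sigma_E,
      mul_smul_comm, smul_add, mul_rule (hX.sigma_E i)]
    congr 2
    rw [← mul_assoc, hX.sigma_K, mul_assoc, σX]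
  · intro i
    simp only [SuperSchurWeyl.coprod, mul_assoc, c2, c4, mul_add, add_mul, hY.sigma_F,
      mul_smul_comm, smul_add, mul_rule (hX.sigma_F i), σX, hY.sigma_K]
  · simp only [SuperSchurWeyl.coprod, hX.K_zero, hY.K_zero, mul_one]
  · intro γ γ'
    simp only [SuperSchurWeyl.coprod, mul_assoc, c2, hY.K_add]
    rw [← mul_assoc, hX.K_add]
  · intro γ i
    simp only [SuperSchurWeyl.coprod, mul_assoc, c2, c1, c4, mul_add, add_mul, hY.K_E,
      mul_smul_comm, smul_add, mul_rule (hX.K_E γ i)]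
    congr 2
    rw [← mul_assoc, hX.K_comm, mul_assoc, ← mul_assoc (X (.K γ)), ← hX.sigma_pow_K, mul_assoc]
  · intro γ i
    simp only [SuperSchurWeyl.coprod, mul_assoc, c2, c4, mul_add, add_mul, hY.K_F,
      mul_smul_comm, smul_add, mul_rule (hX.K_F γ i), hY.K_comm γ]
    congr 2
    rw [← mul_assoc, ← hX.sigma_pow_K, mul_assoc]
  · intro i
    have hσ : X .sigma ^ nodeParity m n i * X .sigma ^ nodeParity m n i = 1 := by
      rw [← pow_add, ← two_mul, pow_mul, pow_two, hX.sigma_sq, one_pow]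
    rw [key, hX.E_F_same, hY.E_F_same, hσ]
    simp only [SuperSchurWeyl.coprod, smul_mul_assoc, mul_smul_comm, ← smul_add, mul_one, sub_mul,
      mul_sub]
    congr 1
    abel
  · intro i j hij
    rw [key, hX.E_F_ne i j hij, hY.E_F_ne i j hij, zero_mul, mul_zero, add_zero]
  · intro z hz
    refine serre_add hq hm hn (a := fun i => X (.E i))
      (b := fun i => X (.K ⟨root m n i, hΓ i⟩) * X .sigma ^ nodeParity m n i * Y (.E i)) ?_
      hX.serre_E ?_ z hz
    · intro i j
      simp only [mul_assoc, c1]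
      rw [mul_rule (hX.sigma_pow_E _ j), mul_smul_comm, mul_rule (hX.K_E _ j), smul_smul, skew]
    · refine SerreElement.scale ?_ ?_ hY.serre_E
      · intro i j
        simp only [mul_assoc, c2, c3]
      · intro i j
        exact (Commute.mul_left (Commute.mul_right (hX.K_comm _ _) (hX.sigma_pow_K _ _).symm)
          (Commute.mul_right (hX.sigma_pow_K _ _) (Commute.pow_pow (Commute.refl _) _ _)))
  · intro z hz
    refine serre_add hq hm hn (a := fun i => X .sigma ^ nodeParity m n i * Y (.F i))
      (b := fun i => X (.F i) * Y (.K (-⟨root m n i, hΓ i⟩))) ?_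
      ?_ ?_ z (by simpa only [SuperSchurWeyl.coprod, add_comm] using hz)
    · intro i j
      simp only [mul_assoc, c2, c4]
      rw [hY.K_F, mul_rule (hX.sigma_pow_F _ i)]
      simp only [mul_smul_comm, smul_smul, skew, NegMemClass.coe_neg, form_neg_left, neg_neg]
      rw [mul_comm (nodeParity m n j), mul_right_comm, neg_one_pow_mul_self, one_mul]
    · refine SerreElement.scale ?_ ?_ hY.serre_F
      · intro i j
        simp only [c3]
      · intro i j
        exact (Commute.pow_pow (Commute.refl _) _ _)
    · intro z hz
      refine SerreElement.scale (c := fun i => Y (.K (-⟨root m n i, hΓ i⟩))) ?_ ?_ hX.serre_F z ?_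
      · intro i j
        simp only [c1]
      · intro i j
        exact hY.K_comm _ _
      · simpa only [c1] using hz

end Coproduct

/-! ### The natural representation and its evaluations -/

section Natural
variable {K : Type u} [Field K] {m n : ℕ} {q : K}

/-- A product of the `E_i` over consecutive vertices is a multiple of a matrix unit, and the product of
the `F_i` in the reverse order is the inverse multiple of the transposed matrix unit. -/
theorem natE_natF_prod (hq : q ≠ 0) (l : List (Fin (m + n))) (hl : l ≠ [])
    (hc : l.IsChain fun x y => prev y = x) :
    ∃ c : K, c ≠ 0 ∧ (l.map (natE m n q)).prod = Matrix.single (prev (l.head hl)) (l.getLast hl) c ∧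
      (l.reverse.map (natF m n q)).prod = Matrix.single (l.getLast hl) (prev (l.head hl)) c⁻¹ := by
  induction l with
  | nil => exact absurd rfl hl
  | cons a l ih =>
    rcases l with _ | ⟨b, l⟩
    · exact ⟨q ^ (-sign m n a), zpow_ne_zero _ hq, by simp [natE], by simp [natF]⟩
    · rw [List.isChain_cons_cons] at hc
      obtain ⟨c, hc0, h1, h2⟩ := ih (by simp) hc.2
      refine ⟨q ^ (-sign m n a) * c, mul_ne_zero (zpow_ne_zero _ hq) hc0, ?_, ?_⟩
      · rw [List.map_cons, List.prod_cons, h1]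
        simp only [List.head_cons, hc.1, natE, List.getLast_cons_cons]
        rw [Matrix.single_mul_single_same]
      · rw [List.reverse_cons, List.map_append, List.prod_append, h2]
        simp only [List.head_cons, hc.1, natF, List.getLast_cons_cons, List.map_cons, List.map_nil,
          List.prod_cons, List.prod_nil, mul_one]
        rw [Matrix.single_mul_single_same, mul_inv, zpow_neg, inv_inv, mul_comm]

/-- The operators of the vertex `0` are proportional to matrix units, with inverse coefficients. -/
theorem natEProd_natFProd (hq : q ≠ 0) (hm : 2 ≤ m) (i : Fin (m + n)) (hi : i.val = 0) :
    ∃ c : K, c ≠ 0 ∧ natEProd m n q = Matrix.single i (prev i) c ∧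
      natFProd m n q = Matrix.single (prev i) i c⁻¹ := by
  have hl : (List.finRange (m + n)).tail ≠ [] := by
    rw [← List.length_pos_iff, List.length_tail, List.length_finRange]; omega
  obtain ⟨c, hc, h1, h2⟩ := natE_natF_prod (m := m) (n := n) hq _ hl (by
    rw [List.isChain_iff_getElem]
    intro k hk
    have hk' : k + 1 + 1 < m + n := by
      rw [List.length_tail, List.length_finRange] at hk; omega
    simp only [List.getElem_tail, List.getElem_finRange]
    have := val_prev (⟨k + 1 + 1, hk'⟩ : Fin (m + n))
    rw [show (⟨k + 1 + 1, hk'⟩ : Fin (m + n)).val = k + 1 + 1 from rfl] at this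
    refine Fin.ext ?_
    change (prev (⟨k + 1 + 1, hk'⟩ : Fin (m + n))).val = k + 1
    omega)
  have e1 : prev ((List.finRange (m + n)).tail.head hl) = i := by
    rw [List.head_eq_getElem, List.getElem_tail, List.getElem_finRange]
    have := val_prev (⟨1, by omega⟩ : Fin (m + n))
    ext
    simp at this ⊢
    omega
  have e2 : (List.finRange (m + n)).tail.getLast hl = prev i := by
    rw [List.getLast_eq_getElem, List.getElem_tail, List.getElem_finRange]
    have := val_prev i
    ext
    simp
    omega
  rw [e1, e2] at h1 h2
  exact ⟨c, hc, h1, h2⟩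

/-- The matrices of the generators on `V`, the vertex `0` acting at the parameter `1`. -/
def natRep (q : K) (Γ : AddSubgroup (WeightLattice m n)) :
    Gen Γ → Matrix (Fin (m + n)) (Fin (m + n)) K
  | .sigma => natSigma K m n
  | .K γ => natK q γ.1
  | .E i => if i.val = 0 then natFProd m n q else natE m n q i
  | .F i => if i.val = 0 then natEProd m n q else natF m n q i

/-- At every vertex, the vertex `0` included, `E_i` and `F_i` are inverse multiples of the matrix units
between the two ends of the vertex. -/
theorem natRep_E_F (hq : q ≠ 0) (hm : 2 ≤ m) (Γ : AddSubgroup (WeightLattice m n))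
    (i : Fin (m + n)) : ∃ c : K, c ≠ 0 ∧ natRep q Γ (.E i) = Matrix.single (prev i) i c ∧
      natRep q Γ (.F i) = Matrix.single i (prev i) c⁻¹ := by
  by_cases hi : i.val = 0
  · obtain ⟨c, hc, h1, h2⟩ := natEProd_natFProd (m := m) (n := n) hq hm i hi
    exact ⟨c⁻¹, inv_ne_zero hc, by simp only [natRep, if_pos hi, h2],
      by simp only [natRep, if_pos hi, h1, inv_inv]⟩
  · exact ⟨q ^ (-sign m n i), zpow_ne_zero _ hq, by simp only [natRep, if_neg hi, natE],
      by simp only [natRep, if_neg hi, natF, zpow_neg, inv_inv]⟩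

theorem parity_prev (hm : 2 ≤ m) (hn : 2 ≤ n) (i : Fin (m + n)) :
    (-1 : K) ^ parity m n (prev i) = (-1) ^ nodeParity m n i * (-1) ^ parity m n i := by
  have := i.isLt
  have h1 := val_prev i
  unfold parity nodeParity
  split_ifs <;> first | (exfalso; omega) | norm_num

theorem form_eps_prev (γ : WeightLattice m n) (i : Fin (m + n)) :
    form γ (eps m n (prev i)) = form γ (root m n i) + form γ (eps m n i) := by
  rw [form_root, form_eps, form_eps]; ring

theorem diagonal_mul_single (d : Fin (m + n) → K) (i j : Fin (m + n)) (c : K) :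
    Matrix.diagonal d * Matrix.single i j c = Matrix.single i j (d i * c) := by
  ext a b
  rw [Matrix.diagonal_mul, Matrix.single_apply, Matrix.single_apply]
  split_ifs with h
  · rw [h.1]
  · rw [mul_zero]

theorem single_mul_diagonal (d : Fin (m + n) → K) (i j : Fin (m + n)) (c : K) :
    Matrix.single i j c * Matrix.diagonal d = Matrix.single i j (c * d j) := by
  ext a b
  rw [Matrix.mul_diagonal, Matrix.single_apply, Matrix.single_apply]
  split_ifs with h
  · rw [h.2]
  · rw [zero_mul]

/-- If all products of two elements vanish except for consecutive vertices, then the Serre relations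
hold because each monomial in them vanishes. -/
theorem serre_of_step (hm : 2 ≤ m) (hn : 2 ≤ n) {A : Type u} [Ring A] [Algebra K A]
    {s : Fin (m + n) → Fin (m + n)} {x : Fin (m + n) → A} (hs : s = next ∨ s = prev)
    (hx : ∀ i j, j ≠ s i → x i * x j = 0) (z : A) (hz : SerreElement q x z) : z = 0 := by
  have h0 : ∀ i j z, j ≠ s i → x i * (x j * z) = 0 := fun i j z h => by
    rw [← mul_assoc, hx i j h, zero_mul]
  have hs1 : ∀ i, i ≠ s i := fun i => by
    rcases hs with rfl | rfl
    exacts [(next_ne hm i).symm, (prev_ne hm i).symm]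
  have hs2 : ∀ i j, j = s i → j = next i ∨ i = next j := fun i j h => by
    rcases hs with rfl | rfl
    · exact .inl h
    · rw [h, next_prev]; exact .inr rfl
  have hs4 : ∀ a b c d, b = s a → c = s b → d = s c → a ≠ b ∧ a ≠ c ∧ a ≠ d ∧ b ≠ d ∧ c ≠ d := by
    intro a b c d h1 h2 h3
    rcases hs with rfl | rfl
    · have v1 := val_next a
      have v2 := val_next b
      have v3 := val_next c
      rw [← h1] at v1; rw [← h2] at v2; rw [← h3] at v3
      simp only [ne_eq, Fin.ext_iff]; omega
    · have v1 := val_prev a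
      have v2 := val_prev b
      have v3 := val_prev c
      rw [← h1] at v1; rw [← h2] at v2; rw [← h3] at v3
      simp only [ne_eq, Fin.ext_iff]; omega
  cases hz with
  | orthogonal i j hij h =>
    rw [form_root_root hm hn, if_neg hij] at h
    have hs : ∀ a, sign m n a ≠ 0 := fun a => by rw [sign_eq]; split_ifs <;> simp
    have h1 : j ≠ next i := by
      rintro rfl
      rw [if_neg (prev_ne_next hm hn i).symm, if_pos rfl] at h
      exact hs i (neg_eq_zero.mp h)
    have h2 : i ≠ next j := by
      rintro rfl
      rw [prev_next, if_pos rfl] at h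
      exact hs j (neg_eq_zero.mp h)
    rw [superBracket_eq (K := K), hx i j fun h => (hs2 _ _ h).elim h1 h2,
      hx j i fun h => (hs2 _ _ h).elim h2 h1]
    simp
  | odd i hi => exact hx i i (hs1 i)
  | cubic i j hi hj =>
    have h3 : x i * (x j * x i) = 0 := by
      by_cases h1 : j = s i
      · by_cases h2 : i = s j
        · exact absurd rfl (hs4 _ _ _ _ h1 h2 h1).2.1
        · rw [hx j i h2, mul_zero]
      · exact h0 _ _ _ h1
    simp only [quantumBracket, mul_sub, sub_mul, mul_smul_comm, smul_mul_assoc, mul_assoc, h3,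
      h0 _ _ _ (hs1 i), hx _ _ (hs1 i), mul_zero]
    simp
  | quartic i hi =>
    -- a nonzero product of four of these elements runs through four different vertices
    have w : ∀ a b c d, a = d ∨ b = d ∨ c = d ∨ a = b ∨ a = c →
        x a * (x b * (x c * x d)) = 0 := by
      intro a b c d h
      by_cases h1 : d = s c
      · by_cases h2 : c = s b
        · by_cases h3 : b = s a
          · have := hs4 _ _ _ _ h3 h2 h1
            tauto
          · rw [h0 _ _ _ h3]
        · rw [h0 _ _ _ h2, mul_zero]
      · rw [hx _ _ h1, mul_zero, mul_zero]
    simp only [superBracket_eq (K := K), quantumBracket, mul_sub, sub_mul, mul_smul_comm,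
      smul_mul_assoc, mul_assoc]
    simp [w]

/-- The natural representation, extended to the vertex `0`, satisfies the defining relations. -/
theorem isRep_natRep (hq : q ≠ 0) (hq2 : q ^ 2 ≠ 1) (hm : 2 ≤ m) (hn : 2 ≤ n)
    (Γ : AddSubgroup (WeightLattice m n)) (hΓ : ∀ i, root m n i ∈ Γ) :
    IsRep q Γ hΓ (natRep q Γ) := by
  have hm0 : 0 < m := by omega
  have EF := natRep_E_F hq hm Γ
  constructor
  · simp only [natRep, natSigma, Matrix.diagonal_mul_diagonal, neg_one_pow_mul_self,
      Matrix.diagonal_one]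
  · intro γ
    simp only [natRep, natSigma, natK, Matrix.diagonal_mul_diagonal, mul_comm]
  · intro i
    obtain ⟨c, hc, h1, h2⟩ := EF i
    rw [h1]
    simp only [natRep, natSigma, diagonal_mul_single, single_mul_diagonal,
      Matrix.smul_single, smul_eq_mul]
    rw [parity_prev hm hn]
    congr 1; ring
  · intro i
    obtain ⟨c, hc, h1, h2⟩ := EF i
    rw [h2]
    simp only [natRep, natSigma, diagonal_mul_single, single_mul_diagonal,
      Matrix.smul_single, smul_eq_mul]
    rw [parity_prev hm hn, mul_left_comm, ← mul_assoc ((-1) ^ nodeParity m n i),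
      neg_one_pow_mul_self, one_mul, mul_comm]
  · simp [natRep, natK, form]
  · intro γ γ'
    simp [natRep, natK, form_add_left, zpow_add₀ hq]
  · intro γ i
    obtain ⟨c, hc, h1, h2⟩ := EF i
    rw [h1]
    simp only [natRep, natK, diagonal_mul_single, single_mul_diagonal,
      Matrix.smul_single, smul_eq_mul]
    rw [form_eps_prev, zpow_add₀ hq]
    congr 1; ring
  · intro γ i
    obtain ⟨c, hc, h1, h2⟩ := EF i
    rw [h2]
    simp only [natRep, natK, diagonal_mul_single, single_mul_diagonal,
      Matrix.smul_single, smul_eq_mul]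
    rw [form_eps_prev, zpow_add₀ hq, zpow_neg]
    have := zpow_ne_zero (form γ.1 (root m n i)) hq
    congr 1; field_simp
  · intro i
    obtain ⟨c, hc, h1, h2⟩ := EF i
    rw [h1, h2, superBracket_eq (K := K), Matrix.single_mul_single_same,
      Matrix.single_mul_single_same, mul_inv_cancel₀ hc, inv_mul_cancel₀ hc]
    have hd : q ^ nodeSign m n i - q ^ (-nodeSign m n i) ≠ 0 := by
      have : q - q⁻¹ ≠ 0 := by
        intro h
        apply hq2
        have := mul_inv_cancel₀ hq
        rw [sub_eq_zero] at h
        rw [pow_two]; nth_rw 2 [h]; exact this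
      rw [nodeSign]
      split_ifs
      · simpa using this
      · simpa using sub_ne_zero.mpr (sub_ne_zero.mp this).symm
    rw [eq_inv_smul_iff₀ hd]
    have hp := prev_ne (n := n) hm i
    ext a b
    simp only [natRep, natK, Matrix.smul_apply, Matrix.sub_apply, Matrix.diagonal_apply,
      Matrix.single_apply, smul_eq_mul, form_eps, NegMemClass.coe_neg, Prod.fst_neg, Pi.neg_apply,
      root_apply, nodeSign_eq hm hn]
    by_cases hab : a = b
    · subst hab
      simp only [and_self, if_true]
      by_cases h3 : a = prev i
      · subst h3
        simp [hp, hp.symm]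
      · by_cases h4 : a = i
        · subst h4
          rcases nodeParity_eq_zero_or_one a with h5 | h5
          · rw [sign_eq_of_nodeParity_zero a h5, h5]
            simp [hp, hp.symm]
          · rw [sign_eq_of_nodeParity_one hm hn a h5, h5]
            simp [hp, hp.symm]
        · simp [h3, h4, Ne.symm h3, Ne.symm h4]
    · have h3 : ∀ c, ¬ (c = a ∧ c = b) := fun c h => hab (h.1.symm.trans h.2)
      simp [hab, h3]
  · intro i j hij
    obtain ⟨c, hc, h1, -⟩ := EF i
    obtain ⟨c', hc', -, h2⟩ := EF j
    rw [h1, h2, superBracket_eq (K := K), Matrix.single_mul_single_of_ne,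
      Matrix.single_mul_single_of_ne, smul_zero, sub_zero]
    · exact fun h => hij (prev_injective h.symm)
    · exact hij
  · intro z hz
    refine serre_of_step hm hn (.inl rfl) (fun i j hij => ?_) z hz
    obtain ⟨c, hc, h1, -⟩ := EF i
    obtain ⟨c', hc', h2, -⟩ := EF j
    rw [h1, h2, Matrix.single_mul_single_of_ne]
    exact fun h => hij (prev_eq_iff.mp h.symm)
  · intro z hz
    refine serre_of_step hm hn (.inr rfl) (fun i j hij => ?_) z hz
    obtain ⟨c, hc, -, h1⟩ := EF i
    obtain ⟨c', hc', -, h2⟩ := EF j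
    rw [h1, h2, Matrix.single_mul_single_of_ne]
    exact fun h => hij h.symm

theorem SerreElement.map_eq_zero {A B : Type u} [Ring A] [Algebra K A] [Ring B] [Algebra K B]
    (φ : A →ₐ[K] B) {x : Fin (m + n) → A} (hx : ∀ z, SerreElement q x z → z = 0) (z : B)
    (hz : SerreElement q (fun i => φ (x i)) z) : z = 0 := by
  cases hz with
  | orthogonal i j hij h => rw [← map_superBracket, hx _ (.orthogonal i j hij h), map_zero]
  | odd i hi => rw [← map_mul, hx _ (.odd i hi), map_zero]
  | cubic i j hi hj =>
    rw [← map_quantumBracket, ← map_quantumBracket, hx _ (.cubic i j hi hj), map_zero]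
  | quartic i hi =>
    rw [← map_quantumBracket, ← map_quantumBracket, ← map_superBracket, hx _ (.quartic i hi),
      map_zero]

theorem IsRep.map {A B : Type u} [Ring A] [Algebra K A] [Ring B] [Algebra K B]
    {Γ : AddSubgroup (WeightLattice m n)} {hΓ : ∀ i, root m n i ∈ Γ} {X : Gen Γ → A}
    (hX : IsRep q Γ hΓ X) (φ : A →ₐ[K] B) : IsRep q Γ hΓ fun g => φ (X g) where
  sigma_sq := by rw [← map_mul, hX.sigma_sq, map_one]
  sigma_K γ := by rw [← map_mul, hX.sigma_K, map_mul]
  sigma_E i := by rw [← map_mul, hX.sigma_E, map_smul, map_mul]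
  sigma_F i := by rw [← map_mul, hX.sigma_F, map_smul, map_mul]
  K_zero := by rw [hX.K_zero, map_one]
  K_add γ γ' := by rw [← map_mul, hX.K_add]
  K_E γ i := by rw [← map_mul, hX.K_E, map_smul, map_mul]
  K_F γ i := by rw [← map_mul, hX.K_F, map_smul, map_mul]
  E_F_same i := by rw [← map_superBracket, hX.E_F_same, map_smul, map_sub]
  E_F_ne i j h := by rw [← map_superBracket, hX.E_F_ne i j h, map_zero]
  serre_E := SerreElement.map_eq_zero φ hX.serre_E
  serre_F := SerreElement.map_eq_zero φ hX.serre_F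

/-- The twist of a family by a unit `y` (the spectral parameter): `E_0` is multiplied by `y⁻¹` and
`F_0` by `y`. -/
def twist {A : Type u} [Ring A] {Γ : AddSubgroup (WeightLattice m n)} (y : Aˣ) (X : Gen Γ → A) :
    Gen Γ → A
  | .sigma => X .sigma
  | .K γ => X (.K γ)
  | .E i => (if i.val = 0 then y⁻¹ else 1 : Aˣ) * X (.E i)
  | .F i => (if i.val = 0 then y else 1 : Aˣ) * X (.F i)

theorem IsRep.twist {A : Type u} [Ring A] [Algebra K A] {Γ : AddSubgroup (WeightLattice m n)}
    {hΓ : ∀ i, root m n i ∈ Γ} {X : Gen Γ → A} (hX : IsRep q Γ hΓ X) (y : Aˣ)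
    (hy : ∀ g, Commute (y : A) (X g)) : IsRep q Γ hΓ (twist y X) := by
  have h1 : ∀ (i : Fin (m + n)) g, X g * ((if i.val = 0 then y⁻¹ else 1 : Aˣ) : A) =
      ((if i.val = 0 then y⁻¹ else 1 : Aˣ) : A) * X g := fun i g => by
    split_ifs
    · exact ((hy g).units_inv_left).symm
    · simp
  have h2 : ∀ (i : Fin (m + n)) g, X g * ((if i.val = 0 then y else 1 : Aˣ) : A) =
      ((if i.val = 0 then y else 1 : Aˣ) : A) * X g := fun i g => by
    split_ifs
    · exact (hy g).symm
    · simp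
  have h3 : ∀ (i : Fin (m + n)) g z, X g * (((if i.val = 0 then y⁻¹ else 1 : Aˣ) : A) * z) =
      ((if i.val = 0 then y⁻¹ else 1 : Aˣ) : A) * (X g * z) := fun i g z => by
    rw [← mul_assoc, h1, mul_assoc]
  have h4 : ∀ (i : Fin (m + n)) g z, X g * (((if i.val = 0 then y else 1 : Aˣ) : A) * z) =
      ((if i.val = 0 then y else 1 : Aˣ) : A) * (X g * z) := fun i g z => by
    rw [← mul_assoc, h2, mul_assoc]
  have h5 : ∀ i j : Fin (m + n), (if j.val = 0 then y else 1) * (if i.val = 0 then y⁻¹ else 1) =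
      (if i.val = 0 then y⁻¹ else 1) * (if j.val = 0 then y else 1) := fun i j => by
    split_ifs <;> simp
  have h6 : ∀ (i j : Fin (m + n)) (z : A), ((if j.val = 0 then y else 1 : Aˣ) : A) *
      (((if i.val = 0 then y⁻¹ else 1 : Aˣ) : A) * z) = ((if i.val = 0 then y⁻¹ else 1 : Aˣ) : A) *
        (((if j.val = 0 then y else 1 : Aˣ) : A) * z) := fun i j z => by
    rw [← mul_assoc, ← Units.val_mul, h5, Units.val_mul, mul_assoc]
  have key : ∀ i j : Fin (m + n), superBracket (nodeParity m n i) (nodeParity m n j)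
      (SuperSchurWeyl.twist y X (.E i)) (SuperSchurWeyl.twist y X (.F j)) =
      ((if i.val = 0 then y⁻¹ else 1 : Aˣ) * (if j.val = 0 then y else 1 : Aˣ) : A) *
        superBracket (nodeParity m n i) (nodeParity m n j) (X (.E i)) (X (.F j)) := by
    intro i j
    simp only [superBracket_eq (K := K), SuperSchurWeyl.twist, mul_assoc, h3, h4, mul_sub,
      mul_smul_comm]
    rw [h6]
  constructor
  · exact hX.sigma_sq
  · exact hX.sigma_K
  · intro i
    simp only [SuperSchurWeyl.twist, h3, mul_assoc, hX.sigma_E, mul_smul_comm]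
  · intro i
    simp only [SuperSchurWeyl.twist, h4, mul_assoc, hX.sigma_F, mul_smul_comm]
  · exact hX.K_zero
  · exact hX.K_add
  · intro γ i
    simp only [SuperSchurWeyl.twist, h3, mul_assoc, hX.K_E, mul_smul_comm]
  · intro γ i
    simp only [SuperSchurWeyl.twist, h4, mul_assoc, hX.K_F, mul_smul_comm]
  · intro i
    rw [key, hX.E_F_same]
    split_ifs <;> simp [SuperSchurWeyl.twist]
  · intro i j hij
    rw [key, hX.E_F_ne i j hij, mul_zero]
  · refine SerreElement.scale (fun i j => (h1 i _).symm) (fun i j => ?_) hX.serre_E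
    rw [← Units.val_mul, ← Units.val_mul]
    split_ifs <;> simp
  · refine SerreElement.scale (fun i j => (h2 i _).symm) (fun i j => ?_) hX.serre_F
    rw [← Units.val_mul, ← Units.val_mul]
    split_ifs <;> simp

end Natural

/-! ### Operators on tensor powers given by matrices at each position -/

section Sites
variable {K : Type u} [Field K] {N d : ℕ}

/-- The operator `f 0 ⊗ f 1 ⊗ ⋯` on `V^{⊗ d}`. -/
def siteMap (f : Fin d → Matrix (Fin N) (Fin N) K) : Module.End K (TensorPower K N d) :=
  PiTensorProduct.map fun l => Matrix.toLin' (f l)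

theorem siteMap_mul (f g : Fin d → Matrix (Fin N) (Fin N) K) :
    siteMap f * siteMap g = siteMap (f * g) := by
  rw [siteMap, siteMap, ← PiTensorProduct.map_mul, siteMap]
  congr 1
  funext l
  rw [Pi.mul_apply, Matrix.toLin'_mul]; rfl

theorem siteMap_one : siteMap (1 : Fin d → Matrix (Fin N) (Fin N) K) = 1 := by
  rw [siteMap, ← PiTensorProduct.map_one]
  congr 1
  funext l
  rw [Pi.one_apply, Matrix.toLin'_one]; rfl

variable {M : Type u} [AddCommGroup M] [Module K M]

/-- The operator `φ ⊗ f 0 ⊗ f 1 ⊗ ⋯` on `M ⊗ V^{⊗ d}`. -/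
def siteOp (φ : Module.End K M) (f : Fin d → Matrix (Fin N) (Fin N) K) :
    Module.End K (M ⊗[K] TensorPower K N d) :=
  TensorProduct.map φ (siteMap f)

theorem siteOp_mul (φ ψ : Module.End K M) (f g : Fin d → Matrix (Fin N) (Fin N) K) :
    siteOp φ f * siteOp ψ g = siteOp (φ * ψ) (f * g) := by
  rw [siteOp, siteOp, ← TensorProduct.map_mul, siteMap_mul, siteOp]

theorem siteOp_one : siteOp (1 : Module.End K M) (1 : Fin d → Matrix (Fin N) (Fin N) K) = 1 := by
  rw [siteOp, siteMap_one, TensorProduct.map_one]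

theorem siteOp_pow (f : Fin d → Matrix (Fin N) (Fin N) K) (k : ℕ) :
    siteOp (1 : Module.End K M) f ^ k = siteOp 1 (f ^ k) := by
  induction k with
  | zero => rw [pow_zero, pow_zero, siteOp_one]
  | succ k ih => rw [pow_succ, pow_succ, ih, siteOp_mul, one_mul]

theorem siteOp_commute {φ ψ : Module.End K M} {f g : Fin d → Matrix (Fin N) (Fin N) K}
    (h : Commute φ ψ) (hfg : ∀ l, Commute (f l) (g l)) :
    Commute (siteOp φ f) (siteOp ψ g) := by
  rw [Commute, SemiconjBy, siteOp_mul, siteOp_mul, h.eq]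
  congr 1
  funext l
  exact hfg l

/-- Matrices acting at the position `k`. -/
def siteHom (M : Type u) [AddCommGroup M] [Module K M] (k : Fin d) :
    Matrix (Fin N) (Fin N) K →ₐ[K] Module.End K (M ⊗[K] TensorPower K N d) :=
  AlgHom.ofLinearMap
    { toFun := fun B => siteOp 1 (Pi.mulSingle k B)
      map_add' := fun B C => by
        have h : ∀ B : Matrix (Fin N) (Fin N) K,
            (fun l => Matrix.toLin' ((Pi.mulSingle k B : Fin d → Matrix (Fin N) (Fin N) K) l)) =
            Function.update (fun _ => LinearMap.id) k (Matrix.toLin' B) := fun B => by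
          funext l
          by_cases hl : l = k
          · subst hl; simp
          · simp [hl]
        rw [siteOp, siteOp, siteOp, siteMap, siteMap, siteMap, h, h, h, map_add,
          PiTensorProduct.map_update_add, TensorProduct.map_add_right]
      map_smul' := fun c B => by
        have h : ∀ B : Matrix (Fin N) (Fin N) K,
            (fun l => Matrix.toLin' ((Pi.mulSingle k B : Fin d → Matrix (Fin N) (Fin N) K) l)) =
            Function.update (fun _ => LinearMap.id) k (Matrix.toLin' B) := fun B => by
          funext l
          by_cases hl : l = k
          · subst hl; simp
          · simp [hl]
        rw [siteOp, siteOp, siteMap, siteMap, h, h, map_smul,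
          PiTensorProduct.map_update_smul, TensorProduct.map_smul_right, RingHom.id_apply] }
    (by
      change siteOp 1 (Pi.mulSingle k 1) = 1
      rw [Pi.mulSingle_one, siteOp_one])
    (fun B C => by
      change siteOp 1 (Pi.mulSingle k (B * C)) = siteOp 1 (Pi.mulSingle k B) * siteOp 1 (Pi.mulSingle k C)
      rw [siteOp_mul, Pi.mulSingle_mul, one_mul])

theorem siteHom_apply (k : Fin d) (B : Matrix (Fin N) (Fin N) K) :
    siteHom M k B = siteOp 1 (Pi.mulSingle k B) := rfl

end Sites

/-! ### The relations on `M ⊗ V^{⊗ d}` -/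

section Iterated
variable {K : Type u} [Field K] {m n : ℕ} {q : K} {Γ : AddSubgroup (WeightLattice m n)}
  {hΓ : ∀ i, root m n i ∈ Γ} {d : ℕ} {M : Type u} [AddCommGroup M] [Module K M]

/-- The operators of the generators on the tensor product of `M` with `V^{⊗ d}`, of which only the
first `r` factors are used; the `k`-th factor has the spectral parameter `y k`, an operator
on `M`. -/
def iteratedRep (q : K) (hΓ : ∀ i, root m n i ∈ Γ) (y : Fin d → (Module.End K M)ˣ) (r : ℕ) :
    Gen Γ → Module.End K (M ⊗[K] TensorPower K (m + n) d)
  | .sigma => siteOp 1 fun l => if l.val < r then natRep q Γ .sigma else 1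
  | .K γ => siteOp 1 fun l => if l.val < r then natRep q Γ (.K γ) else 1
  | .E i => ∑ k : Fin d with k.val < r,
      siteOp ((if i.val = 0 then (y k)⁻¹ else 1 : (Module.End K M)ˣ) : Module.End K M) fun l =>
        if l < k then natRep q Γ (.K ⟨root m n i, hΓ i⟩) * natRep q Γ .sigma ^ nodeParity m n i
        else if l = k then natRep q Γ (.E i) else 1
  | .F i => ∑ k : Fin d with k.val < r,
      siteOp ((if i.val = 0 then y k else 1 : (Module.End K M)ˣ) : Module.End K M) fun l =>
        if l < k then natRep q Γ .sigma ^ nodeParity m n i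
        else if l = k then natRep q Γ (.F i)
        else if l.val < r then natRep q Γ (.K (-⟨root m n i, hΓ i⟩)) else 1

/-- A unit of `End M` as a unit of `End (M ⊗ V^{⊗ d})`. -/
def paramUnit (N d : ℕ) (u : (Module.End K M)ˣ) : (Module.End K (M ⊗[K] TensorPower K N d))ˣ where
  val := siteOp u 1
  inv := siteOp (u⁻¹ : (Module.End K M)ˣ) 1
  val_inv := by rw [siteOp_mul, Units.mul_inv, one_mul, siteOp_one]
  inv_val := by rw [siteOp_mul, Units.inv_mul, one_mul, siteOp_one]

theorem isRep_twist_site (hq : q ≠ 0) (hq2 : q ^ 2 ≠ 1) (hm : 2 ≤ m) (hn : 2 ≤ n)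
    (u : (Module.End K M)ˣ) (k : Fin d) :
    IsRep q Γ hΓ (twist (paramUnit (m + n) d u) fun g => siteHom M k (natRep q Γ g)) := by
  refine ((isRep_natRep hq hq2 hm hn Γ hΓ).map _).twist _ fun g => ?_
  exact siteOp_commute (Commute.one_right _) fun l => Commute.one_left _

/-- One more tensor factor amounts to one more comultiplication. -/
theorem iteratedRep_succ (y : Fin d → (Module.End K M)ˣ) (r : ℕ) (hr : r < d) :
    iteratedRep q hΓ y (r + 1) = coprod hΓ (iteratedRep q hΓ y r)
      (twist (paramUnit (m + n) d (y ⟨r, hr⟩)) fun g => siteHom M ⟨r, hr⟩ (natRep q Γ g)) := by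
  have hsite : ∀ (B : Matrix (Fin (m + n)) (Fin (m + n)) K) (l : Fin d),
      (Pi.mulSingle ⟨r, hr⟩ B : Fin d → Matrix (Fin (m + n)) (Fin (m + n)) K) l =
        if l.val = r then B else 1 := fun B l => by
    rw [Pi.mulSingle_apply]; simp only [Fin.ext_iff]
  have hf : (Finset.univ.filter fun k : Fin d => k.val < r + 1) =
      insert ⟨r, hr⟩ (Finset.univ.filter fun k : Fin d => k.val < r) := by
    ext k; simp [Fin.ext_iff]; omega
  have hE : ∀ i : Fin (m + n), ((if i.val = 0 then (paramUnit (m + n) d (y ⟨r, hr⟩))⁻¹ else 1 :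
      (Module.End K (M ⊗[K] TensorPower K (m + n) d))ˣ) :
        Module.End K (M ⊗[K] TensorPower K (m + n) d)) =
      siteOp ((if i.val = 0 then (y ⟨r, hr⟩)⁻¹ else 1 : (Module.End K M)ˣ) : Module.End K M) 1 :=
    fun i => by
      split_ifs
      · rfl
      · exact siteOp_one.symm
  have hF : ∀ i : Fin (m + n), ((if i.val = 0 then paramUnit (m + n) d (y ⟨r, hr⟩) else 1 :
      (Module.End K (M ⊗[K] TensorPower K (m + n) d))ˣ) :
        Module.End K (M ⊗[K] TensorPower K (m + n) d)) =
      siteOp ((if i.val = 0 then (y ⟨r, hr⟩) else 1 : (Module.End K M)ˣ) : Module.End K M) 1 :=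
    fun i => by
      split_ifs
      · rfl
      · exact siteOp_one.symm
  have hnot : (⟨r, hr⟩ : Fin d) ∉ Finset.univ.filter fun k : Fin d => k.val < r := by simp
  funext g
  cases g with
  | sigma =>
    simp only [iteratedRep, coprod, twist, siteHom_apply, siteOp_mul, one_mul]
    congr 1
    funext l
    rw [Pi.mul_apply, hsite]
    split_ifs <;> first | omega | simp
  | K γ =>
    simp only [iteratedRep, coprod, twist, siteHom_apply, siteOp_mul, one_mul]
    congr 1
    funext l
    rw [Pi.mul_apply, hsite]
    split_ifs <;> first | omega | simp
  | E i =>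
    simp only [iteratedRep, coprod, twist, siteHom_apply, siteOp_mul, one_mul, mul_one, hE,
      siteOp_pow]
    rw [hf, Finset.sum_insert hnot]
    refine (add_comm _ _).trans ?_
    congr 2
    funext l
    rw [Pi.mul_apply, Pi.mul_apply, Pi.pow_apply, hsite]
    simp only [Fin.lt_def, Fin.ext_iff]
    split_ifs <;> first | omega | simp
  | F i =>
    simp only [iteratedRep, coprod, twist, siteHom_apply, siteOp_mul, one_mul, mul_one, hF,
      siteOp_pow, Finset.sum_mul]
    rw [hf, Finset.sum_insert hnot]
    refine (add_comm _ _).trans ?_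
    congr 1
    · refine Finset.sum_congr rfl fun k hk => ?_
      have hk := (Finset.mem_filter.mp hk).2
      congr 1
      funext l
      rw [Pi.mul_apply, hsite]
      simp only [Fin.lt_def, Fin.ext_iff]
      split_ifs <;> first | omega | simp
    · congr 1
      funext l
      rw [Pi.mul_apply, Pi.pow_apply, hsite]
      simp only [Fin.lt_def, Fin.ext_iff]
      split_ifs <;> first | omega | simp

/-- The iterated comultiplication with commuting spectral parameters satisfies the defining relations. -/
theorem isRep_iteratedRep (hq : q ≠ 0) (hq2 : q ^ 2 ≠ 1) (hm : 2 ≤ m) (hn : 2 ≤ n)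
    (y : Fin d → (Module.End K M)ˣ)
    (hy : ∀ j k, Commute (y j : Module.End K M) (y k : Module.End K M)) (r : ℕ) (hr : r ≤ d) :
    IsRep q Γ hΓ (iteratedRep q hΓ y r) := by
  induction r with
  | zero =>
    have hE : ∀ i, iteratedRep q hΓ y 0 (.E i) = 0 := fun i => by simp [iteratedRep]
    have hF : ∀ i, iteratedRep q hΓ y 0 (.F i) = 0 := fun i => by simp [iteratedRep]
    have hK : ∀ γ, iteratedRep q hΓ y 0 (.K γ) = 1 := fun γ => by
      simp only [iteratedRep, Nat.not_lt_zero, if_false]; exact siteOp_one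
    have hσ : iteratedRep q hΓ y 0 .sigma = 1 := by
      simp only [iteratedRep, Nat.not_lt_zero, if_false]; exact siteOp_one
    constructor <;> intros <;> simp_all [superBracket]
    all_goals
      exact serre_of_step hm hn (.inl rfl) (fun _ _ _ => mul_zero _) _ (by assumption)
  | succ r ih =>
    have hr' : r < d := hr
    rw [iteratedRep_succ y r hr']
    refine (ih hr'.le).coprod hq hm hn (isRep_twist_site hq hq2 hm hn _ _) ?_
    have h1 : ∀ (f : Fin d → Matrix (Fin (m + n)) (Fin (m + n)) K) B φ ψ, f ⟨r, hr'⟩ = 1 →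
        Commute φ ψ → Commute (siteOp (M := M) φ f) (siteOp ψ (Pi.mulSingle ⟨r, hr'⟩ B)) := by
      intro f B φ ψ hf hφ
      refine siteOp_commute hφ fun l => ?_
      by_cases hl : l = ⟨r, hr'⟩
      · rw [hl, hf]; exact Commute.one_left _
      · rw [Pi.mulSingle_eq_of_ne hl]; exact Commute.one_right _
    have h2 : ∀ h, ∃ ψ : Module.End K M, ∃ B,
        twist (paramUnit (m + n) d (y ⟨r, hr'⟩)) (fun g => siteHom M ⟨r, hr'⟩ (natRep q Γ g)) h =
          siteOp ψ (Pi.mulSingle ⟨r, hr'⟩ B) ∧ ∀ k, Commute (y k : Module.End K M) ψ := by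
      intro h
      cases h with
      | sigma => exact ⟨1, _, rfl, fun k => Commute.one_right _⟩
      | K γ => exact ⟨1, _, rfl, fun k => Commute.one_right _⟩
      | E i =>
        by_cases hi : i.val = 0
        · refine ⟨((y ⟨r, hr'⟩)⁻¹ : (Module.End K M)ˣ), natRep q Γ (.E i), ?_, fun k =>
            (hy k _).units_inv_right⟩
          simp only [twist, if_pos hi]
          change siteOp _ 1 * siteOp _ _ = _
          rw [siteOp_mul, one_mul, mul_one]
        · refine ⟨1, natRep q Γ (.E i), ?_, fun k => Commute.one_right _⟩
          simp only [twist, if_neg hi, Units.val_one, one_mul]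
          rfl
      | F i =>
        by_cases hi : i.val = 0
        · refine ⟨(y ⟨r, hr'⟩ : (Module.End K M)ˣ), natRep q Γ (.F i), ?_, fun k => hy k _⟩
          simp only [twist, if_pos hi]
          change siteOp _ 1 * siteOp _ _ = _
          rw [siteOp_mul, one_mul, mul_one]
        · refine ⟨1, natRep q Γ (.F i), ?_, fun k => Commute.one_right _⟩
          simp only [twist, if_neg hi, Units.val_one, one_mul]
          rfl
    intro g h
    obtain ⟨ψ, B, hB, hψ⟩ := h2 h
    rw [hB]
    cases g with
    | sigma => exact h1 _ _ _ _ (by simp) (Commute.one_left _)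
    | K γ => exact h1 _ _ _ _ (by simp) (Commute.one_left _)
    | E i =>
      refine Commute.sum_left _ _ _ fun k hk => h1 _ _ _ _ ?_ ?_
      · have hk := (Finset.mem_filter.mp hk).2
        simp only [Fin.lt_def, Fin.ext_iff]
        split_ifs <;> first | omega | rfl
      · split_ifs
        · exact (hψ k).units_inv_left
        · exact Commute.one_left _
    | F i =>
      refine Commute.sum_left _ _ _ fun k hk => h1 _ _ _ _ ?_ ?_
      · have hk := (Finset.mem_filter.mp hk).2
        simp only [Fin.lt_def, Fin.ext_iff]
        split_ifs <;> first | omega | rfl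
      · split_ifs
        · exact hψ k
        · exact Commute.one_left _

end Iterated

/-! ### The braiding on two tensor factors -/

section Slots
variable {K : Type u} [Field K] {N d : ℕ}

/-- The tensor `w` with the factors `x` and `y` replaced by the basis vectors `a` and `b`. -/
def slot (x y : Fin d) (w : Fin d → Fin N → K) (a b : Fin N) : TensorPower K N d :=
  PiTensorProduct.tprod K
    (Function.update (Function.update w x (Pi.single a 1)) y (Pi.single b 1))

theorem siteMap_tprod (f : Fin d → Matrix (Fin N) (Fin N) K) (w : Fin d → Fin N → K) :
    siteMap f (PiTensorProduct.tprod K w) = PiTensorProduct.tprod K fun l => (f l).mulVec (w l) := by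
  rw [siteMap, PiTensorProduct.map_tprod]; rfl

theorem slot_congr {x y : Fin d} {w w' : Fin d → Fin N → K}
    (h : ∀ l, l ≠ x → l ≠ y → w l = w' l) (a b : Fin N) : slot x y w a b = slot x y w' a b := by
  rw [slot, slot]
  congr 1
  funext l
  by_cases hy : l = y
  · subst hy; simp
  · by_cases hx : l = x
    · subst hx; simp [hy]
    · simp [hx, hy, h l hx hy]

theorem siteMap_slot {x y : Fin d} (hxy : x ≠ y) (f : Fin d → Matrix (Fin N) (Fin N) K)
    (w : Fin d → Fin N → K) {a b a' b' : Fin N} {α β : K}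
    (ha : (f x).mulVec (Pi.single a 1) = α • Pi.single a' 1)
    (hb : (f y).mulVec (Pi.single b 1) = β • Pi.single b' 1) :
    siteMap f (slot x y w a b) = (α * β) • slot x y (fun l => (f l).mulVec (w l)) a' b' := by
  have e : (fun l => (f l).mulVec
      (Function.update (Function.update w x (Pi.single a 1)) y (Pi.single b 1) l)) =
      Function.update (Function.update (fun l => (f l).mulVec (w l)) x (α • Pi.single a' 1)) y
        (β • Pi.single b' 1) := by
    funext l
    by_cases hy : l = y
    · subst hy; simp [hb]
    · by_cases hx : l = x
      · subst hx; simp [hy, ha]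
      · simp [hx, hy]
  rw [slot, siteMap_tprod, e, MultilinearMap.map_update_smul, Function.update_comm hxy,
    MultilinearMap.map_update_smul, smul_smul, mul_comm, slot, Function.update_comm hxy]

theorem mulVec_single_self (p s : Fin N) (c : K) (a : Fin N) :
    (Matrix.single p s c).mulVec (Pi.single a 1) =
      (if a = s then c else 0) • (Pi.single p 1 : Fin N → K) := by
  rw [Matrix.single_mulVec]
  ext i
  by_cases h : a = s
  · subst h
    by_cases hi : i = p
    · subst hi; simp
    · simp [hi]
  · by_cases hi : i = p
    · subst hi; simp [h, Ne.symm h]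
    · simp [hi, h]

theorem mulVec_diagonal_single (D : Fin N → K) (a : Fin N) :
    (Matrix.diagonal D).mulVec (Pi.single a 1) = D a • (Pi.single a 1 : Fin N → K) := by
  rw [Matrix.diagonal_mulVec_single, ← Pi.single_smul]; simp

theorem tensorBasis_apply (f : Fin d → Fin N) :
    tensorBasis K N d f = PiTensorProduct.tprod K fun l => Pi.single (f l) 1 := by
  rw [tensorBasis, Basis.piTensorProduct_apply]
  simp

theorem tensorBasis_eq_slot (x y : Fin d) (f : Fin d → Fin N) :
    tensorBasis K N d f = slot x y (fun l => Pi.single (f l) 1) (f x) (f y) := by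
  rw [tensorBasis_apply, slot]
  congr 1
  funext l
  by_cases hy : l = y
  · subst hy; simp
  · by_cases hx : l = x
    · subst hx; simp [hy]
    · simp [hy]

theorem tensorBasis_swap_eq_slot {x y : Fin d} (hxy : x ≠ y) (f : Fin d → Fin N) :
    tensorBasis K N d (f ∘ Equiv.swap x y) =
      slot x y (fun l => Pi.single (f l) 1) (f y) (f x) := by
  rw [tensorBasis_apply, slot]
  congr 1
  funext l
  by_cases hy : l = y
  · subst hy; simp
  · by_cases hx : l = x
    · subst hx; simp [hy]
    · simp [hx, hy, Equiv.swap_apply_of_ne_of_ne hx hy]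

/-- Linear maps on `V^{⊗ d}` agree if they agree on the tensors `slot x y w a b`. -/
theorem ext_slot {W : Type*} [AddCommMonoid W] [Module K W] (x y : Fin d)
    {f g : TensorPower K N d →ₗ[K] W} (h : ∀ w a b, f (slot x y w a b) = g (slot x y w a b)) :
    f = g :=
  (tensorBasis K N d).ext fun i => by rw [tensorBasis_eq_slot x y]; exact h _ _ _

end Slots

section Braiding
variable {K : Type u} [Field K] {m n d : ℕ} {q : K}

/-- The eigenvalue of the braiding on `v_a ⊗ v_a`. -/
def braidSelf (m n : ℕ) (q : K) (a : Fin (m + n)) : K := (-1) ^ parity m n a * q ^ sign m n a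

/-- The coefficient of `v_b ⊗ v_a` in the braiding of `v_a ⊗ v_b`. -/
def braidSwap (K : Type u) [Field K] (m n : ℕ) (a b : Fin (m + n)) : K :=
  (-1) ^ (parity m n a * parity m n b)

/-- The coefficient of `v_a ⊗ v_b` in the braiding of `v_a ⊗ v_b`. -/
def braidKeep (q : K) (a b : Fin (m + n)) : K := if a < b then q - q⁻¹ else 0

/-- The formula for the braiding on basis vectors in two factors, for arbitrary vectors in the others. -/
theorem braiding_slot {x y : Fin d} (hxy : x ≠ y) (w : Fin d → Fin (m + n) → K)
    (a b : Fin (m + n)) :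
    braiding m n q x y (slot x y w a b) =
      if a = b then braidSelf m n q a • slot x y w a b
      else braidSwap K m n a b • slot x y w b a + braidKeep q a b • slot x y w a b := by
  -- the braiding is a linear combination of tensor products of matrix units
  let two : Matrix (Fin (m + n)) (Fin (m + n)) K → Matrix (Fin (m + n)) (Fin (m + n)) K →
      Module.End K (TensorPower K (m + n) d) := fun A B =>
    siteMap (Function.update (Function.update 1 x A) y B)
  have htwo : ∀ (w : Fin d → Fin (m + n) → K) (p s p' s' a b : Fin (m + n)),
      two (Matrix.single p s 1) (Matrix.single p' s' 1) (slot x y w a b) =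
        ((if a = s then 1 else 0) * (if b = s' then 1 else 0) : K) • slot x y w p p' := by
    intro w p s p' s' a b
    change siteMap _ _ = _
    rw [siteMap_slot hxy _ w (a' := p) (b' := p') (α := if a = s then 1 else 0)
      (β := if b = s' then 1 else 0)]
    · congr 1
      refine slot_congr (fun l hx hy => ?_) _ _
      simp [hx, hy]
    · simp only [Function.update_of_ne hxy, Function.update_self, mulVec_single_self]
    · simp only [Function.update_self, mulVec_single_self]
  let R : Module.End K (TensorPower K (m + n) d) := ∑ a, ∑ b,
    if a = b then braidSelf m n q a • two (Matrix.single a a 1) (Matrix.single b b 1)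
    else braidSwap K m n a b • two (Matrix.single b a 1) (Matrix.single a b 1) +
      braidKeep q a b • two (Matrix.single a a 1) (Matrix.single b b 1)
  have hR : ∀ (w : Fin d → Fin (m + n) → K) a b, R (slot x y w a b) =
      if a = b then braidSelf m n q a • slot x y w a b
      else braidSwap K m n a b • slot x y w b a + braidKeep q a b • slot x y w a b := by
    intro w a b
    simp only [R, LinearMap.sum_apply]
    rw [Finset.sum_eq_single a, Finset.sum_eq_single b]
    · split_ifs with h
      · rw [LinearMap.smul_apply, htwo]; simp
      · rw [LinearMap.add_apply, LinearMap.smul_apply, LinearMap.smul_apply, htwo, htwo]; simp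
    · intro c _ hc
      split_ifs with h
      · rw [LinearMap.smul_apply, htwo]; simp [hc.symm]
      · rw [LinearMap.add_apply, LinearMap.smul_apply, LinearMap.smul_apply, htwo, htwo]
        simp [hc.symm]
    · simp
    · intro c _ hc
      refine Finset.sum_eq_zero fun c' _ => ?_
      split_ifs with h
      · rw [LinearMap.smul_apply, htwo]; simp [hc.symm]
      · rw [LinearMap.add_apply, LinearMap.smul_apply, LinearMap.smul_apply, htwo, htwo]
        simp [hc.symm]
    · simp
  have hb : braiding m n q x y = R := by
    refine (tensorBasis K (m + n) d).ext fun f => ?_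
    rw [braiding_basis, tensorBasis_swap_eq_slot hxy, tensorBasis_eq_slot x y, hR]
    rfl
  rw [hb, hR]

/-- The braiding commutes with operators that act on both factors by the same diagonal matrix. -/
theorem braiding_comm_siteMap {x y : Fin d} (hxy : x ≠ y)
    {f : Fin d → Matrix (Fin (m + n)) (Fin (m + n)) K} {D : Fin (m + n) → K}
    (hx : f x = Matrix.diagonal D) (hy : f y = Matrix.diagonal D) :
    braiding m n q x y * siteMap f = siteMap f * braiding m n q x y := by
  refine ext_slot x y fun w a b => ?_
  have h : ∀ a b, siteMap f (slot x y w a b) =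
      (D a * D b) • slot x y (fun l => (f l).mulVec (w l)) a b := fun a b =>
    siteMap_slot hxy f w (by rw [hx, mulVec_diagonal_single]) (by rw [hy, mulVec_diagonal_single])
  rw [Module.End.mul_apply, Module.End.mul_apply, h, map_smul, braiding_slot hxy,
    braiding_slot hxy]
  split_ifs with hab
  · rw [map_smul, h, smul_comm]
  · rw [map_add, map_smul, map_smul, h, h, mul_comm (D b)]
    module

variable {x y : Fin d} {f f' : Fin d → Matrix (Fin (m + n)) (Fin (m + n)) K}
  {p s : Fin (m + n)} {c : K} {α γ : Fin (m + n) → K}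

/-- Action on `slot` of a matrix unit at the first place and a diagonal matrix at the second. -/
theorem siteMap_slot_left (hxy : x ≠ y) (hx : f x = Matrix.single p s c)
    (hy : f y = Matrix.diagonal γ) (w : Fin d → Fin (m + n) → K) (a b : Fin (m + n)) :
    siteMap f (slot x y w a b) = ((if a = s then c else 0) * γ b) •
      slot x y (fun l => (f l).mulVec (w l)) p b :=
  siteMap_slot hxy f w (by rw [hx, mulVec_single_self]) (by rw [hy, mulVec_diagonal_single])

/-- Action on `slot` of a diagonal matrix at the first place and a matrix unit at the second. -/
theorem siteMap_slot_right (hxy : x ≠ y) (hx : f' x = Matrix.diagonal α)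
    (hy : f' y = Matrix.single p s c) (hf : ∀ l, l ≠ x → l ≠ y → f' l = f l)
    (w : Fin d → Fin (m + n) → K) (a b : Fin (m + n)) :
    siteMap f' (slot x y w a b) = (α a * (if b = s then c else 0)) •
      slot x y (fun l => (f l).mulVec (w l)) a p := by
  rw [siteMap_slot hxy f' w (by rw [hx, mulVec_diagonal_single]) (by rw [hy, mulVec_single_self])]
  congr 1
  exact slot_congr (fun l h1 h2 => by simp only [hf l h1 h2]) _ _

/-- A sufficient condition for the sum of a matrix unit at the first place and at the second place,
with diagonal matrices at the other place, to commute with the braiding. -/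
theorem braiding_comm_sum (hxy : x ≠ y) (hps : p ≠ s) (hx : f x = Matrix.single p s c)
    (hy : f y = Matrix.diagonal γ) (hx' : f' x = Matrix.diagonal α)
    (hy' : f' y = Matrix.single p s c) (hf : ∀ l, l ≠ x → l ≠ y → f' l = f l)
    (h1 : γ s * braidSwap K m n p s + α s * braidKeep q s p = braidSelf m n q s * α s)
    (h2 : γ s * braidKeep q p s + α s * braidSwap K m n s p = braidSelf m n q s * γ s)
    (h3 : γ p * braidSelf m n q p = braidSwap K m n s p * α p + braidKeep q s p * γ p)
    (h4 : α p * braidSelf m n q p = braidSwap K m n p s * γ p + braidKeep q p s * α p)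
    (h5 : ∀ b, b ≠ p → b ≠ s → γ b * braidSwap K m n p b = braidSwap K m n s b * α b ∧
      braidKeep q p b = braidKeep q s b)
    (h6 : ∀ a, a ≠ p → a ≠ s → α a * braidSwap K m n a p = braidSwap K m n a s * γ a ∧
      braidKeep q a p = braidKeep q a s) :
    braiding m n q x y * (siteMap f + siteMap f') =
      (siteMap f + siteMap f') * braiding m n q x y := by
  refine ext_slot x y fun w a b => ?_
  have hl := siteMap_slot_left hxy hx hy w
  have hr := siteMap_slot_right (f := f) hxy hx' hy' hf w
  set w' := fun l => (f l).mulVec (w l)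
  rw [Module.End.mul_apply, Module.End.mul_apply, LinearMap.add_apply, hl, hr]
  by_cases ha : a = s
  · subst ha
    by_cases hb : b = a
    · subst hb
      simp only [braiding_slot hxy, map_add, map_smul, if_true, if_neg hps, if_neg hps.symm,
        LinearMap.add_apply, hl, hr]
      match_scalars <;> first | ring1 | linear_combination c * h2 | linear_combination c * h1
    · by_cases hb' : b = p
      · subst hb'
        simp only [braiding_slot hxy, mul_zero, zero_mul, zero_smul, add_zero, zero_add,
          map_add, map_smul, if_true, if_neg hps, if_neg hps.symm,
          LinearMap.add_apply, hl, hr]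
        match_scalars
        linear_combination c * h3
      · obtain ⟨e1, e2⟩ := h5 b hb' hb
        simp only [braiding_slot hxy, mul_zero, zero_mul, zero_smul, add_zero, zero_add,
          map_add, map_smul, if_true, if_neg hb, if_neg (Ne.symm hb),
          if_neg (Ne.symm hb'), LinearMap.add_apply, hl, hr, e2]
        match_scalars <;> first | ring1 | linear_combination c * e1
  · by_cases hb : b = s
    · subst hb
      by_cases ha' : a = p
      · subst ha'
        simp only [braiding_slot hxy, mul_zero, zero_mul, zero_smul, add_zero, zero_add,
          map_add, map_smul, if_true, if_neg hps, LinearMap.add_apply, hl, hr]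
        match_scalars
        linear_combination c * h4
      · obtain ⟨e1, e2⟩ := h6 a ha' ha
        simp only [braiding_slot hxy, mul_zero, zero_mul, zero_smul, add_zero, zero_add,
          map_add, map_smul, if_true, if_neg ha, if_neg ha', LinearMap.add_apply, hl, hr, e2]
        match_scalars <;> first | ring1 | linear_combination c * e1
    · by_cases hab : a = b
      · subst hab
        simp [braiding_slot hxy, hl, hr, ha]
      · simp [braiding_slot hxy, hl, hr, ha, hb, hab]

/-- A sufficient condition for the braiding to move a matrix unit from the first place to the
second. -/
theorem braiding_move_right (hxy : x ≠ y) (hps : p ≠ s) (hx : f x = Matrix.single p s c)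
    (hy : f y = Matrix.diagonal γ) (hx' : f' x = Matrix.diagonal α)
    (hy' : f' y = Matrix.single p s c) (hf : ∀ l, l ≠ x → l ≠ y → f' l = f l)
    (hp : ∀ a, a ≠ p → braidKeep q p a = 0) (hs : ∀ a, a ≠ s → braidKeep q a s = 0)
    (h1 : γ s * braidSwap K m n p s = braidSelf m n q s * α s)
    (h2 : γ p * braidSelf m n q p = braidSwap K m n s p * α p)
    (h3 : ∀ b, b ≠ p → b ≠ s → γ b * braidSwap K m n p b = braidSwap K m n s b * α b) :
    braiding m n q x y * siteMap f = siteMap f' * braiding m n q x y := by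
  refine ext_slot x y fun w a b => ?_
  have hl := siteMap_slot_left hxy hx hy w
  have hr := siteMap_slot_right (f := f) hxy hx' hy' hf w
  set w' := fun l => (f l).mulVec (w l)
  rw [Module.End.mul_apply, Module.End.mul_apply, hl]
  by_cases ha : a = s
  · subst ha
    by_cases hb : b = a
    · subst hb
      simp only [braiding_slot hxy, zero_smul, add_zero, map_smul, if_true, if_neg hps, hr, hp _ hps.symm]
      match_scalars
      linear_combination c * h1
    · by_cases hb' : b = p
      · subst hb'
        simp only [braiding_slot hxy, mul_zero, zero_smul, smul_zero, add_zero, map_add, map_smul, if_true, if_neg hps, if_neg hps.symm, hr]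
        match_scalars
        linear_combination c * h2
      · simp only [braiding_slot hxy, mul_zero, zero_smul, smul_zero, add_zero, map_add, map_smul, if_true, if_neg hb, if_neg (Ne.symm hb),
          if_neg (Ne.symm hb'), hr, hp _ hb']
        match_scalars
        linear_combination c * h3 b hb' hb
  · by_cases hb : b = s
    · subst hb
      simp [braiding_slot hxy, hr, ha, hs a ha]
    · by_cases hab : a = b
      · subst hab
        simp [braiding_slot hxy, hr, ha]
      · simp [braiding_slot hxy, hr, ha, hb, hab]

/-- A sufficient condition for the braiding to move a matrix unit from the second place to the
first. -/
theorem braiding_move_left (hxy : x ≠ y) (hps : p ≠ s) (hx : f x = Matrix.single p s c)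
    (hy : f y = Matrix.diagonal γ) (hx' : f' x = Matrix.diagonal α)
    (hy' : f' y = Matrix.single p s c) (hf : ∀ l, l ≠ x → l ≠ y → f' l = f l)
    (hp : ∀ a, a ≠ p → braidKeep q a p = 0) (hs : ∀ a, a ≠ s → braidKeep q s a = 0)
    (h1 : α s * braidSwap K m n s p = braidSelf m n q s * γ s)
    (h2 : α p * braidSelf m n q p = braidSwap K m n p s * γ p)
    (h3 : ∀ a, a ≠ p → a ≠ s → α a * braidSwap K m n a p = braidSwap K m n a s * γ a) :
    braiding m n q x y * siteMap f' = siteMap f * braiding m n q x y := by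
  refine ext_slot x y fun w a b => ?_
  have hl := siteMap_slot_left hxy hx hy w
  have hr := siteMap_slot_right (f := f) hxy hx' hy' hf w
  set w' := fun l => (f l).mulVec (w l)
  rw [Module.End.mul_apply, Module.End.mul_apply, hr]
  by_cases hb : b = s
  · subst hb
    by_cases ha : a = b
    · subst ha
      simp only [braiding_slot hxy, zero_smul, add_zero, map_smul, if_true, if_neg hps.symm, hl, hp _ hps.symm]
      match_scalars
      linear_combination c * h1
    · by_cases ha' : a = p
      · subst ha'
        simp only [braiding_slot hxy, zero_mul, zero_smul, smul_zero, add_zero, map_add, map_smul, if_true, if_neg hps, hl]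
        match_scalars
        linear_combination c * h2
      · simp only [braiding_slot hxy, zero_mul, zero_smul, smul_zero, add_zero, map_add, map_smul, if_true, if_neg ha,
          if_neg ha', hl, hp _ ha']
        match_scalars
        linear_combination c * h3 a ha' ha
  · by_cases ha : a = s
    · subst ha
      simp [braiding_slot hxy, hl, hb, Ne.symm hb, hs b hb]
    · by_cases hab : a = b
      · subst hab
        simp [braiding_slot hxy, hl, ha]
      · simp [braiding_slot hxy, hl, ha, hb, hab]

end Braiding

section Intertwine
variable {K : Type u} [Field K] {m n d : ℕ} {q : K} {Γ : AddSubgroup (WeightLattice m n)}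
  {hΓ : ∀ i, root m n i ∈ Γ}

theorem natRep_K_root_sigma (i : Fin (m + n)) (k : ℕ) :
    natRep q Γ (.K ⟨root m n i, hΓ i⟩) * natRep q Γ .sigma ^ k =
      Matrix.diagonal fun a => q ^ (sign m n a * (root m n i).1 a) * ((-1) ^ parity m n a) ^ k := by
  simp only [natRep, natK, natSigma, Matrix.diagonal_pow, Matrix.diagonal_mul_diagonal, form_eps]
  rfl

theorem natRep_K_neg_root (i : Fin (m + n)) :
    natRep q Γ (.K (-⟨root m n i, hΓ i⟩)) =
      Matrix.diagonal fun a => q ^ (-(sign m n a * (root m n i).1 a)) := by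
  simp only [natRep, natK, form_eps, NegMemClass.coe_neg, Prod.fst_neg, Pi.neg_apply, mul_neg]

theorem natRep_sigma_pow (k : ℕ) :
    natRep q Γ .sigma ^ k = Matrix.diagonal fun a => ((-1) ^ parity m n a) ^ k := by
  simp only [natRep, natSigma, Matrix.diagonal_pow]
  rfl

/-- The three possible positions of a vertex `i ≠ 0` relative to the boundary between even and odd
basis vectors. -/
theorem parity_cases (i : Fin (m + n)) (hi : i.val ≠ 0) :
    (parity m n (prev i) = 0 ∧ parity m n i = 0 ∧ nodeParity m n i = 0) ∨
    (parity m n (prev i) = 0 ∧ parity m n i = 1 ∧ nodeParity m n i = 1) ∨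
    (parity m n (prev i) = 1 ∧ parity m n i = 1 ∧ nodeParity m n i = 0) := by
  have h1 := val_prev i
  unfold parity nodeParity
  split_ifs <;> omega

theorem parity_zero_or_one (a : Fin (m + n)) : parity m n a = 0 ∨ parity m n a = 1 := by
  unfold parity; split_ifs <;> simp

variable {x y : Fin d} {f f' : Fin d → Matrix (Fin (m + n)) (Fin (m + n)) K}

/-- The ends of a vertex `i ≠ 0` are neighbours in the linear order of the basis, so every other basis
vector lies on the same side of both. -/
theorem braidKeep_prev {i : Fin (m + n)} (hi : i.val ≠ 0) :
    braidKeep q (prev i) i = q - q⁻¹ ∧ braidKeep q i (prev i) = 0 ∧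
    (∀ b, b ≠ prev i → b ≠ i → braidKeep q (prev i) b = braidKeep q i b) ∧
    (∀ b, b ≠ prev i → b ≠ i → braidKeep q b (prev i) = braidKeep q b i) := by
  have h1 := val_prev i
  refine ⟨if_pos ?_, if_neg ?_, fun b hb hb' => ?_, fun b hb hb' => ?_⟩
  · rw [Fin.lt_def]; omega
  · rw [Fin.lt_def]; omega
  · simp only [braidKeep, Fin.lt_def]
    simp only [ne_eq, Fin.ext_iff] at hb hb'
    congr 1
    rw [eq_iff_iff]; omega
  · simp only [braidKeep, Fin.lt_def]
    simp only [ne_eq, Fin.ext_iff] at hb hb'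
    congr 1
    rw [eq_iff_iff]; omega

/-- The sum of the two summands of `E_i`, `i ≠ 0`, that act on the factors `x` and `y` commutes with the
braiding of these factors. -/
theorem braiding_comm_E (hq : q ≠ 0) (hm : 2 ≤ m) (hxy : x ≠ y) (i : Fin (m + n))
    (hi : i.val ≠ 0) (hx : f x = natRep q Γ (.E i)) (hy : f y = 1)
    (hx' : f' x = natRep q Γ (.K ⟨root m n i, hΓ i⟩) * natRep q Γ .sigma ^ nodeParity m n i)
    (hy' : f' y = natRep q Γ (.E i)) (hf : ∀ l, l ≠ x → l ≠ y → f' l = f l) :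
    braiding m n q x y * (siteMap f + siteMap f') =
      (siteMap f + siteMap f') * braiding m n q x y := by
  obtain ⟨c, -, hE, -⟩ := natRep_E_F hq hm Γ i
  rw [hE] at hx hy'
  rw [natRep_K_root_sigma] at hx'
  have hp := prev_ne (n := n) hm i
  obtain ⟨k1, k2, k3, k4⟩ := braidKeep_prev (n := n) (q := q) hi
  refine braiding_comm_sum hxy hp hx (hy.trans Matrix.diagonal_one.symm) hx' hy' hf
    ?_ ?_ ?_ ?_ (fun b hb hb' => ⟨?_, k3 b hb hb'⟩) (fun b hb hb' => ⟨?_, k4 b hb hb'⟩)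
  all_goals
    simp only [braidSelf, braidSwap, k1, k2, root_apply, hp, hp.symm, if_true, if_false, sign]
    try simp only [hb, hb', if_false]
    try rcases parity_zero_or_one b with h4 | h4 <;> rw [h4]
  all_goals
    obtain ⟨h1, h2, h3⟩ | ⟨h1, h2, h3⟩ | ⟨h1, h2, h3⟩ := parity_cases i hi <;>
    rw [h1, h2, h3] <;> simp <;> field_simp <;> ring

/-- The sum of the two summands of `F_i`, `i ≠ 0`, that act on the factors `x` and `y` commutes with the
braiding of these factors. -/
theorem braiding_comm_F (hq : q ≠ 0) (hm : 2 ≤ m) (hxy : x ≠ y) (i : Fin (m + n))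
    (hi : i.val ≠ 0) (hx : f x = natRep q Γ (.F i))
    (hy : f y = natRep q Γ (.K (-⟨root m n i, hΓ i⟩)))
    (hx' : f' x = natRep q Γ .sigma ^ nodeParity m n i)
    (hy' : f' y = natRep q Γ (.F i)) (hf : ∀ l, l ≠ x → l ≠ y → f' l = f l) :
    braiding m n q x y * (siteMap f + siteMap f') =
      (siteMap f + siteMap f') * braiding m n q x y := by
  obtain ⟨c, -, -, hE⟩ := natRep_E_F hq hm Γ i
  rw [hE] at hx hy'
  rw [natRep_K_neg_root] at hy
  rw [natRep_sigma_pow] at hx'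
  have hp := prev_ne (n := n) hm i
  obtain ⟨k1, k2, k3, k4⟩ := braidKeep_prev (n := n) (q := q) hi
  refine braiding_comm_sum hxy hp.symm hx hy hx' hy' hf
    ?_ ?_ ?_ ?_ (fun b hb hb' => ⟨?_, (k3 b hb' hb).symm⟩) (fun b hb hb' => ⟨?_, (k4 b hb' hb).symm⟩)
  all_goals
    simp only [braidSelf, braidSwap, k1, k2, root_apply, hp, hp.symm, if_true, if_false, sign]
    try simp only [hb, hb', if_false]
    try rcases parity_zero_or_one b with h4 | h4 <;> rw [h4]
  all_goals
    obtain ⟨h1, h2, h3⟩ | ⟨h1, h2, h3⟩ | ⟨h1, h2, h3⟩ := parity_cases i hi <;>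
    rw [h1, h2, h3] <;> simp <;> field_simp <;> ring

theorem parity_zero_vertex (hm : 2 ≤ m) (hn : 2 ≤ n) (i : Fin (m + n)) (hi : i.val = 0) :
    parity m n (prev i) = 1 ∧ parity m n i = 0 ∧ nodeParity m n i = 1 := by
  have h1 := val_prev i
  unfold parity nodeParity
  split_ifs <;> omega

theorem braidKeep_zero_vertex (i : Fin (m + n)) (hi : i.val = 0) :
    (∀ a, braidKeep q (prev i) a = 0) ∧ (∀ a, braidKeep q a i = 0) := by
  have h1 := val_prev i
  refine ⟨fun a => if_neg ?_, fun a => if_neg ?_⟩ <;> rw [Fin.lt_def] <;> omega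

/-- The braiding moves the summand of `E_0` at the factor `x` to that at the factor `y`. Unlike for the
other vertices, the two ends of the vertex `0` are the first and the last basis vector, and the sum
of both summands does not commute with the braiding. -/
theorem braiding_E_zero (hq : q ≠ 0) (hm : 2 ≤ m) (hn : 2 ≤ n) (hxy : x ≠ y) (i : Fin (m + n))
    (hi : i.val = 0) (hx : f x = natRep q Γ (.E i)) (hy : f y = 1)
    (hx' : f' x = natRep q Γ (.K ⟨root m n i, hΓ i⟩) * natRep q Γ .sigma ^ nodeParity m n i)
    (hy' : f' y = natRep q Γ (.E i)) (hf : ∀ l, l ≠ x → l ≠ y → f' l = f l) :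
    braiding m n q x y * siteMap f = siteMap f' * braiding m n q x y := by
  obtain ⟨c, -, hE, -⟩ := natRep_E_F hq hm Γ i
  rw [hE] at hx hy'
  rw [natRep_K_root_sigma] at hx'
  have hp := prev_ne (n := n) hm i
  obtain ⟨k1, k2⟩ := braidKeep_zero_vertex (n := n) (q := q) i hi
  obtain ⟨h1, h2, h3⟩ := parity_zero_vertex hm hn i hi
  refine braiding_move_right hxy hp hx (hy.trans Matrix.diagonal_one.symm) hx' hy' hf
    (fun a _ => k1 a) (fun a _ => k2 a) ?_ ?_ (fun b hb hb' => ?_)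
  all_goals
    simp only [braidSelf, braidSwap, root_apply, hp, hp.symm, if_true, if_false, sign, h1, h2, h3]
  · simp [hq]
  · simp
  · simp [hb, hb']

/-- The braiding moves the summand of `F_0` at the factor `y` to that at the factor `x`. -/
theorem braiding_F_zero (hq : q ≠ 0) (hm : 2 ≤ m) (hn : 2 ≤ n) (hxy : x ≠ y) (i : Fin (m + n))
    (hi : i.val = 0) (hx : f x = natRep q Γ (.F i))
    (hy : f y = natRep q Γ (.K (-⟨root m n i, hΓ i⟩)))
    (hx' : f' x = natRep q Γ .sigma ^ nodeParity m n i)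
    (hy' : f' y = natRep q Γ (.F i)) (hf : ∀ l, l ≠ x → l ≠ y → f' l = f l) :
    braiding m n q x y * siteMap f' = siteMap f * braiding m n q x y := by
  obtain ⟨c, -, -, hE⟩ := natRep_E_F hq hm Γ i
  rw [hE] at hx hy'
  rw [natRep_K_neg_root] at hy
  rw [natRep_sigma_pow] at hx'
  have hp := prev_ne (n := n) hm i
  obtain ⟨k1, k2⟩ := braidKeep_zero_vertex (n := n) (q := q) i hi
  obtain ⟨h1, h2, h3⟩ := parity_zero_vertex hm hn i hi
  refine braiding_move_left hxy hp.symm hx hy hx' hy' hf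
    (fun a _ => k2 a) (fun a _ => k1 a) ?_ ?_ (fun b hb hb' => ?_)
  all_goals
    simp only [braidSelf, braidSwap, root_apply, hp, hp.symm, if_true, if_false, sign, h1, h2, h3]
  · simp [hq]
  · simp
  · simp [hb, hb']

end Intertwine

/-! ### Hecke algebras: induction and commutation relations -/

section Hecke
variable {K : Type u} [Field K] {q : K} {d : ℕ}

theorem FiniteHecke.induction {p : FiniteHecke q d → Prop} (hT : ∀ i, p (FiniteHecke.T q i))
    (h1 : p 1) (hs : ∀ (c : K) a, p a → p (c • a)) (ha : ∀ a b, p a → p b → p (a + b))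
    (hm : ∀ a b, p a → p b → p (a * b)) (h : FiniteHecke q d) : p h := by
  obtain ⟨z, rfl⟩ : ∃ z, FiniteHecke.mk q d z = h := RingQuot.mkAlgHom_surjective K _ h
  induction z with
  | grade0 c =>
    rw [AlgHom.commutes, Algebra.algebraMap_eq_smul_one]; exact hs c 1 h1
  | grade1 i => exact hT i
  | mul a b iha ihb => rw [map_mul]; exact hm _ _ iha ihb
  | add a b iha ihb => rw [map_add]; exact ha _ _ iha ihb

theorem AffineHecke.induction {p : AffineHecke q d → Prop} (hg : ∀ g, p (AffineHecke.gen q g))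
    (h1 : p 1) (hs : ∀ (c : K) a, p a → p (c • a)) (ha : ∀ a b, p a → p b → p (a + b))
    (hm : ∀ a b, p a → p b → p (a * b)) (h : AffineHecke q d) : p h := by
  obtain ⟨z, rfl⟩ : ∃ z, AffineHecke.mk q d z = h := RingQuot.mkAlgHom_surjective K _ h
  induction z with
  | grade0 c =>
    rw [AlgHom.commutes, Algebra.algebraMap_eq_smul_one]; exact hs c 1 h1
  | grade1 g => exact hg g
  | mul a b iha ihb => rw [map_mul]; exact hm _ _ iha ihb
  | add a b iha ihb => rw [map_add]; exact ha _ _ iha ihb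

theorem sq_of_quad {A : Type u} [Ring A] [Algebra K A] (hq : q ≠ 0) {t : A}
    (ht : (t + algebraMap K A q⁻¹) * (t - algebraMap K A q) = 0) :
    t * t = (q - q⁻¹) • t + 1 := by
  have h3 : algebraMap K A q⁻¹ * algebraMap K A q = 1 := by
    rw [← map_mul, inv_mul_cancel₀ hq, map_one]
  rw [add_mul, mul_sub, mul_sub, h3, ← Algebra.commutes, ← Algebra.smul_def,
    ← Algebra.smul_def] at ht
  rw [← sub_eq_zero, ← ht]
  module

theorem AffineHecke.T_sq (hq : q ≠ 0) (i : Fin (d - 1)) :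
    AffineHecke.gen q (.T i) * AffineHecke.gen q (.T i) =
      (q - q⁻¹) • AffineHecke.gen q (.T i) + (1 : AffineHecke q d) :=
  sq_of_quad hq (AffineHecke.rel (.finite _ _ (.quad i)))

/-- The relations between a generator `t` of a Hecke algebra with parameter `c = q - q⁻¹` and two
neighbouring elements `u`, `u'` of the lattice part: `t u = c u + u' t` and `t u' = u (t - c)`. -/
structure HeckePair {A : Type u} [Ring A] [Algebra K A] (c : K) (t u u' : A) : Prop where
  left : t * u = c • u + u' * t
  right : t * u' = u * t - c • u

/-- The relation `t y t = y'` in solved form. -/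
theorem HeckePair.of_conj {A : Type u} [Ring A] [Algebra K A] {c : K} {t y y' : A}
    (ht : t * t = c • t + 1) (h : t * y * t = y') : HeckePair c t y' y where
  left := by
    rw [← h, ← mul_assoc, ← mul_assoc, ht]
    simp only [add_mul, smul_mul_assoc, one_mul]
  right := by
    rw [← h, mul_assoc _ t t, ht]
    simp only [mul_add, mul_smul_comm, mul_one]
    module

/-- The relations pass to the inverses of the two lattice elements, with the roles exchanged. -/
theorem HeckePair.inv {A : Type u} [Ring A] [Algebra K A] {c : K} {t y y' z z' : A}
    (h : HeckePair c t y' y) (h1 : z * y = 1) (h2 : y * z = 1) (h3 : z' * y' = 1)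
    (h4 : y' * z' = 1) : HeckePair c t z z' where
  left := by
    have e : z' * (t * y) * z = z' * (y' * t - c • y') * z := by rw [h.right]
    rw [mul_assoc, mul_assoc t, h2, mul_one, mul_sub, ← mul_assoc, h3, one_mul, mul_smul_comm, h3,
      sub_mul, smul_mul_assoc, one_mul] at e
    rw [e]; abel
  right := by
    have e : z * (t * y') * z' = z * (c • y' + y * t) * z' := by rw [h.left]
    rw [mul_assoc, mul_assoc t, h4, mul_one, mul_add, ← mul_assoc z y, h1, one_mul, mul_smul_comm,
      add_mul, smul_mul_assoc, mul_assoc z, h4, mul_one] at e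
    rw [e]; abel

theorem AffineHecke.pair_y (hq : q ≠ 0) (i : Fin (d - 1)) :
    HeckePair (q - q⁻¹) (AffineHecke.gen q (.T i)) (AffineHecke.gen q (.y (upper i)))
      (AffineHecke.gen q (.y (lower i)) : AffineHecke q d) :=
  .of_conj (AffineHecke.T_sq hq i) (AffineHecke.rel (.T_y_T i))

theorem AffineHecke.pair_yInv (hq : q ≠ 0) (i : Fin (d - 1)) :
    HeckePair (q - q⁻¹) (AffineHecke.gen q (.T i)) (AffineHecke.gen q (.yInv (lower i)))
      (AffineHecke.gen q (.yInv (upper i)) : AffineHecke q d) :=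
  (AffineHecke.pair_y hq i).inv (AffineHecke.rel (.inv_mul _)) (AffineHecke.rel (.mul_inv _))
    (AffineHecke.rel (.inv_mul _)) (AffineHecke.rel (.mul_inv _))

theorem AffineHecke.yInv_T {j : Fin d} {i : Fin (d - 1)} (h₁ : j ≠ lower i) (h₂ : j ≠ upper i) :
    AffineHecke.gen q (.yInv j) * AffineHecke.gen q (.T i) =
      AffineHecke.gen q (.T i) * (AffineHecke.gen q (.yInv j) : AffineHecke q d) := by
  have h := AffineHecke.rel (q := q) (.y_T j i h₁ h₂)
  have e1 := AffineHecke.rel (q := q) (.mul_inv j)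
  have e2 := AffineHecke.rel (q := q) (.inv_mul j)
  calc AffineHecke.gen q (.yInv j) * AffineHecke.gen q (.T i)
      = AffineHecke.gen q (.yInv j) * (AffineHecke.gen q (.T i) * AffineHecke.gen q (.y j)) *
          AffineHecke.gen q (.yInv j) := by rw [mul_assoc, mul_assoc, e1, mul_one]
    _ = _ := by rw [← h, ← mul_assoc, e2, one_mul]

theorem lower_ne_upper (i : Fin (d - 1)) : lower i ≠ upper i := by
  simp [lower, upper, Fin.ext_iff]

variable {m n : ℕ}

theorem heckeAction_T (hq : q ≠ 0) (i : Fin (d - 1)) :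
    heckeAction m n hq d (FiniteHecke.T q i) = braiding m n q (lower i) (upper i) :=
  FiniteHecke.lift_T _ _ _

theorem finiteToAffine_T (i : Fin (d - 1)) :
    finiteToAffine q d (FiniteHecke.T q i) = AffineHecke.gen q (.T i) :=
  FiniteHecke.lift_T _ _ _

variable {M : Type u} [AddCommGroup M] [Module K M] [Module (AffineHecke q d)ᵐᵒᵖ M]

theorem balanced_T (hq : q ≠ 0) (i : Fin (d - 1)) (x : M) (v : TensorPower K (m + n) d) :
    (Submodule.Quotient.mk ((MulOpposite.op (AffineHecke.gen q (.T i)) • x) ⊗ₜ v) :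
      SchurWeyl m n hq d M) =
    Submodule.Quotient.mk (x ⊗ₜ braiding m n q (lower i) (upper i) v) := by
  rw [Submodule.Quotient.eq, ← finiteToAffine_T, ← heckeAction_T hq]
  exact Submodule.subset_span ⟨_, x, v, rfl⟩

variable [IsScalarTower K (AffineHecke q d)ᵐᵒᵖ M]

/-- It is enough to balance the generators of the Hecke algebra. -/
theorem balancedRelations_le (hq : q ≠ 0) {W : Type*} [AddCommGroup W] [Module K W]
    (L : M ⊗[K] TensorPower K (m + n) d →ₗ[K] W)
    (h : ∀ i x v, L ((MulOpposite.op (AffineHecke.gen q (.T i)) • x) ⊗ₜ v) =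
      L (x ⊗ₜ braiding m n q (lower i) (upper i) v)) :
    balancedRelations m n hq d M ≤ LinearMap.ker L := by
  have key : ∀ h x v, L ((MulOpposite.op (finiteToAffine q d h) • x) ⊗ₜ v) =
      L (x ⊗ₜ heckeAction m n hq d h v) := by
    intro h
    induction h using FiniteHecke.induction with
    | hT i => intro x v; rw [finiteToAffine_T, heckeAction_T, h]
    | h1 => intro x v; simp
    | hs c a ih =>
      intro x v
      rw [map_smul, map_smul, MulOpposite.op_smul, smul_assoc, ← TensorProduct.smul_tmul',
        LinearMap.smul_apply, TensorProduct.tmul_smul, map_smul, map_smul, ih]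
    | ha a b iha ihb =>
      intro x v
      rw [map_add, map_add, MulOpposite.op_add, add_smul, TensorProduct.add_tmul,
        LinearMap.add_apply, TensorProduct.tmul_add, map_add, map_add, iha, ihb]
    | hm a b iha ihb =>
      intro x v
      rw [map_mul, map_mul, MulOpposite.op_mul, mul_smul, ihb, iha]; rfl
  rw [balancedRelations, Submodule.span_le]
  rintro _ ⟨h, x, v, rfl⟩
  rw [SetLike.mem_coe, LinearMap.mem_ker, map_sub, key, sub_self]

end Hecke

/-! ### The action on the balanced tensor product -/

section Action
variable {K : Type u} [Field K] {q : K} {d : ℕ} {m n : ℕ}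
  {Γ : AddSubgroup (WeightLattice m n)} {hΓ : ∀ i, root m n i ∈ Γ}
  {M : Type u} [AddCommGroup M] [Module K M] [Module (AffineHecke q d)ᵐᵒᵖ M]
  [IsScalarTower K (AffineHecke q d)ᵐᵒᵖ M]

theorem rightMul_apply (h : AffineHecke q d) (x : M) : rightMul M h x = MulOpposite.op h • x := rfl

theorem rightMul_mul (a b : AffineHecke q d) : rightMul M a * rightMul M b = rightMul M (b * a) := by
  ext x
  simp only [Module.End.mul_apply, rightMul_apply, MulOpposite.op_mul, mul_smul]

theorem rightMul_one : rightMul M (1 : AffineHecke q d) = 1 := by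
  ext x
  simp [rightMul_apply]

/-- Right multiplication by `y_j`. -/
def rightY (q : K) (M : Type u) [AddCommGroup M] [Module K M] [Module (AffineHecke q d)ᵐᵒᵖ M]
    [IsScalarTower K (AffineHecke q d)ᵐᵒᵖ M] (j : Fin d) : (Module.End K M)ˣ where
  val := rightMul M (AffineHecke.gen q (.y j))
  inv := rightMul M (AffineHecke.gen q (.yInv j))
  val_inv := by rw [rightMul_mul, AffineHecke.rel (.inv_mul j), rightMul_one]
  inv_val := by rw [rightMul_mul, AffineHecke.rel (.mul_inv j), rightMul_one]

theorem rightY_commute (j k : Fin d) :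
    Commute (rightY q M j : Module.End K M) (rightY q M k : Module.End K M) := by
  change rightMul M _ * rightMul M _ = rightMul M _ * rightMul M _
  rw [rightMul_mul, rightMul_mul, AffineHecke.rel (.y_comm j k)]

theorem sum_root_fst : (∑ i, root m n i).1 = 0 := by
  funext a
  rw [Prod.fst_sum, Finset.sum_apply]
  simp only [root_apply, Finset.sum_sub_distrib, Finset.sum_ite_eq, Finset.mem_univ, if_true]
  rw [Finset.sum_eq_single (next a)]
  · simp [prev_next]
  · intro b _ hb
    rw [if_neg]
    exact fun h => hb (prev_eq_iff.mp h.symm)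
  · simp

/-- On `V` the element `K_{α_0}` acts as `K_Π⁻¹`, because the sum of all simple roots is `δ`. -/
theorem natK_root_zero (i : Fin (m + n)) (hi : i.val = 0) :
    natK q (root m n i) = natK q (-finiteRootSum m n) := by
  have h : (-finiteRootSum m n).1 = (root m n i).1 := by
    have h1 : root m n i + finiteRootSum m n = ∑ i, root m n i := by
      rw [finiteRootSum, ← Finset.add_sum_erase _ _ (Finset.mem_univ i)]
      congr 2
      ext j
      simp only [Finset.mem_filter, Finset.mem_univ, true_and, Finset.mem_erase, and_true, ne_eq,
        Fin.ext_iff, hi]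
    have h2 := congrArg Prod.fst h1
    rw [sum_root_fst, Prod.fst_add] at h2
    rw [Prod.fst_neg, eq_comm, ← add_eq_zero_iff_eq_neg]
    exact h2
  simp only [natK, form_eps, h]

theorem natK_neg_root_zero (i : Fin (m + n)) (hi : i.val = 0) :
    natK q (-root m n i) = natK q (finiteRootSum m n) := by
  have h : ∀ v : WeightLattice m n, natK q (-v) = Matrix.diagonal fun a =>
      (q ^ form v (eps m n a))⁻¹ := fun v => by simp only [natK, form_neg_left, zpow_neg]
  have h1 := natK_root_zero (q := q) i hi
  have h2 : (fun a => q ^ form (root m n i) (eps m n a)) = _ :=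
    Matrix.diagonal_injective (natK_root_zero (q := q) i hi)
  rw [h]
  simp only [natK]
  congr 1
  funext a
  rw [congrFun h2 a, form_neg_left, zpow_neg, inv_inv]

/-- The formulas that define the action are an instance of the iterated comultiplication, the
spectral parameters being the commuting operators of right multiplication by the `y_j`. -/
theorem schurWeylOperator_eq :
    schurWeylOperator q Γ d M = iteratedRep q hΓ (rightY q M) d := by
  funext g
  have hd : ∀ l : Fin d, l.val < d := fun l => l.isLt
  cases g with
  | sigma => simp only [iteratedRep, hd, if_true]; rfl
  | K γ => simp only [iteratedRep, hd, if_true]; rfl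
  | E i =>
    simp only [iteratedRep, hd, Finset.filter_true, schurWeylOperator]
    by_cases hi : i.val = 0
    · simp only [if_pos hi]
      refine Finset.sum_congr rfl fun k _ => ?_
      have hp : nodeParity m n i = 1 := by simp [nodeParity, hi]
      have e : natRep q Γ (.K ⟨root m n i, hΓ i⟩) * natRep q Γ .sigma ^ nodeParity m n i =
          natSigma K m n * natK q (-finiteRootSum m n) := by
        rw [hp, pow_one, ← natK_root_zero i hi]
        simp only [natRep, natSigma, natK, Matrix.diagonal_mul_diagonal, mul_comm]
      rw [e]
      simp only [natRep, if_pos hi]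
      rfl
    · simp only [if_neg hi]
      refine Finset.sum_congr rfl fun k _ => ?_
      have e : natRep q Γ (.K ⟨root m n i, hΓ i⟩) * natRep q Γ .sigma ^ nodeParity m n i =
          natSigma K m n ^ nodeParity m n i * natK q (root m n i) := by
        simp only [natRep, natSigma, natK, Matrix.diagonal_pow, Matrix.diagonal_mul_diagonal,
          mul_comm]
      rw [e]
      simp only [natRep, if_neg hi]
      rfl
  | F i =>
    simp only [iteratedRep, hd, Finset.filter_true, if_true, schurWeylOperator]
    by_cases hi : i.val = 0
    · simp only [if_pos hi]
      refine Finset.sum_congr rfl fun k _ => ?_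
      have hp : nodeParity m n i = 1 := by simp [nodeParity, hi]
      simp only [natRep, if_pos hi, hp, pow_one, NegMemClass.coe_neg, natK_neg_root_zero i hi]
      rfl
    · simp only [if_neg hi]
      refine Finset.sum_congr rfl fun k _ => ?_
      simp only [natRep, if_neg hi, NegMemClass.coe_neg]
      rfl

end Action

section Descent
variable {K : Type u} [Field K] {q : K} {d : ℕ} {m n : ℕ}
  {Γ : AddSubgroup (WeightLattice m n)} {hΓ : ∀ i, root m n i ∈ Γ}
  {M : Type u} [AddCommGroup M] [Module K M] [Module (AffineHecke q d)ᵐᵒᵖ M]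
  [IsScalarTower K (AffineHecke q d)ᵐᵒᵖ M]

theorem sum_eq_pair_add {W : Type*} [AddCommMonoid W] {x y : Fin d} (hxy : x ≠ y) (g : Fin d → W) :
    ∑ k, g k = g x + g y + ∑ k with k ≠ x ∧ k ≠ y, g k := by
  have h : (Finset.univ : Finset (Fin d)) =
      insert x (insert y (Finset.univ.filter fun k => k ≠ x ∧ k ≠ y)) := by
    ext k; simp; tauto
  conv_lhs => rw [h]
  rw [Finset.sum_insert, Finset.sum_insert, add_assoc]
  · simp
  · simp [hxy]

/-- The exchange relation of a braiding `r` with `s`, `t`, in the form with `r` on the right. -/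
theorem exchange_right {A : Type*} [Ring A] [Algebra K A] {c : K} {r s t : A}
    (hr : r * r = c • r + 1) (h : r * s = t * r) : s * r = c • s + (r * t - c • t) := by
  have h1 : t = r * s * r - c • (r * s) := by
    rw [h, mul_assoc, hr, mul_add, mul_one, mul_smul_comm, add_sub_cancel_left]
  have h2 : r * t = c • (r * s * r) + s * r - c • (c • (r * s) + s) := by
    rw [h1, mul_sub, mul_smul_comm, ← mul_assoc, ← mul_assoc, hr, add_mul, add_mul, one_mul,
      smul_mul_assoc, smul_mul_assoc]
  rw [h2]
  nth_rw 1 [h1]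
  module

/-- Operators `1 ⊗ S` with `S` commuting with the braidings descend to the balanced tensor product. -/
theorem balanced_of_comm (hq : q ≠ 0) (S : Module.End K (TensorPower K (m + n) d))
    (hS : ∀ i, braiding m n q (lower i) (upper i) * S = S * braiding m n q (lower i) (upper i)) :
    balancedRelations m n hq d M ≤
      LinearMap.ker ((balancedRelations m n hq d M).mkQ ∘ₗ TensorProduct.map 1 S) := by
  refine balancedRelations_le hq _ fun i x v => ?_
  simp only [LinearMap.comp_apply, TensorProduct.map_tmul, Module.End.one_apply,
    Submodule.mkQ_apply]
  rw [balanced_T, ← Module.End.mul_apply, hS, Module.End.mul_apply]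

/-- Operators `∑ₖ u_k ⊗ S_k` in which the `u_k` satisfy the commutation relations of the lattice part
of the affine Hecke algebra and the `S_k` are exchanged by the braiding descend to the balanced
tensor product. -/
theorem balanced_of_exchange (hq : q ≠ 0) (u : Fin d → AffineHecke q d)
    (S : Fin d → Module.End K (TensorPower K (m + n) d))
    (h₁ : ∀ i k, k ≠ lower i → k ≠ upper i →
      u k * AffineHecke.gen q (.T i) = AffineHecke.gen q (.T i) * u k)
    (h₂ : ∀ i k, k ≠ lower i → k ≠ upper i →
      braiding m n q (lower i) (upper i) * S k = S k * braiding m n q (lower i) (upper i))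
    (h₃ : ∀ i, ∃ s t, (s = lower i ∧ t = upper i ∨ s = upper i ∧ t = lower i) ∧
      HeckePair (q - q⁻¹) (AffineHecke.gen q (.T i)) (u s) (u t) ∧
      braiding m n q (lower i) (upper i) * S s = S t * braiding m n q (lower i) (upper i)) :
    balancedRelations m n hq d M ≤
      LinearMap.ker ((balancedRelations m n hq d M).mkQ ∘ₗ
        ∑ k, TensorProduct.map (rightMul M (u k)) (S k)) := by
  refine balancedRelations_le hq _ fun i x v => ?_
  obtain ⟨s, t, hst, hu, hS⟩ := h₃ i
  have hne : s ≠ t := by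
    rcases hst with ⟨rfl, rfl⟩ | ⟨rfl, rfl⟩
    exacts [lower_ne_upper i, (lower_ne_upper i).symm]
  set R := braiding m n q (lower i) (upper i) with hR
  have hRR : R * R = (q - q⁻¹) • R + 1 := braiding_sq m n hq _ _
  rw [sum_eq_pair_add hne]
  simp only [LinearMap.comp_apply, LinearMap.add_apply, LinearMap.sum_apply,
    TensorProduct.map_tmul, map_add, map_sum, Submodule.mkQ_apply, rightMul_apply]
  congr 1
  · generalize q - q⁻¹ = c at hu hRR ⊢
    have e1 : S s * R = c • S s + (R * S t - c • S t) :=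
      exchange_right (A := Module.End K (TensorPower K (m + n) d)) hRR hS
    have f1 : ∀ v, S s (R v) = c • S s v + (R (S t v) - c • S t v) := fun v =>
      LinearMap.congr_fun e1 v
    have f2 : ∀ v, S t (R v) = R (S s v) := fun v => (LinearMap.congr_fun hS v).symm
    rw [← mul_smul, ← MulOpposite.op_mul, ← mul_smul, ← MulOpposite.op_mul, hu.left, hu.right,
      MulOpposite.op_add, MulOpposite.op_sub, MulOpposite.op_smul, MulOpposite.op_mul,
      MulOpposite.op_mul, f1, f2, add_smul, sub_smul, smul_assoc, mul_smul, mul_smul]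
    simp only [TensorProduct.add_tmul, TensorProduct.sub_tmul, TensorProduct.tmul_add,
      TensorProduct.tmul_sub, Submodule.Quotient.mk_add, Submodule.Quotient.mk_sub, balanced_T, ← hR,
      ← TensorProduct.smul_tmul' c, TensorProduct.tmul_smul]
    abel
  · refine Finset.sum_congr rfl fun k hk => ?_
    obtain ⟨hk1, hk2⟩ := (Finset.mem_filter.mp hk).2
    have hk3 : k ≠ lower i ∧ k ≠ upper i := by
      rcases hst with ⟨rfl, rfl⟩ | ⟨rfl, rfl⟩
      exacts [⟨hk1, hk2⟩, ⟨hk2, hk1⟩]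
    rw [← mul_smul, ← MulOpposite.op_mul, ← h₁ i k hk3.1 hk3.2, MulOpposite.op_mul, mul_smul,
      balanced_T, ← Module.End.mul_apply, h₂ i k hk3.1 hk3.2, Module.End.mul_apply]

/-- The matrices of the `k`-th summand of the operator of `E_i` on `V^{⊗ d}`. -/
def siteE (q : K) (hΓ : ∀ i, root m n i ∈ Γ) (i : Fin (m + n)) (k l : Fin d) :
    Matrix (Fin (m + n)) (Fin (m + n)) K :=
  if l < k then natRep q Γ (.K ⟨root m n i, hΓ i⟩) * natRep q Γ .sigma ^ nodeParity m n i
  else if l = k then natRep q Γ (.E i) else 1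

/-- The matrices of the `k`-th summand of the operator of `F_i` on `V^{⊗ d}`. -/
def siteF (q : K) (hΓ : ∀ i, root m n i ∈ Γ) (i : Fin (m + n)) (k l : Fin d) :
    Matrix (Fin (m + n)) (Fin (m + n)) K :=
  if l < k then natRep q Γ .sigma ^ nodeParity m n i
  else if l = k then natRep q Γ (.F i) else natRep q Γ (.K (-⟨root m n i, hΓ i⟩))

theorem lt_lower_iff {i : Fin (d - 1)} {k : Fin d} (h₂ : k ≠ upper i) :
    lower i < k ↔ upper i < k := by
  simp only [ne_eq, Fin.ext_iff, Fin.lt_def, lower, upper] at *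
  omega

theorem lower_lt_upper (i : Fin (d - 1)) : lower i < upper i := by
  simp [Fin.lt_def, lower, upper]

theorem eq_lower_upper_cases {i : Fin (d - 1)} {l : Fin d} (h₁ : l ≠ lower i) (h₂ : l ≠ upper i) :
    (l < upper i ↔ l < lower i) ∧ l ≠ lower i ∧ l ≠ upper i := by
  simp only [ne_eq, Fin.ext_iff, Fin.lt_def, lower, upper] at *
  omega

theorem braiding_comm_siteE (i : Fin (m + n)) (t : Fin (d - 1)) (k : Fin d)
    (h₁ : k ≠ lower t) (h₂ : k ≠ upper t) :
    braiding m n q (lower t) (upper t) * siteMap (siteE q hΓ i k) =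
      siteMap (siteE q hΓ i k) * braiding m n q (lower t) (upper t) := by
  by_cases h : lower t < k
  · refine braiding_comm_siteMap (lower_ne_upper t)
      (((if_pos h).trans (natRep_K_root_sigma i _)))
      (((if_pos ((lt_lower_iff h₂).mp h)).trans (natRep_K_root_sigma i _)))
  · have h' := (lt_lower_iff h₂).not.mp h
    refine braiding_comm_siteMap (D := fun _ => 1) (lower_ne_upper t) ?_ ?_ <;>
      simp [siteE, h, h', h₁.symm, h₂.symm]

theorem braiding_comm_siteF (i : Fin (m + n)) (t : Fin (d - 1)) (k : Fin d)
    (h₁ : k ≠ lower t) (h₂ : k ≠ upper t) :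
    braiding m n q (lower t) (upper t) * siteMap (siteF q hΓ i k) =
      siteMap (siteF q hΓ i k) * braiding m n q (lower t) (upper t) := by
  by_cases h : lower t < k
  · refine braiding_comm_siteMap (lower_ne_upper t)
      (((if_pos h).trans (natRep_sigma_pow _)))
      (((if_pos ((lt_lower_iff h₂).mp h)).trans (natRep_sigma_pow _)))
  · have h' := (lt_lower_iff h₂).not.mp h
    refine braiding_comm_siteMap (lower_ne_upper t) (((if_neg h).trans (if_neg h₁.symm)).trans
      (natRep_K_neg_root i)) (((if_neg h').trans (if_neg h₂.symm)).trans (natRep_K_neg_root i))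

theorem iteratedRep_E_eq (y : Fin d → (Module.End K M)ˣ) (i : Fin (m + n)) :
    iteratedRep q hΓ y d (.E i) = ∑ k, TensorProduct.map
      ((if i.val = 0 then (y k)⁻¹ else 1 : (Module.End K M)ˣ) : Module.End K M)
      (siteMap (siteE q hΓ i k)) := by
  simp only [iteratedRep, Fin.is_lt, Finset.filter_true]
  rfl

theorem iteratedRep_F_eq (y : Fin d → (Module.End K M)ˣ) (i : Fin (m + n)) :
    iteratedRep q hΓ y d (.F i) = ∑ k, TensorProduct.map
      ((if i.val = 0 then (y k) else 1 : (Module.End K M)ˣ) : Module.End K M)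
      (siteMap (siteF q hΓ i k)) := by
  simp only [iteratedRep, Fin.is_lt, Finset.filter_true, if_true]
  rfl

/-- The operators of the generators descend to the balanced tensor product. -/
theorem balanced_iteratedRep (hq : q ≠ 0) (hm : 2 ≤ m) (hn : 2 ≤ n) (g : Gen Γ) :
    balancedRelations m n hq d M ≤
      LinearMap.ker ((balancedRelations m n hq d M).mkQ ∘ₗ
        iteratedRep q hΓ (rightY q M) d g) := by
  have off : ∀ (t : Fin (d - 1)) (l : Fin d), l ≠ lower t → l ≠ upper t →
      (siteE q hΓ · (upper t) l) = (siteE q hΓ · (lower t) l) ∧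
      (siteF q hΓ · (upper t) l) = (siteF q hΓ · (lower t) l) := by
    intro t l h1 h2
    obtain ⟨h3, -, -⟩ := eq_lower_upper_cases h1 h2
    constructor <;> funext i <;> simp only [siteE, siteF, h3, h1, h2, if_false]
  cases g with
  | sigma =>
    simp only [iteratedRep, Fin.is_lt, if_true, siteOp]
    exact balanced_of_comm hq _ fun i =>
      braiding_comm_siteMap (lower_ne_upper i) (D := fun a => (-1) ^ parity m n a) rfl rfl
  | K γ =>
    simp only [iteratedRep, Fin.is_lt, if_true, siteOp]
    exact balanced_of_comm hq _ fun i =>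
      braiding_comm_siteMap (lower_ne_upper i) (D := fun a => q ^ form γ.1 (eps m n a)) rfl rfl
  | E i =>
    rw [iteratedRep_E_eq]
    have e1 : ∀ t : Fin (d - 1), siteE q hΓ i (lower t) (lower t) = natRep q Γ (.E i) :=
      fun t => by simp [siteE]
    have e2 : ∀ t : Fin (d - 1), siteE q hΓ i (lower t) (upper t) = 1 :=
      fun t => by simp [siteE, (lower_lt_upper t).not_gt, (lower_lt_upper t).ne']
    have e3 : ∀ t : Fin (d - 1), siteE q hΓ i (upper t) (lower t) =
      natRep q Γ (.K ⟨root m n i, hΓ i⟩) * natRep q Γ .sigma ^ nodeParity m n i :=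
      fun t => by simp [siteE, lower_lt_upper t]
    have e4 : ∀ t : Fin (d - 1), siteE q hΓ i (upper t) (upper t) = natRep q Γ (.E i) :=
      fun t => by simp [siteE]
    by_cases hi : i.val = 0
    · simp only [if_pos hi]
      refine balanced_of_exchange hq (fun k => AffineHecke.gen q (.yInv k)) _
        (fun t k h1 h2 => AffineHecke.yInv_T h1 h2) (braiding_comm_siteE i)
        fun t => ⟨lower t, upper t, .inl ⟨rfl, rfl⟩, AffineHecke.pair_yInv hq t, ?_⟩
      exact braiding_E_zero hq hm hn (lower_ne_upper t) i hi (e1 t) (e2 t) (e3 t) (e4 t)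
        fun l h1 h2 => congrFun (off t l h1 h2).1 i
    · simp only [if_neg hi, Units.val_one]
      have hs : (∑ k, TensorProduct.map (1 : Module.End K M) (siteMap (siteE q hΓ i k))) =
          TensorProduct.map 1 (∑ k : Fin d, siteMap (siteE q hΓ i k)) :=
        (map_sum (TensorProduct.mapBilinear (RingHom.id K) M _ M _ 1) _ _).symm
      rw [hs]
      refine balanced_of_comm hq _ fun t => ?_
      rw [sum_eq_pair_add (lower_ne_upper t), mul_add, add_mul, Finset.mul_sum, Finset.sum_mul]
      congr 1
      · exact braiding_comm_E hq hm (lower_ne_upper t) i hi (e1 t) (e2 t) (e3 t) (e4 t)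
          fun l h1 h2 => congrFun (off t l h1 h2).1 i
      · refine Finset.sum_congr rfl fun k hk => ?_
        obtain ⟨h1, h2⟩ := (Finset.mem_filter.mp hk).2
        exact braiding_comm_siteE i t k h1 h2
  | F i =>
    rw [iteratedRep_F_eq]
    have e1 : ∀ t : Fin (d - 1), siteF q hΓ i (lower t) (lower t) = natRep q Γ (.F i) :=
      fun t => by simp [siteF]
    have e2 : ∀ t : Fin (d - 1), siteF q hΓ i (lower t) (upper t) =
        natRep q Γ (.K (-⟨root m n i, hΓ i⟩)) :=
      fun t => by simp [siteF, (lower_lt_upper t).not_gt, (lower_lt_upper t).ne']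
    have e3 : ∀ t : Fin (d - 1), siteF q hΓ i (upper t) (lower t) =
      natRep q Γ .sigma ^ nodeParity m n i :=
      fun t => by simp [siteF, lower_lt_upper t]
    have e4 : ∀ t : Fin (d - 1), siteF q hΓ i (upper t) (upper t) = natRep q Γ (.F i) :=
      fun t => by simp [siteF]
    by_cases hi : i.val = 0
    · simp only [if_pos hi]
      refine balanced_of_exchange hq (fun k => AffineHecke.gen q (.y k)) _
        (fun t k h1 h2 => AffineHecke.rel (.y_T k t h1 h2)) (braiding_comm_siteF i)
        fun t => ⟨upper t, lower t, .inr ⟨rfl, rfl⟩, AffineHecke.pair_y hq t, ?_⟩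
      exact braiding_F_zero hq hm hn (lower_ne_upper t) i hi (e1 t) (e2 t) (e3 t) (e4 t)
        fun l h1 h2 => congrFun (off t l h1 h2).2 i
    · simp only [if_neg hi, Units.val_one]
      have hs : (∑ k, TensorProduct.map (1 : Module.End K M) (siteMap (siteF q hΓ i k))) =
          TensorProduct.map 1 (∑ k : Fin d, siteMap (siteF q hΓ i k)) :=
        (map_sum (TensorProduct.mapBilinear (RingHom.id K) M _ M _ 1) _ _).symm
      rw [hs]
      refine balanced_of_comm hq _ fun t => ?_
      rw [sum_eq_pair_add (lower_ne_upper t), mul_add, add_mul, Finset.mul_sum, Finset.sum_mul]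
      congr 1
      · exact braiding_comm_F hq hm (lower_ne_upper t) i hi (e1 t) (e2 t) (e3 t) (e4 t)
          fun l h1 h2 => congrFun (off t l h1 h2).2 i
      · refine Finset.sum_congr rfl fun k hk => ?_
        obtain ⟨h1, h2⟩ := (Finset.mem_filter.mp hk).2
        exact braiding_comm_siteF i t k h1 h2

/-- The formulas define a representation on the balanced tensor product, and only one. -/
theorem existsUnique_isSchurWeylAction (hq : q ≠ 0) (hq2 : q ^ 2 ≠ 1) (hm : 2 ≤ m) (hn : 2 ≤ n) :
    ∃! ρ : AffineQuantum q Γ hΓ →ₐ[K] Module.End K (SchurWeyl m n hq d M),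
      IsSchurWeylAction hq Γ hΓ d M ρ := by
  have hrep := isRep_iteratedRep (Γ := Γ) (hΓ := hΓ) hq hq2 hm hn (rightY q M) rightY_commute d
    le_rfl
  let X : Gen Γ → Module.End K (SchurWeyl m n hq d M) := fun g =>
    (balancedRelations m n hq d M).liftQ _ (balanced_iteratedRep (hΓ := hΓ) hq hm hn g)
  have hX : ∀ g w, X g (Submodule.Quotient.mk w) =
      Submodule.Quotient.mk (iteratedRep q hΓ (rightY q M) d g w) := fun g w => rfl
  have hlift : ∀ z w, FreeAlgebra.lift K X z (Submodule.Quotient.mk w) =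
      Submodule.Quotient.mk (FreeAlgebra.lift K (iteratedRep q hΓ (rightY q M) d) z w) := by
    intro z
    induction z with
    | grade0 c =>
      intro w
      rw [AlgHom.commutes, AlgHom.commutes]; rfl
    | grade1 g => intro w; rw [FreeAlgebra.lift_ι_apply, FreeAlgebra.lift_ι_apply, hX]
    | mul a b iha ihb =>
      intro w
      rw [map_mul, map_mul, Module.End.mul_apply, ihb, iha]; rfl
    | add a b iha ihb =>
      intro w
      rw [map_add, map_add, LinearMap.add_apply, iha, ihb]; rfl
  have hrel : ∀ a b, QuantumRel q Γ hΓ a b → FreeAlgebra.lift K X a = FreeAlgebra.lift K X b := by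
    intro a b hab
    refine LinearMap.ext fun w => ?_
    obtain ⟨w, rfl⟩ := Submodule.Quotient.mk_surjective _ w
    rw [hlift, hlift, hrep.lift_eq hab]
  refine ⟨IsRep.toAlgHom hrel, fun g w => ?_, fun ρ hρ => ?_⟩
  · rw [IsRep.toAlgHom_gen, hX, schurWeylOperator_eq (hΓ := hΓ)]
  · refine AffineQuantum.hom_ext fun g => LinearMap.ext fun w => ?_
    obtain ⟨w, rfl⟩ := Submodule.Quotient.mk_surjective _ w
    rw [hρ g w, IsRep.toAlgHom_gen, hX, schurWeylOperator_eq (hΓ := hΓ)]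

end Descent

/-! ### Laurent polynomials and Demazure operators -/

section Laurent
variable {K : Type u} [Field K] {d : ℕ}

/-- Laurent polynomials in `y_0, …, y_{d-1}`. -/
abbrev Laurent (K : Type u) [Field K] (d : ℕ) : Type u := AddMonoidAlgebra K (Fin d → ℤ)

/-- The variable `y_j`, a unit of the ring of Laurent polynomials. -/
def Laurent.y (K : Type u) [Field K] {d : ℕ} (j : Fin d) : (Laurent K d)ˣ where
  val := AddMonoidAlgebra.single (Pi.single j 1) 1
  inv := AddMonoidAlgebra.single (Pi.single j (-1)) 1
  val_inv := by
    rw [AddMonoidAlgebra.single_mul_single, ← Pi.single_add]; simp [AddMonoidAlgebra.one_def]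
  inv_val := by
    rw [AddMonoidAlgebra.single_mul_single, ← Pi.single_add]; simp [AddMonoidAlgebra.one_def]

theorem Laurent.y_injective : Function.Injective fun j : Fin d => (Laurent.y K j : Laurent K d) := by
  intro a b h
  by_contra hab
  have h1 := congrArg (fun f : Laurent K d => f.coeff (Pi.single a 1)) h
  simp only [Laurent.y, AddMonoidAlgebra.coeff_single] at h1
  rw [Finsupp.single_eq_same, Finsupp.single_eq_of_ne] at h1
  · exact one_ne_zero h1
  · intro h2
    have := congrFun h2 a
    simp [hab] at this

/-- A subset of the Laurent polynomials that contains the variables, their inverses and the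
constants, and is stable under sums and products, is everything. -/
theorem Laurent.induction {p : Laurent K d → Prop} (hy : ∀ j : Fin d, p (Laurent.y K j))
    (hy' : ∀ j : Fin d, p ((Laurent.y K j)⁻¹ : (Laurent K d)ˣ)) (h1 : p 1)
    (hs : ∀ (c : K) a, p a → p (c • a))
    (ha : ∀ a b, p a → p b → p (a + b)) (hm : ∀ a b, p a → p b → p (a * b)) (f : Laurent K d) :
    p f := by
  have hpow : ∀ j (k : ℤ), p (AddMonoidAlgebra.single (Pi.single j k) 1) := by
    intro j k
    induction k with
    | zero => simpa [AddMonoidAlgebra.one_def] using h1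
    | succ k ih =>
      have := hm _ _ ih (hy j)
      simp only [Laurent.y, AddMonoidAlgebra.single_mul_single, ← Pi.single_add, one_mul] at this
      exact this
    | pred k ih =>
      have := hm _ _ ih (hy' j)
      simp only [Laurent.y, Units.inv_mk, AddMonoidAlgebra.single_mul_single, ← Pi.single_add,
        one_mul] at this
      exact this
  have hmon : ∀ (s : Finset (Fin d)) (v : Fin d → ℤ),
      p (AddMonoidAlgebra.single (∑ j ∈ s, Pi.single j (v j)) 1) := by
    intro s v
    induction s using Finset.induction_on with
    | empty => simpa [AddMonoidAlgebra.one_def] using h1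
    | insert j s hj ih =>
      rw [Finset.sum_insert hj]
      have := hm _ _ (hpow j (v j)) ih
      rwa [AddMonoidAlgebra.single_mul_single, one_mul] at this
  induction f using AddMonoidAlgebra.induction_linear with
  | zero => simpa using hs 0 1 h1
  | add a b iha ihb => exact ha _ _ iha ihb
  | single v c =>
    have := hs c _ (hmon Finset.univ v)
    rw [Finset.univ_sum_single, AddMonoidAlgebra.smul_single] at this
    simpa using this

/-- Permutation of the variables. -/
def Laurent.perm (K : Type u) [Field K] {d : ℕ} (w : Equiv.Perm (Fin d)) :
    Laurent K d →ₐ[K] Laurent K d :=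
  AddMonoidAlgebra.mapDomainAlgHom K K (LinearMap.funLeft ℤ ℤ w.symm).toAddMonoidHom

theorem Laurent.perm_single (w : Equiv.Perm (Fin d)) (v : Fin d → ℤ) (c : K) :
    Laurent.perm K w (AddMonoidAlgebra.single v c) = AddMonoidAlgebra.single (v ∘ w.symm) c := by
  simp [Laurent.perm]; rfl

theorem Laurent.perm_y (w : Equiv.Perm (Fin d)) (j : Fin d) :
    Laurent.perm K w (Laurent.y K j) = Laurent.y K (w j) := by
  simp only [Laurent.y, Laurent.perm_single]
  congr 1
  ext l
  simp [Pi.single_apply, Equiv.symm_apply_eq]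

theorem Laurent.perm_yInv (w : Equiv.Perm (Fin d)) (j : Fin d) :
    Laurent.perm K w ↑(Laurent.y K j)⁻¹ = ↑(Laurent.y K (w j))⁻¹ := by
  simp only [Laurent.y, Units.inv_mk, Laurent.perm_single]
  congr 1
  ext l
  simp [Pi.single_apply, Equiv.symm_apply_eq]

theorem Laurent.perm_perm (w w' : Equiv.Perm (Fin d)) (f : Laurent K d) :
    Laurent.perm K w (Laurent.perm K w' f) = Laurent.perm K (w * w') f := by
  induction f using AddMonoidAlgebra.induction_linear with
  | zero => simp
  | add a b iha ihb => simp only [map_add, iha, ihb]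
  | single v c => rw [perm_single, perm_single, perm_single]; rfl

theorem Laurent.perm_one (f : Laurent K d) : Laurent.perm K 1 f = f := by
  induction f using AddMonoidAlgebra.induction_linear with
  | zero => simp
  | add a b iha ihb => simp only [map_add, iha, ihb]
  | single v c => rw [perm_single]; rfl

/-- The divisibility that makes the Demazure operators well defined. -/
theorem Laurent.dvd_sub_swap (a b : Fin d) (f : Laurent K d) :
    (Laurent.y K b - Laurent.y K a : Laurent K d) ∣ f - Laurent.perm K (Equiv.swap a b) f := by
  induction f using Laurent.induction with
  | hy j =>
    rw [perm_y]
    rcases eq_or_ne j a with rfl | ha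
    · rw [Equiv.swap_apply_left]; exact ⟨-1, by ring⟩
    · rcases eq_or_ne j b with rfl | hb
      · rw [Equiv.swap_apply_right]
      · rw [Equiv.swap_apply_of_ne_of_ne ha hb, sub_self]; exact dvd_zero _
  | hy' j =>
    rw [perm_yInv]
    have key : ∀ u v : (Laurent K d)ˣ, (↑u⁻¹ - ↑v⁻¹ : Laurent K d) = (v - u) * (↑u⁻¹ * ↑v⁻¹) := by
      intro u v
      rw [sub_mul, mul_left_comm, Units.mul_inv, mul_one, ← mul_assoc, Units.mul_inv, one_mul]
    rw [key]
    rcases eq_or_ne j a with rfl | ha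
    · rw [Equiv.swap_apply_left]; exact Dvd.intro _ rfl
    · rcases eq_or_ne j b with rfl | hb
      · rw [Equiv.swap_apply_right]
        exact (dvd_sub_comm.mp dvd_rfl).mul_right _
      · rw [Equiv.swap_apply_of_ne_of_ne ha hb, sub_self, zero_mul]; exact dvd_zero _
  | h1 => simp
  | hs c f ih =>
    rw [map_smul, ← smul_sub, Algebra.smul_def]; exact ih.mul_left _
  | ha f g ihf ihg =>
    rw [map_add, add_sub_add_comm]; exact dvd_add ihf ihg
  | hm f g ihf ihg =>
    rw [map_mul, show ∀ f g f' g' : Laurent K d, f * g - f' * g' = (f - f') * g + f' * (g - g') by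
      intros; ring]
    exact dvd_add (ihf.mul_right _) (ihg.mul_left _)

theorem Laurent.y_sub_ne_zero {a b : Fin d} (h : a ≠ b) :
    (Laurent.y K b - Laurent.y K a : Laurent K d) ≠ 0 := fun h' =>
  h (Laurent.y_injective (sub_eq_zero.mp h')).symm

theorem exists_demazure (a b : Fin d) (f : Laurent K d) : ∃ g : Laurent K d,
    (Laurent.y K b - Laurent.y K a) * g =
      Laurent.y K b * (f - Laurent.perm K (Equiv.swap a b) f) := by
  obtain ⟨g, hg⟩ := Laurent.dvd_sub_swap a b f
  exact ⟨Laurent.y K b * g, by rw [hg, mul_left_comm]⟩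

/-- The Demazure operator `f ↦ y_b (f - s f) / (y_b - y_a)`, with `s` the exchange of `y_a` and
`y_b`. -/
def demazure (K : Type u) [Field K] {d : ℕ} {a b : Fin d} (h : a ≠ b) :
    Laurent K d →ₗ[K] Laurent K d where
  toFun f := (exists_demazure a b f).choose
  map_add' f g := by
    refine mul_left_cancel₀ (Laurent.y_sub_ne_zero (K := K) h) ?_
    rw [mul_add, (exists_demazure a b _).choose_spec, (exists_demazure a b _).choose_spec,
      (exists_demazure a b _).choose_spec, map_add]
    ring
  map_smul' c f := by
    refine mul_left_cancel₀ (Laurent.y_sub_ne_zero (K := K) h) ?_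
    rw [RingHom.id_apply, mul_smul_comm, (exists_demazure a b _).choose_spec,
      (exists_demazure a b _).choose_spec, map_smul, ← smul_sub, mul_smul_comm]

theorem demazure_spec {a b : Fin d} (h : a ≠ b) (f : Laurent K d) :
    (Laurent.y K b - Laurent.y K a) * demazure K h f =
      Laurent.y K b * (f - Laurent.perm K (Equiv.swap a b) f) :=
  (exists_demazure a b f).choose_spec

theorem demazure_eq {a b : Fin d} (h : a ≠ b) {f g : Laurent K d}
    (hg : (Laurent.y K b - Laurent.y K a) * g =
      Laurent.y K b * (f - Laurent.perm K (Equiv.swap a b) f)) : demazure K h f = g :=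
  mul_left_cancel₀ (Laurent.y_sub_ne_zero (K := K) h) ((demazure_spec h f).trans hg.symm)

/-- A Laurent polynomial as an element of the field of fractions. -/
abbrev Laurent.frac (f : Laurent K d) : FractionRing (Laurent K d) := algebraMap _ _ f

theorem Laurent.frac_injective : Function.Injective (Laurent.frac : Laurent K d → _) :=
  IsFractionRing.injective _ _

theorem Laurent.frac_sub_ne_zero {a b : Fin d} (h : a ≠ b) :
    Laurent.frac (Laurent.y K b : Laurent K d) - Laurent.frac (Laurent.y K a : Laurent K d) ≠ 0 :=
  fun h' => Laurent.y_sub_ne_zero (K := K) h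
    (sub_eq_zero.mpr (Laurent.frac_injective (sub_eq_zero.mp h')))

/-- Values of the Demazure operators in the field of fractions. -/
theorem Laurent.frac_perm_demazure {a b : Fin d} (h : a ≠ b) (w : Equiv.Perm (Fin d))
    (f : Laurent K d) :
    Laurent.frac (Laurent.perm K w (demazure K h f)) =
      Laurent.frac (Laurent.y K (w b) : Laurent K d) /
        (Laurent.frac (Laurent.y K (w b) : Laurent K d) - Laurent.frac (Laurent.y K (w a) : Laurent K d)) *
        (Laurent.frac (Laurent.perm K w f) -
          Laurent.frac (Laurent.perm K (w * Equiv.swap a b) f)) := by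
  have h1 := congrArg (Laurent.perm K w) (demazure_spec h f)
  simp only [map_mul, map_sub, Laurent.perm_y, Laurent.perm_perm] at h1
  have h2 := congrArg Laurent.frac h1
  simp only [Laurent.frac, map_mul, map_sub] at h2
  rw [div_mul_eq_mul_div, eq_div_iff (Laurent.frac_sub_ne_zero (w.injective.ne h)), mul_comm, h2]

theorem Laurent.frac_demazure {a b : Fin d} (h : a ≠ b) (f : Laurent K d) :
    Laurent.frac (demazure K h f) = Laurent.frac (Laurent.y K b : Laurent K d) /
      (Laurent.frac (Laurent.y K b : Laurent K d) - Laurent.frac (Laurent.y K a : Laurent K d)) *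
        (Laurent.frac f - Laurent.frac (Laurent.perm K (Equiv.swap a b) f)) := by
  simpa [Laurent.perm_one] using Laurent.frac_perm_demazure h 1 f

theorem demazure_demazure {a b : Fin d} (h : a ≠ b) (f : Laurent K d) :
    demazure K h (demazure K h f) = demazure K h f := by
  apply Laurent.frac_injective
  have := Laurent.frac_sub_ne_zero (K := K) h
  have h2 : Laurent.frac (Laurent.y K a : Laurent K d) - Laurent.frac (Laurent.y K b : Laurent K d) ≠ 0 :=
    Laurent.frac_sub_ne_zero (K := K) h.symm
  simp only [Laurent.frac_perm_demazure, Laurent.frac_demazure, Equiv.swap_apply_left,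
    Equiv.swap_apply_right, Equiv.swap_mul_self, Laurent.perm_one]
  generalize Laurent.frac (Laurent.y K a : Laurent K d) = A at *
  generalize Laurent.frac (Laurent.y K b : Laurent K d) = B at *
  field_simp
  ring

/-- The relation `1 + D s + s D = s` between the Demazure operator `D` and the exchange `s`. -/
theorem add_demazure_perm {a b : Fin d} (h : a ≠ b) (f : Laurent K d) :
    f + demazure K h (Laurent.perm K (Equiv.swap a b) f) +
      Laurent.perm K (Equiv.swap a b) (demazure K h f) = Laurent.perm K (Equiv.swap a b) f := by
  apply Laurent.frac_injective
  have := Laurent.frac_sub_ne_zero (K := K) h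
  have h2 : Laurent.frac (Laurent.y K a : Laurent K d) - Laurent.frac (Laurent.y K b : Laurent K d) ≠ 0 :=
    Laurent.frac_sub_ne_zero (K := K) h.symm
  have hadd : ∀ f g : Laurent K d, Laurent.frac (f + g) = Laurent.frac f + Laurent.frac g :=
    fun _ _ => map_add _ _ _
  simp only [hadd, Laurent.frac_perm_demazure, Laurent.frac_demazure, Equiv.swap_apply_left,
    Equiv.swap_apply_right, Equiv.swap_mul_self, Laurent.perm_one, Laurent.perm_perm]
  generalize Laurent.frac (Laurent.y K a : Laurent K d) = A at *
  generalize Laurent.frac (Laurent.y K b : Laurent K d) = B at *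
  field_simp
  ring

section Three
variable {a b c : Fin d}

theorem swap_mul_swap_mul_swap_comm (hab : a ≠ b) (hbc : b ≠ c) (hac : a ≠ c) :
    Equiv.swap b c * Equiv.swap a b * Equiv.swap b c =
    Equiv.swap a b * Equiv.swap b c * Equiv.swap a b := by
  rw [Equiv.swap_mul_swap_mul_swap hab hac, Equiv.swap_comm a b, Equiv.swap_comm b c,
    Equiv.swap_mul_swap_mul_swap hbc.symm hac.symm, Equiv.swap_comm]

/-- The relations between two neighbouring Demazure operators and exchanges of variables that make
up the braid relation in the affine Hecke algebra. -/
theorem demazure_relations (hab : a ≠ b) (hbc : b ≠ c) (hac : a ≠ c) (f : Laurent K d) :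
    Laurent.perm K (Equiv.swap a b) (Laurent.perm K (Equiv.swap b c)
        (Laurent.perm K (Equiv.swap a b) f)) =
      Laurent.perm K (Equiv.swap b c) (Laurent.perm K (Equiv.swap a b)
        (Laurent.perm K (Equiv.swap b c) f)) ∧
    Laurent.perm K (Equiv.swap a b) (Laurent.perm K (Equiv.swap b c) (demazure K hab f)) =
      demazure K hbc (Laurent.perm K (Equiv.swap a b) (Laurent.perm K (Equiv.swap b c) f)) ∧
    demazure K hab (Laurent.perm K (Equiv.swap b c) (Laurent.perm K (Equiv.swap a b) f)) =
      Laurent.perm K (Equiv.swap b c) (Laurent.perm K (Equiv.swap a b) (demazure K hbc f)) ∧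
    Laurent.perm K (Equiv.swap a b) (demazure K hbc (Laurent.perm K (Equiv.swap a b) f)) =
      Laurent.perm K (Equiv.swap b c) (demazure K hab (Laurent.perm K (Equiv.swap b c) f)) ∧
    demazure K hab (demazure K hbc (demazure K hab f)) =
      demazure K hbc (demazure K hab (demazure K hbc f)) ∧
    Laurent.perm K (Equiv.swap a b) (demazure K hbc (Laurent.perm K (Equiv.swap a b) f)) +
        Laurent.perm K (Equiv.swap a b) (demazure K hbc (demazure K hab f)) +
        demazure K hab (demazure K hbc (Laurent.perm K (Equiv.swap a b) f)) =
      demazure K hbc (Laurent.perm K (Equiv.swap a b) (demazure K hbc f)) ∧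
    Laurent.perm K (Equiv.swap b c) (demazure K hab (Laurent.perm K (Equiv.swap b c) f)) +
        Laurent.perm K (Equiv.swap b c) (demazure K hab (demazure K hbc f)) +
        demazure K hbc (demazure K hab (Laurent.perm K (Equiv.swap b c) f)) =
      demazure K hab (Laurent.perm K (Equiv.swap b c) (demazure K hab f)) := by
  have h1 := Laurent.frac_sub_ne_zero (K := K) hab
  have h2 := Laurent.frac_sub_ne_zero (K := K) hab.symm
  have h3 := Laurent.frac_sub_ne_zero (K := K) hac
  have h4 := Laurent.frac_sub_ne_zero (K := K) hac.symm
  have h5 := Laurent.frac_sub_ne_zero (K := K) hbc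
  have h6 := Laurent.frac_sub_ne_zero (K := K) hbc.symm
  have e1 := swap_mul_swap_mul_swap_comm hab hbc hac
  have e2 : ∀ w : Equiv.Perm (Fin d), w * Equiv.swap a b * Equiv.swap a b = w := fun w => by
    rw [mul_assoc, Equiv.swap_mul_self, mul_one]
  have e3 : ∀ w : Equiv.Perm (Fin d), w * Equiv.swap b c * Equiv.swap b c = w := fun w => by
    rw [mul_assoc, Equiv.swap_mul_self, mul_one]
  have hadd : ∀ f g : Laurent K d, Laurent.frac (f + g) = Laurent.frac f + Laurent.frac g :=
    fun _ _ => map_add _ _ _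
  refine ⟨?_, ?_, ?_, ?_, ?_, ?_, ?_⟩
  all_goals
    apply Laurent.frac_injective
    simp only [hadd, Laurent.frac_perm_demazure, Laurent.frac_demazure, Laurent.perm_perm,
      Equiv.swap_apply_left, Equiv.swap_apply_right, Equiv.swap_mul_self, Laurent.perm_one,
      Equiv.Perm.mul_apply, Equiv.swap_apply_of_ne_of_ne hab hac,
      Equiv.swap_apply_of_ne_of_ne hac.symm hbc.symm, ← mul_assoc, e1]
    -- every side is a combination of the permuted `f` with rational coefficients in `y_a, y_b, y_c`
    try
      generalize Laurent.frac (Laurent.y K a : Laurent K d) = A at *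
      generalize Laurent.frac (Laurent.y K b : Laurent K d) = B at *
      generalize Laurent.frac (Laurent.y K c : Laurent K d) = C at *
      field_simp
      try ring

end Three

theorem demazure_one {a b : Fin d} (h : a ≠ b) : demazure K h 1 = 0 :=
  demazure_eq h (by simp)

/-- The twisted Leibniz rule. -/
theorem demazure_mul {a b : Fin d} (h : a ≠ b) (f g : Laurent K d) :
    demazure K h (f * g) = demazure K h f * g +
      Laurent.perm K (Equiv.swap a b) f * demazure K h g := by
  refine demazure_eq h ?_
  rw [map_mul]
  linear_combination g * demazure_spec h f +
    Laurent.perm K (Equiv.swap a b) f * demazure_spec h g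

theorem demazure_y_fst {a b : Fin d} (h : a ≠ b) :
    demazure K h (Laurent.y K a : Laurent K d) = -(Laurent.y K b : Laurent K d) :=
  demazure_eq h (by rw [Laurent.perm_y, Equiv.swap_apply_left]; ring)

theorem demazure_y_snd {a b : Fin d} (h : a ≠ b) :
    demazure K h (Laurent.y K b : Laurent K d) = Laurent.y K b :=
  demazure_eq h (by rw [Laurent.perm_y, Equiv.swap_apply_right]; ring)

theorem demazure_y_of_ne {a b j : Fin d} (h : a ≠ b) (ha : j ≠ a) (hb : j ≠ b) :
    demazure K h (Laurent.y K j : Laurent K d) = 0 :=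
  demazure_eq h (by rw [Laurent.perm_y, Equiv.swap_apply_of_ne_of_ne ha hb]; ring)

/-- Two Demazure operators in disjoint pairs of variables commute. -/
theorem demazure_comm {a b a' b' : Fin d} (h : a ≠ b) (h' : a' ≠ b') (h1 : a ≠ a') (h2 : a ≠ b')
    (h3 : b ≠ a') (h4 : b ≠ b') (f : Laurent K d) :
    demazure K h (demazure K h' f) = demazure K h' (demazure K h f) ∧
    Laurent.perm K (Equiv.swap a b) (demazure K h' f) =
      demazure K h' (Laurent.perm K (Equiv.swap a b) f) ∧
    Laurent.perm K (Equiv.swap a b) (Laurent.perm K (Equiv.swap a' b') f) =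
      Laurent.perm K (Equiv.swap a' b') (Laurent.perm K (Equiv.swap a b) f) := by
  have e : Equiv.swap a b * Equiv.swap a' b' = Equiv.swap a' b' * Equiv.swap a b := by
    rw [Equiv.mul_swap_eq_swap_mul, Equiv.swap_apply_of_ne_of_ne h1.symm h3.symm,
      Equiv.swap_apply_of_ne_of_ne h2.symm h4.symm]
  refine ⟨?_, ?_, ?_⟩
  · apply Laurent.frac_injective
    simp only [Laurent.frac_perm_demazure, Laurent.frac_demazure, e,
      Equiv.swap_apply_of_ne_of_ne h1.symm h3.symm, Equiv.swap_apply_of_ne_of_ne h2.symm h4.symm,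
      Equiv.swap_apply_of_ne_of_ne h1 h2, Equiv.swap_apply_of_ne_of_ne h3 h4]
    ring
  · apply Laurent.frac_injective
    simp only [Laurent.frac_perm_demazure, Laurent.frac_demazure, e, Laurent.perm_perm,
      Equiv.swap_apply_of_ne_of_ne h1.symm h3.symm, Equiv.swap_apply_of_ne_of_ne h2.symm h4.symm]
  · rw [Laurent.perm_perm, Laurent.perm_perm, e]

end Laurent

/-! ### The affine Hecke algebra acts on Laurent polynomials with values in `V^{⊗ d}` -/

section Generic
variable {K : Type u} [Field K] {A B : Type*} [Ring A] [Algebra K A] [Ring B] [Algebra K B]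

/-- The braid relation for `s ⊗ r + c D ⊗ 1`, from relations in the two tensor factors. -/
theorem tmul_braid (c : K) {s s' D D' : A} {r r' : B} (hr : r * r = c • r + 1)
    (hr' : r' * r' = c • r' + 1) (hrr : r * r' * r = r' * r * r') (h1 : s * s' * s = s' * s * s')
    (h2 : s * s' * D = D' * s * s') (h3 : D * s' * s = s' * s * D') (h4 : s * D' * s = s' * D * s')
    (h5 : D * D' * D = D' * D * D') (h6 : s * D' * s + s * D' * D + D * D' * s = D' * s * D')
    (h7 : s' * D * s' + s' * D * D' + D' * D * s' = D * s' * D) :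
    (s ⊗ₜ[K] r + c • D ⊗ₜ[K] (1 : B)) * (s' ⊗ₜ[K] r' + c • D' ⊗ₜ[K] (1 : B)) *
        (s ⊗ₜ[K] r + c • D ⊗ₜ[K] (1 : B)) =
      (s' ⊗ₜ[K] r' + c • D' ⊗ₜ[K] (1 : B)) * (s ⊗ₜ[K] r + c • D ⊗ₜ[K] (1 : B)) *
        (s' ⊗ₜ[K] r' + c • D' ⊗ₜ[K] (1 : B)) := by
  rw [h4] at h6
  simp only [mul_add, add_mul, smul_mul_assoc, mul_smul_comm, Algebra.TensorProduct.tmul_mul_tmul,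
    mul_one, one_mul, hr, hr', hrr, h1, h2, h3, h4, h5, ← h6, ← h7, TensorProduct.tmul_add,
    TensorProduct.add_tmul, TensorProduct.tmul_smul]
  module

/-- The quadratic relation for `s ⊗ r + c D ⊗ 1`, from relations in the two tensor factors. -/
theorem tmul_sq (c : K) {s D : A} {r : B} (hr : r * r = c • r + 1) (hs : s * s = 1)
    (hD : D * D = D) (hsD : 1 + D * s + s * D = s) :
    (s ⊗ₜ[K] r + c • D ⊗ₜ[K] (1 : B)) * (s ⊗ₜ[K] r + c • D ⊗ₜ[K] (1 : B)) =
      c • (s ⊗ₜ[K] r + c • D ⊗ₜ[K] (1 : B)) + 1 := by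
  have h : s ⊗ₜ[K] r = (1 : A) ⊗ₜ[K] r + (D * s) ⊗ₜ[K] r + (s * D) ⊗ₜ[K] r := by
    rw [← TensorProduct.add_tmul, ← TensorProduct.add_tmul, hsD]
  simp only [mul_add, add_mul, smul_mul_assoc, mul_smul_comm, Algebra.TensorProduct.tmul_mul_tmul,
    mul_one, one_mul, hr, hs, hD, TensorProduct.tmul_add, TensorProduct.tmul_smul,
    Algebra.TensorProduct.one_def]
  rw [h]
  module

theorem tmul_comm (c : K) {s s' D D' : A} {r r' : B} (hr : r * r' = r' * r) (h1 : s * s' = s' * s)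
    (h2 : s * D' = D' * s) (h3 : s' * D = D * s') (h4 : D * D' = D' * D) :
    (s ⊗ₜ[K] r + c • D ⊗ₜ[K] (1 : B)) * (s' ⊗ₜ[K] r' + c • D' ⊗ₜ[K] (1 : B)) =
      (s' ⊗ₜ[K] r' + c • D' ⊗ₜ[K] (1 : B)) * (s ⊗ₜ[K] r + c • D ⊗ₜ[K] (1 : B)) := by
  simp only [mul_add, add_mul, smul_mul_assoc, mul_smul_comm, Algebra.TensorProduct.tmul_mul_tmul,
    mul_one, one_mul, hr, h1, h2, h3, h4]
  module

theorem conj_of_exchange {c : K} {t u u' : A} (ht : t * t = c • t + 1)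
    (h : t * u = u' * t - c • u') : t * u * t = u' := by
  rw [h, sub_mul, mul_assoc, ht, mul_add, mul_one, mul_smul_comm, smul_mul_assoc,
    add_sub_cancel_left]

end Generic

section Module
variable {K : Type u} [Field K] {m n d : ℕ} {q : K}

/-- The tensor product of the operators on Laurent polynomials and of those on `V^{⊗ d}`. -/
abbrev PolyEnd (K : Type u) [Field K] (N d : ℕ) : Type u :=
  Module.End K (Laurent K d) ⊗[K] Module.End K (TensorPower K N d)

/-- Multiplication by Laurent polynomials. -/
def polyMul (K : Type u) [Field K] (N d : ℕ) : Laurent K d →ₐ[K] PolyEnd K N d :=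
  Algebra.TensorProduct.includeLeft.comp (Algebra.lmul K (Laurent K d))

/-- The Demazure-Lusztig operator `f ⊗ v ↦ s f ⊗ Ř v + (q - q⁻¹) D f ⊗ v` of two positions. -/
def lusztig (m n : ℕ) (q : K) {a b : Fin d} (h : a ≠ b) : PolyEnd K (m + n) d :=
  (Laurent.perm K (Equiv.swap a b)).toLinearMap ⊗ₜ braiding m n q a b +
    (q - q⁻¹) • demazure K h ⊗ₜ 1

theorem lusztig_sq (hq : q ≠ 0) {a b : Fin d} (h : a ≠ b) :
    lusztig m n q h * lusztig m n q h = (q - q⁻¹) • lusztig m n q h + 1 :=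
  tmul_sq (A := Module.End K (Laurent K d)) (B := Module.End K (TensorPower K (m + n) d)) _
    (braiding_sq m n hq _ _)
    (LinearMap.ext fun f => by simp [Laurent.perm_perm, Laurent.perm_one])
    (LinearMap.ext fun f => demazure_demazure _ f)
    (LinearMap.ext fun f => add_demazure_perm _ f)

theorem lusztig_braid (hq : q ≠ 0) {a b c : Fin d} (hab : a ≠ b) (hbc : b ≠ c) (hac : a ≠ c) :
    lusztig m n q hab * lusztig m n q hbc * lusztig m n q hab =
      lusztig m n q hbc * lusztig m n q hab * lusztig m n q hbc := by
  have key := demazure_relations (K := K) hab hbc hac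
  exact tmul_braid (A := Module.End K (Laurent K d)) (B := Module.End K (TensorPower K (m + n) d)) _
    (braiding_sq m n hq _ _) (braiding_sq m n hq _ _) (braiding_braid m n hq hab hac hbc)
    (LinearMap.ext fun f => (key f).1) (LinearMap.ext fun f => (key f).2.1)
    (LinearMap.ext fun f => (key f).2.2.1) (LinearMap.ext fun f => (key f).2.2.2.1)
    (LinearMap.ext fun f => (key f).2.2.2.2.1) (LinearMap.ext fun f => (key f).2.2.2.2.2.1)
    (LinearMap.ext fun f => (key f).2.2.2.2.2.2)

theorem lusztig_comm {a b a' b' : Fin d} (h : a ≠ b) (h' : a' ≠ b') (h1 : a ≠ a') (h2 : a ≠ b')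
    (h3 : b ≠ a') (h4 : b ≠ b') :
    lusztig m n q h * lusztig m n q h' = lusztig m n q h' * lusztig m n q h := by
  have key := demazure_comm (K := K) h h' h1 h2 h3 h4
  have key' := demazure_comm (K := K) h' h h1.symm h3.symm h2.symm h4.symm
  exact tmul_comm (A := Module.End K (Laurent K d)) (B := Module.End K (TensorPower K (m + n) d)) _
    (braiding_comm m n q h1 h2 h3 h4) (LinearMap.ext fun f => (key f).2.2)
    (LinearMap.ext fun f => (key f).2.1) (LinearMap.ext fun f => (key' f).2.1)
    (LinearMap.ext fun f => (key f).1)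

/-- The Bernstein relation for the Demazure-Lusztig operators. -/
theorem lusztig_mul_polyMul {a b : Fin d} (h : a ≠ b) (f : Laurent K d) :
    lusztig m n q h * polyMul K (m + n) d f =
      polyMul K (m + n) d (Laurent.perm K (Equiv.swap a b) f) * lusztig m n q h +
        (q - q⁻¹) • polyMul K (m + n) d (demazure K h f) := by
  have e1 : (Laurent.perm K (Equiv.swap a b)).toLinearMap * Algebra.lmul K (Laurent K d) f =
      Algebra.lmul K (Laurent K d) (Laurent.perm K (Equiv.swap a b) f) *
        (Laurent.perm K (Equiv.swap a b)).toLinearMap :=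
    LinearMap.ext fun g => map_mul (Laurent.perm K (Equiv.swap a b)) f g
  have e2 : demazure K h * Algebra.lmul K (Laurent K d) f =
      Algebra.lmul K (Laurent K d) (demazure K h f) +
        Algebra.lmul K (Laurent K d) (Laurent.perm K (Equiv.swap a b) f) * demazure K h :=
    LinearMap.ext fun g => demazure_mul h f g
  simp only [lusztig, polyMul, AlgHom.comp_apply, Algebra.TensorProduct.includeLeft_apply, add_mul,
    mul_add, smul_mul_assoc, mul_smul_comm, Algebra.TensorProduct.tmul_mul_tmul, mul_one, one_mul,
    e1, e2, TensorProduct.add_tmul]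
  module

theorem lusztig_mul_y_mul (hq : q ≠ 0) {a b : Fin d} (h : a ≠ b) :
    lusztig m n q h * polyMul K (m + n) d (Laurent.y K a) * lusztig m n q h =
      polyMul K (m + n) d (Laurent.y K b) := by
  refine conj_of_exchange (A := PolyEnd K (m + n) d) (c := q - q⁻¹) (lusztig_sq hq h) ?_
  rw [lusztig_mul_polyMul, Laurent.perm_y, Equiv.swap_apply_left, demazure_y_fst, map_neg, smul_neg,
    ← sub_eq_add_neg]

/-- The generators of the affine Hecke algebra as operators on Laurent polynomials with values in
`V^{⊗ d}`: the `T_i` are Demazure-Lusztig operators, the `y_j` are multiplication operators. -/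
def polyGen (m n : ℕ) (q : K) : HeckeGen d → PolyEnd K (m + n) d
  | .T i => lusztig m n q (lower_ne_upper i)
  | .y j => polyMul K (m + n) d (Laurent.y K j)
  | .yInv j => polyMul K (m + n) d ((Laurent.y K j)⁻¹ : (Laurent K d)ˣ)

theorem polyGen_rel (hq : q ≠ 0) (a b : PolyEnd K (m + n) d)
    (h : AffineRel q (fun i => polyGen m n q (.T i)) (fun j => polyGen m n q (.y j))
      (fun j => polyGen m n q (.yInv j)) a b) : a = b := by
  cases h with
  | finite _ _ h =>
    cases h with
    | quad i => exact quad_of_sq (A := PolyEnd K (m + n) d) hq _ (lusztig_sq hq _)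
    | braid i j h =>
      have e : upper i = lower j := Fin.ext h.symm
      have h1 := lower_ne_upper i
      have h2 := lower_ne_upper j
      have h3 : lower i ≠ upper j := by simp [lower, upper, Fin.ext_iff]; omega
      change lusztig m n q h1 * lusztig m n q h2 * lusztig m n q h1 =
        lusztig m n q h2 * lusztig m n q h1 * lusztig m n q h2
      clear h
      generalize upper i = b at e h1 ⊢
      subst e
      exact lusztig_braid hq h1 h2 h3
    | comm i j h =>
      refine lusztig_comm _ _ ?_ ?_ ?_ ?_ <;> simp [lower, upper, Fin.ext_iff] <;> omega
  | mul_inv j => simp only [polyGen]; rw [← map_mul, Units.mul_inv, map_one]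
  | inv_mul j => simp only [polyGen]; rw [← map_mul, Units.inv_mul, map_one]
  | y_comm j k => simp only [polyGen]; rw [← map_mul, mul_comm, map_mul]
  | y_T j i h₁ h₂ =>
    simp only [polyGen]
    rw [lusztig_mul_polyMul, demazure_y_of_ne _ h₁ h₂, Laurent.perm_y,
      Equiv.swap_apply_of_ne_of_ne h₁ h₂, map_zero, smul_zero, add_zero]
  | T_y_T i => exact lusztig_mul_y_mul hq _

/-- The left action of the affine Hecke algebra on Laurent polynomials with values in `V^{⊗ d}`. -/
def polyAction (m n : ℕ) (hq : q ≠ 0) (d : ℕ) :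
    AffineHecke q d →ₐ[K] Module.End K (Laurent K d ⊗[K] TensorPower K (m + n) d) :=
  (Module.endTensorEndAlgHom (R := K) (S := K) (A := K)).comp
    (AffineHecke.lift (polyGen m n q) (polyGen_rel hq))

theorem polyAction_T (hq : q ≠ 0) (i : Fin (d - 1)) (f : Laurent K d)
    (v : TensorPower K (m + n) d) :
    polyAction m n hq d (AffineHecke.gen q (.T i)) (f ⊗ₜ v) =
      Laurent.perm K (Equiv.swap (lower i) (upper i)) f ⊗ₜ braiding m n q (lower i) (upper i) v +
        (q - q⁻¹) • demazure K (lower_ne_upper i) f ⊗ₜ v := by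
  rw [polyAction, AlgHom.comp_apply, AffineHecke.lift_gen]
  simp only [polyGen, lusztig, map_add, map_smul, Module.endTensorEndAlgHom_apply]
  rfl

theorem polyAction_y (hq : q ≠ 0) (j : Fin d) (f : Laurent K d) (v : TensorPower K (m + n) d) :
    polyAction m n hq d (AffineHecke.gen q (.y j)) (f ⊗ₜ v) = (Laurent.y K j * f) ⊗ₜ v := by
  rw [polyAction, AlgHom.comp_apply, AffineHecke.lift_gen]
  rfl

theorem polyAction_yInv (hq : q ≠ 0) (j : Fin d) (f : Laurent K d) (v : TensorPower K (m + n) d) :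
    polyAction m n hq d (AffineHecke.gen q (.yInv j)) (f ⊗ₜ v) =
      (((Laurent.y K j)⁻¹ : (Laurent K d)ˣ) * f) ⊗ₜ v := by
  rw [polyAction, AlgHom.comp_apply, AffineHecke.lift_gen]
  rfl

theorem pairwise_commute_zpowers {G : Type*} [Group G] {y : Fin d → G}
    (hy : ∀ j k, Commute (y j) (y k)) :
    Pairwise fun j k => ∀ a b, Commute (zpowersHom G (y j) a) (zpowersHom G (y k) b) :=
  fun j k _ a b => by simpa only [zpowersHom_apply] using (hy j k).zpow_zpow _ _

/-- Laurent polynomials evaluated at commuting units. -/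
def Laurent.eval {A : Type u} [Ring A] [Algebra K A] (y : Fin d → Aˣ)
    (hy : ∀ j k, Commute (y j) (y k)) : Laurent K d →ₐ[K] A :=
  AddMonoidAlgebra.lift K A (Fin d → ℤ) <| (Units.coeHom A).comp <|
    (MonoidHom.noncommPiCoprod (fun j => zpowersHom Aˣ (y j))
      (pairwise_commute_zpowers hy)).comp
      (MulEquiv.piMultiplicative fun _ : Fin d => ℤ).toMonoidHom

theorem Laurent.eval_y {A : Type u} [Ring A] [Algebra K A] (y : Fin d → Aˣ)
    (hy : ∀ j k, Commute (y j) (y k)) (j : Fin d) :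
    Laurent.eval (K := K) y hy (Laurent.y K j) = y j := by
  have e : MulEquiv.piMultiplicative (fun _ : Fin d => ℤ) (Multiplicative.ofAdd (Pi.single j 1)) =
      Pi.mulSingle j (Multiplicative.ofAdd 1) := by
    funext k
    rcases eq_or_ne k j with rfl | h
    · simp
    · simp [h]
  simp only [Laurent.eval, Laurent.y, AddMonoidAlgebra.lift_single, one_smul, MonoidHom.comp_apply,
    MulEquiv.toMonoidHom_eq_coe, MonoidHom.coe_coe, e, Units.coeHom_apply]
  rw [MonoidHom.noncommPiCoprod_mulSingle, zpowersHom_apply, toAdd_ofAdd, zpow_one]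

/-- The Bernstein relation between a generator of a Hecke algebra and evaluated Laurent
polynomials. -/
theorem bernstein {A : Type u} [Ring A] [Algebra K A] (χ : Laurent K d →ₐ[K] A) {a b : Fin d}
    (h : a ≠ b) {c : K} {t : A}
    (ht : HeckePair c t (χ (Laurent.y K b)) (χ (Laurent.y K a)))
    (ht' : ∀ j, j ≠ a → j ≠ b → Commute (χ (Laurent.y K j)) t) (f : Laurent K d) :
    t * χ f = χ (Laurent.perm K (Equiv.swap a b) f) * t + c • χ (demazure K h f) := by
  have hvar : ∀ j : Fin d, t * χ (Laurent.y K j) =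
      χ (Laurent.perm K (Equiv.swap a b) (Laurent.y K j)) * t +
        c • χ (demazure K h (Laurent.y K j : Laurent K d)) := by
    intro j
    rw [Laurent.perm_y]
    rcases eq_or_ne j a with rfl | ha
    · rw [Equiv.swap_apply_left, demazure_y_fst, map_neg, smul_neg, ht.right, sub_eq_add_neg]
    · rcases eq_or_ne j b with rfl | hb
      · rw [Equiv.swap_apply_right, demazure_y_snd, ht.left, add_comm]
      · rw [Equiv.swap_apply_of_ne_of_ne ha hb, demazure_y_of_ne h ha hb, map_zero, smul_zero,
          add_zero, (ht' j ha hb).eq]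
  induction f using Laurent.induction with
  | hy j => exact hvar j
  | hy' j =>
    -- the relation passes from a unit `f` to its inverse `g`, since `D (f * g) = D 1 = 0`
    have h1 := hvar j
    have h2 := Units.mul_inv (Laurent.y K j)
    generalize (Laurent.y K j : Laurent K d) = f at h1 h2
    generalize (((Laurent.y K j)⁻¹ : (Laurent K d)ˣ) : Laurent K d) = g at h2 ⊢
    have h3 := demazure_mul h f g
    rw [h2, demazure_one, eq_comm, add_eq_zero_iff_eq_neg] at h3
    have h4 : Laurent.perm K (Equiv.swap a b) g * Laurent.perm K (Equiv.swap a b) f = 1 := by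
      rw [← map_mul, mul_comm, h2, map_one]
    have h5 : χ f * χ g = 1 := by rw [← map_mul, h2, map_one]
    have h6 := congrArg (χ (Laurent.perm K (Equiv.swap a b) g) * · * χ g) h1
    simp only [mul_add, add_mul, mul_smul_comm, smul_mul_assoc] at h6
    rw [mul_assoc, mul_assoc t, h5, mul_one, ← mul_assoc _ (χ _) t, ← map_mul, h4, map_one,
      one_mul, mul_assoc (χ _) (χ _) (χ g), ← map_mul χ _ g, h3, map_neg, map_mul, mul_neg,
      ← mul_assoc, ← map_mul, h4, map_one, one_mul] at h6
    rw [h6]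
    module
  | h1 => simp [demazure_one]
  | hs r f ih =>
    simp only [map_smul, mul_smul_comm, smul_mul_assoc, ih, smul_add, smul_comm c]
  | ha f g ihf ihg =>
    simp only [map_add, mul_add, add_mul, ihf, ihg, smul_add]
    abel
  | hm f g ihf ihg =>
    rw [map_mul, ← mul_assoc, ihf, add_mul, mul_assoc, ihg, demazure_mul]
    simp only [map_add, map_mul, mul_add, smul_add, mul_assoc, mul_smul_comm, smul_mul_assoc]
    abel

end Module

/-! ### Concatenation of tensors -/

section Concat
variable {K : Type u} [Field K] {m n N d₁ d₂ : ℕ} {q : K}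

/-- Concatenation `V^{⊗ d₁} ⊗ V^{⊗ d₂} ≃ V^{⊗ (d₁ + d₂)}`. -/
def concat (K : Type u) [Field K] (N d₁ d₂ : ℕ) :
    TensorPower K N d₁ ⊗[K] TensorPower K N d₂ ≃ₗ[K] TensorPower K N (d₁ + d₂) :=
  _root_.TensorPower.mulEquiv

theorem concat_tprod (a : Fin d₁ → Fin N → K) (b : Fin d₂ → Fin N → K) :
    concat K N d₁ d₂ (PiTensorProduct.tprod K a ⊗ₜ PiTensorProduct.tprod K b) =
      PiTensorProduct.tprod K (Fin.append a b) :=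
  _root_.TensorPower.tprod_mul_tprod K a b

theorem concat_basis (f : Fin d₁ → Fin N) (g : Fin d₂ → Fin N) :
    concat K N d₁ d₂ (tensorBasis K N d₁ f ⊗ₜ tensorBasis K N d₂ g) =
      tensorBasis K N (d₁ + d₂) (Fin.append f g) := by
  rw [tensorBasis_apply, tensorBasis_apply, tensorBasis_apply, concat_tprod]
  congr 1
  funext l
  refine Fin.addCases (fun l => ?_) (fun l => ?_) l <;> simp

/-- Linear maps on `V^{⊗ d₁} ⊗ V^{⊗ d₂}` agree if they agree on products of basis tensors. -/
theorem ext_tensorBasis {W : Type*} [AddCommMonoid W] [Module K W]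
    {F G : TensorPower K N d₁ ⊗[K] TensorPower K N d₂ →ₗ[K] W}
    (h : ∀ f g, F (tensorBasis K N d₁ f ⊗ₜ tensorBasis K N d₂ g) =
      G (tensorBasis K N d₁ f ⊗ₜ tensorBasis K N d₂ g)) : F = G :=
  ((tensorBasis K N d₁).tensorProduct (tensorBasis K N d₂)).ext fun i => by
    rw [Module.Basis.tensorProduct_apply]; exact h _ _

theorem siteMap_basis {d : ℕ} (f : Fin d → Matrix (Fin N) (Fin N) K) (a : Fin d → Fin N) :
    siteMap f (tensorBasis K N d a) =
      PiTensorProduct.tprod K fun l => (f l).mulVec (Pi.single (a l) 1) := by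
  rw [tensorBasis_apply, siteMap_tprod]

theorem siteMap_concat (f : Fin (d₁ + d₂) → Matrix (Fin N) (Fin N) K)
    (v : TensorPower K N d₁) (w : TensorPower K N d₂) :
    siteMap f (concat K N d₁ d₂ (v ⊗ₜ w)) =
      concat K N d₁ d₂ (siteMap (fun l => f (Fin.castAdd d₂ l)) v ⊗ₜ
        siteMap (fun l => f (Fin.natAdd d₁ l)) w) := by
  have h : siteMap f ∘ₗ (concat K N d₁ d₂).toLinearMap = (concat K N d₁ d₂).toLinearMap ∘ₗ
      TensorProduct.map (siteMap fun l => f (Fin.castAdd d₂ l))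
        (siteMap fun l => f (Fin.natAdd d₁ l)) := by
    refine ext_tensorBasis fun a b => ?_
    simp only [LinearMap.comp_apply, LinearEquiv.coe_coe, TensorProduct.map_tmul, siteMap_basis,
      concat_basis, concat_tprod]
    congr 1
    funext l
    refine Fin.addCases (fun l => ?_) (fun l => ?_) l <;> simp
  exact LinearMap.congr_fun h (v ⊗ₜ w)

theorem braiding_concat_left (x y : Fin d₁)
    (t : TensorPower K (m + n) d₁ ⊗[K] TensorPower K (m + n) d₂) :
    braiding m n q (Fin.castAdd d₂ x) (Fin.castAdd d₂ y) (concat K (m + n) d₁ d₂ t) =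
      concat K (m + n) d₁ d₂ (TensorProduct.map (braiding m n q x y) LinearMap.id t) := by
  have h : braiding m n q (Fin.castAdd d₂ x) (Fin.castAdd d₂ y) ∘ₗ
      (concat K (m + n) d₁ d₂).toLinearMap = (concat K (m + n) d₁ d₂).toLinearMap ∘ₗ
      TensorProduct.map (braiding m n q x y) LinearMap.id := by
    refine ext_tensorBasis fun a b => ?_
    have hs : Fin.append a b ∘ Equiv.swap (Fin.castAdd d₂ x) (Fin.castAdd d₂ y) =
        Fin.append (a ∘ Equiv.swap x y) b := by
      funext l
      refine Fin.addCases (fun l => ?_) (fun l => ?_) l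
      · simp [Equiv.swap_apply_def, apply_ite (Fin.append a b), apply_ite a]
      · rw [Function.comp_apply, Equiv.swap_apply_of_ne_of_ne] <;> simp [Fin.ext_iff] <;> omega
    simp only [LinearMap.comp_apply, LinearEquiv.coe_coe, TensorProduct.map_tmul, braiding_basis,
      concat_basis, Fin.append_left, hs, LinearMap.id_apply]
    split_ifs <;> simp only [TensorProduct.add_tmul, ← TensorProduct.smul_tmul', map_add, map_smul,
      concat_basis]
  exact LinearMap.congr_fun h t

theorem braiding_concat_right (x y : Fin d₂)
    (t : TensorPower K (m + n) d₁ ⊗[K] TensorPower K (m + n) d₂) :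
    braiding m n q (Fin.natAdd d₁ x) (Fin.natAdd d₁ y) (concat K (m + n) d₁ d₂ t) =
      concat K (m + n) d₁ d₂ (TensorProduct.map LinearMap.id (braiding m n q x y) t) := by
  have h : braiding m n q (Fin.natAdd d₁ x) (Fin.natAdd d₁ y) ∘ₗ
      (concat K (m + n) d₁ d₂).toLinearMap = (concat K (m + n) d₁ d₂).toLinearMap ∘ₗ
      TensorProduct.map LinearMap.id (braiding m n q x y) := by
    refine ext_tensorBasis fun a b => ?_
    have hs : Fin.append a b ∘ Equiv.swap (Fin.natAdd d₁ x) (Fin.natAdd d₁ y) =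
        Fin.append a (b ∘ Equiv.swap x y) := by
      funext l
      refine Fin.addCases (fun l => ?_) (fun l => ?_) l
      · rw [Function.comp_apply, Equiv.swap_apply_of_ne_of_ne] <;> simp [Fin.ext_iff] <;> omega
      · simp [Equiv.swap_apply_def, apply_ite (Fin.append a b), apply_ite b]
    simp only [LinearMap.comp_apply, LinearEquiv.coe_coe, TensorProduct.map_tmul, braiding_basis,
      concat_basis, Fin.append_right, hs, LinearMap.id_apply]
    split_ifs <;> simp only [TensorProduct.tmul_add, TensorProduct.tmul_smul, map_add, map_smul,
      concat_basis]
  exact LinearMap.congr_fun h t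

end Concat

/-! ### Spanning set of the affine Hecke algebra -/

section Span
variable {K : Type u} [Field K] {q : K} {d : ℕ}

/-- The span of the products of a monomial in the `y_j^{±1}` by a monomial in the `T_i`. -/
inductive AffineHecke.IsNormal (q : K) (d : ℕ) : AffineHecke q d → Prop
  | one : IsNormal q d 1
  | y_mul (j : Fin d) {h} : IsNormal q d h → IsNormal q d (AffineHecke.gen q (.y j) * h)
  | yInv_mul (j : Fin d) {h} : IsNormal q d h → IsNormal q d (AffineHecke.gen q (.yInv j) * h)
  | mul_T (i : Fin (d - 1)) {h} : IsNormal q d h → IsNormal q d (h * AffineHecke.gen q (.T i))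
  | add {h h'} : IsNormal q d h → IsNormal q d h' → IsNormal q d (h + h')
  | smul (c : K) {h} : IsNormal q d h → IsNormal q d (c • h)

theorem AffineHecke.IsNormal.sub {h h' : AffineHecke q d} (hh : IsNormal q d h)
    (hh' : IsNormal q d h') : IsNormal q d (h - h') := by
  have := hh.add (hh'.smul (-1))
  rwa [neg_one_smul, ← sub_eq_add_neg] at this

/-- Left multiplication by `T_i`: it is moved past the lattice part by the Hecke relations. -/
theorem AffineHecke.IsNormal.T_mul (hq : q ≠ 0) (i : Fin (d - 1)) {h : AffineHecke q d}
    (hh : IsNormal q d h) : IsNormal q d (AffineHecke.gen q (.T i) * h) := by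
  induction hh with
  | one => simpa using IsNormal.one.mul_T i
  | @y_mul j h hh ih =>
    rw [← mul_assoc]
    by_cases h1 : j = lower i
    · rw [h1, (AffineHecke.pair_y hq i).right, sub_mul, mul_assoc, smul_mul_assoc]
      exact (ih.y_mul _).sub ((hh.y_mul _).smul _)
    · by_cases h2 : j = upper i
      · rw [h2, (AffineHecke.pair_y hq i).left, add_mul, mul_assoc _ _ h, smul_mul_assoc]
        exact ((hh.y_mul _).smul _).add (ih.y_mul _)
      · rw [← AffineHecke.rel (.y_T j i h1 h2), mul_assoc]
        exact ih.y_mul j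
  | @yInv_mul j h hh ih =>
    rw [← mul_assoc]
    by_cases h1 : j = lower i
    · rw [h1, (AffineHecke.pair_yInv hq i).left, add_mul, mul_assoc _ _ h, smul_mul_assoc]
      exact ((hh.yInv_mul _).smul _).add (ih.yInv_mul _)
    · by_cases h2 : j = upper i
      · rw [h2, (AffineHecke.pair_yInv hq i).right, sub_mul, mul_assoc, smul_mul_assoc]
        exact (ih.yInv_mul _).sub ((hh.yInv_mul _).smul _)
      · rw [← AffineHecke.yInv_T h1 h2, mul_assoc]
        exact ih.yInv_mul j
  | mul_T i' _ ih => rw [← mul_assoc]; exact ih.mul_T i'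
  | add _ _ ih ih' => rw [mul_add]; exact ih.add ih'
  | smul c _ ih => rw [mul_smul_comm]; exact ih.smul c

/-- The products of a lattice monomial by a monomial in the `T_i` span the affine Hecke algebra. -/
theorem AffineHecke.isNormal (hq : q ≠ 0) (h : AffineHecke q d) : IsNormal q d h := by
  suffices H : ∀ h', IsNormal q d h' → IsNormal q d (h * h') by simpa using H 1 .one
  induction h using AffineHecke.induction with
  | hg g =>
    intro h' hh
    cases g with
    | T i => exact hh.T_mul hq i
    | y j => exact hh.y_mul j
    | yInv j => exact hh.yInv_mul j
  | h1 => intro h' hh; rwa [one_mul]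
  | hs c a ih => intro h' hh; rw [smul_mul_assoc]; exact (ih h' hh).smul c
  | ha a b iha ihb => intro h' hh; rw [add_mul]; exact (iha h' hh).add (ihb h' hh)
  | hm a b iha ihb => intro h' hh; rw [mul_assoc]; exact iha _ (ihb h' hh)

end Span

/-! ### Laurent polynomials acting on `M₁ ⊗ M₂` -/

theorem HeckePair.map {K : Type u} [Field K] {A B : Type u} [Ring A] [Algebra K A] [Ring B]
    [Algebra K B] {c : K} {t y y' : A} (h : HeckePair c t y y') (f : A →ₐ[K] B) :
    HeckePair c (f t) (f y) (f y') where
  left := by rw [← map_mul, h.left, map_add, map_smul, map_mul]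
  right := by rw [← map_mul, h.right, map_sub, map_smul, map_mul]

section Joint
variable {K : Type u} [Field K] {m n d₁ d₂ : ℕ} {q : K}
  {M₁ : Type u} [AddCommGroup M₁] [Module K M₁] [Module (AffineHecke q d₁)ᵐᵒᵖ M₁]
  [IsScalarTower K (AffineHecke q d₁)ᵐᵒᵖ M₁]
  {M₂ : Type u} [AddCommGroup M₂] [Module K M₂] [Module (AffineHecke q d₂)ᵐᵒᵖ M₂]
  [IsScalarTower K (AffineHecke q d₂)ᵐᵒᵖ M₂]

/-- The unit `y_j` of the affine Hecke algebra. -/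
def AffineHecke.yUnit (q : K) {d : ℕ} (j : Fin d) : (AffineHecke q d)ˣ where
  val := AffineHecke.gen q (.y j)
  inv := AffineHecke.gen q (.yInv j)
  val_inv := AffineHecke.rel (.mul_inv j)
  inv_val := AffineHecke.rel (.inv_mul j)

/-- The action of `H^a_{d₁}` on the first factor of `M₁ ⊗ M₂`. -/
def actLeft (q : K) (d₁ : ℕ) (M₁ M₂ : Type u) [AddCommGroup M₁] [Module K M₁]
    [Module (AffineHecke q d₁)ᵐᵒᵖ M₁] [IsScalarTower K (AffineHecke q d₁)ᵐᵒᵖ M₁]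
    [AddCommGroup M₂] [Module K M₂] :
    AffineHecke q d₁ →ₐ[K] (Module.End K (M₁ ⊗[K] M₂))ᵐᵒᵖ :=
  AlgHom.opComm.symm ((Module.End.rTensorAlgHom K M₁ M₂).comp (Algebra.lsmul K K M₁))

/-- The action of `H^a_{d₂}` on the second factor of `M₁ ⊗ M₂`. -/
def actRight (q : K) (d₂ : ℕ) (M₁ M₂ : Type u) [AddCommGroup M₁] [Module K M₁]
    [AddCommGroup M₂] [Module K M₂] [Module (AffineHecke q d₂)ᵐᵒᵖ M₂]
    [IsScalarTower K (AffineHecke q d₂)ᵐᵒᵖ M₂] :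
    AffineHecke q d₂ →ₐ[K] (Module.End K (M₁ ⊗[K] M₂))ᵐᵒᵖ :=
  AlgHom.opComm.symm ((Module.End.lTensorAlgHom K M₂ M₁).comp (Algebra.lsmul K K M₂))

theorem actLeft_unop (a : AffineHecke q d₁) :
    (actLeft q d₁ M₁ M₂ a).unop = TensorProduct.map (rightMul M₁ a) LinearMap.id := rfl

theorem actRight_unop (b : AffineHecke q d₂) :
    (actRight q d₂ M₁ M₂ b).unop = TensorProduct.map LinearMap.id (rightMul M₂ b) := rfl

theorem actLeft_commute (a : AffineHecke q d₁) (b : AffineHecke q d₂) :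
    Commute (actLeft q d₁ M₁ M₂ a) (actRight q d₂ M₁ M₂ b) := by
  apply MulOpposite.unop_injective
  rw [MulOpposite.unop_mul, MulOpposite.unop_mul, actLeft_unop, actRight_unop]
  refine TensorProduct.ext' fun x y => rfl

/-- The units of the lattice parts of both affine Hecke algebras acting on `M₁ ⊗ M₂`. -/
def jointY (q : K) (d₁ d₂ : ℕ) (M₁ M₂ : Type u) [AddCommGroup M₁] [Module K M₁]
    [Module (AffineHecke q d₁)ᵐᵒᵖ M₁] [IsScalarTower K (AffineHecke q d₁)ᵐᵒᵖ M₁]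
    [AddCommGroup M₂] [Module K M₂] [Module (AffineHecke q d₂)ᵐᵒᵖ M₂]
    [IsScalarTower K (AffineHecke q d₂)ᵐᵒᵖ M₂] :
    Fin (d₁ + d₂) → ((Module.End K (M₁ ⊗[K] M₂))ᵐᵒᵖ)ˣ :=
  Fin.append (fun j => Units.map (actLeft q d₁ M₁ M₂).toMonoidHom (AffineHecke.yUnit q j))
    (fun j => Units.map (actRight q d₂ M₁ M₂).toMonoidHom (AffineHecke.yUnit q j))

theorem jointY_left (j : Fin d₁) :
    (jointY q d₁ d₂ M₁ M₂ (Fin.castAdd d₂ j) : (Module.End K (M₁ ⊗[K] M₂))ᵐᵒᵖ) =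
      actLeft q d₁ M₁ M₂ (AffineHecke.gen q (.y j)) := by
  rw [jointY, Fin.append_left]; rfl

theorem jointY_right (j : Fin d₂) :
    (jointY q d₁ d₂ M₁ M₂ (Fin.natAdd d₁ j) : (Module.End K (M₁ ⊗[K] M₂))ᵐᵒᵖ) =
      actRight q d₂ M₁ M₂ (AffineHecke.gen q (.y j)) := by
  rw [jointY, Fin.append_right]; rfl

theorem jointY_commute (j k : Fin (d₁ + d₂)) :
    Commute (jointY q d₁ d₂ M₁ M₂ j) (jointY q d₁ d₂ M₁ M₂ k) := by
  refine Commute.units_of_val ?_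
  have hy : ∀ {d} (j k : Fin d), Commute (AffineHecke.gen q (.y j))
      (AffineHecke.gen q (.y k)) := fun j k => AffineHecke.rel (.y_comm j k)
  refine Fin.addCases (fun j => ?_) (fun j => ?_) j <;>
    refine Fin.addCases (fun k => ?_) (fun k => ?_) k <;>
    simp only [jointY_left, jointY_right]
  · exact (hy j k).map _
  · exact actLeft_commute _ _
  · exact (actLeft_commute _ _).symm
  · exact (hy j k).map _

/-- Laurent polynomials in the `y_j` acting on `M₁ ⊗ M₂`. -/
def jointEval (q : K) (d₁ d₂ : ℕ) (M₁ M₂ : Type u) [AddCommGroup M₁] [Module K M₁]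
    [Module (AffineHecke q d₁)ᵐᵒᵖ M₁] [IsScalarTower K (AffineHecke q d₁)ᵐᵒᵖ M₁]
    [AddCommGroup M₂] [Module K M₂] [Module (AffineHecke q d₂)ᵐᵒᵖ M₂]
    [IsScalarTower K (AffineHecke q d₂)ᵐᵒᵖ M₂] :
    Laurent K (d₁ + d₂) →ₐ[K] (Module.End K (M₁ ⊗[K] M₂))ᵐᵒᵖ :=
  Laurent.eval (jointY q d₁ d₂ M₁ M₂) jointY_commute

theorem jointEval_y (j : Fin (d₁ + d₂)) :
    jointEval q d₁ d₂ M₁ M₂ (Laurent.y K j) = jointY q d₁ d₂ M₁ M₂ j := Laurent.eval_y _ _ j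

theorem jointEval_yInv (j : Fin (d₁ + d₂)) :
    jointEval q d₁ d₂ M₁ M₂ ((Laurent.y K j)⁻¹ : (Laurent K (d₁ + d₂))ˣ) =
      ((jointY q d₁ d₂ M₁ M₂ j)⁻¹ : ((Module.End K (M₁ ⊗[K] M₂))ᵐᵒᵖ)ˣ) := by
  refine (Units.inv_eq_of_mul_eq_one_right ?_).symm
  rw [← jointEval_y, ← map_mul, Units.mul_inv, map_one]

variable (hq : q ≠ 0)

/-- The projection of `(M₁ ⊗ M₂) ⊗ (V^{⊗ d₁} ⊗ V^{⊗ d₂})` onto `ℱ(M₁) ⊗ ℱ(M₂)`. -/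
def outer (m n : ℕ) (hq : q ≠ 0) (d₁ d₂ : ℕ) (M₁ M₂ : Type u) [AddCommGroup M₁] [Module K M₁]
    [Module (AffineHecke q d₁)ᵐᵒᵖ M₁] [AddCommGroup M₂] [Module K M₂]
    [Module (AffineHecke q d₂)ᵐᵒᵖ M₂] :
    (M₁ ⊗[K] M₂) ⊗[K] (TensorPower K (m + n) d₁ ⊗[K] TensorPower K (m + n) d₂) →ₗ[K]
      SchurWeyl m n hq d₁ M₁ ⊗[K] SchurWeyl m n hq d₂ M₂ :=
  TensorProduct.map (balancedRelations m n hq d₁ M₁).mkQ (balancedRelations m n hq d₂ M₂).mkQ ∘ₗ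
    (TensorProduct.tensorTensorTensorComm K M₁ M₂ _ _).toLinearMap

theorem outer_tmul (x : M₁) (y : M₂) (v : TensorPower K (m + n) d₁)
    (w : TensorPower K (m + n) d₂) :
    outer m n hq d₁ d₂ M₁ M₂ ((x ⊗ₜ y) ⊗ₜ (v ⊗ₜ w)) =
      Submodule.Quotient.mk (x ⊗ₜ v) ⊗ₜ Submodule.Quotient.mk (y ⊗ₜ w) := rfl

theorem outer_T_left (i : Fin (d₁ - 1)) (μ : M₁ ⊗[K] M₂)
    (v : TensorPower K (m + n) d₁ ⊗[K] TensorPower K (m + n) d₂) :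
    outer m n hq d₁ d₂ M₁ M₂ ((actLeft q d₁ M₁ M₂ (AffineHecke.gen q (.T i))).unop μ ⊗ₜ v) =
      outer m n hq d₁ d₂ M₁ M₂ (μ ⊗ₜ
        TensorProduct.map (braiding m n q (lower i) (upper i)) LinearMap.id v) := by
  rw [actLeft_unop]
  induction μ with
  | zero => simp
  | add a b ha hb => simp only [map_add, TensorProduct.add_tmul, ha, hb]
  | tmul x y =>
    induction v with
    | zero => simp
    | add a b ha hb => simp only [map_add, TensorProduct.tmul_add, ha, hb]
    | tmul v w =>
      rw [TensorProduct.map_tmul, TensorProduct.map_tmul, outer_tmul, outer_tmul, rightMul_apply,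
        balanced_T]
      rfl

theorem outer_T_right (i : Fin (d₂ - 1)) (μ : M₁ ⊗[K] M₂)
    (v : TensorPower K (m + n) d₁ ⊗[K] TensorPower K (m + n) d₂) :
    outer m n hq d₁ d₂ M₁ M₂ ((actRight q d₂ M₁ M₂ (AffineHecke.gen q (.T i))).unop μ ⊗ₜ v) =
      outer m n hq d₁ d₂ M₁ M₂ (μ ⊗ₜ
        TensorProduct.map LinearMap.id (braiding m n q (lower i) (upper i)) v) := by
  rw [actRight_unop]
  induction μ with
  | zero => simp
  | add a b ha hb => simp only [map_add, TensorProduct.add_tmul, ha, hb]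
  | tmul x y =>
    induction v with
    | zero => simp
    | add a b ha hb => simp only [map_add, TensorProduct.tmul_add, ha, hb]
    | tmul v w =>
      rw [TensorProduct.map_tmul, TensorProduct.map_tmul, outer_tmul, outer_tmul, rightMul_apply,
        balanced_T]
      rfl

/-- The pairing `(μ, f ⊗ v) ↦ μ f(y) ⊗ v` of `M₁ ⊗ M₂` with the Laurent polynomials with values in
`V^{⊗ (d₁ + d₂)}`. -/
def joint (m n : ℕ) (hq : q ≠ 0) (d₁ d₂ : ℕ) (M₁ M₂ : Type u) [AddCommGroup M₁] [Module K M₁]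
    [Module (AffineHecke q d₁)ᵐᵒᵖ M₁] [IsScalarTower K (AffineHecke q d₁)ᵐᵒᵖ M₁]
    [AddCommGroup M₂] [Module K M₂] [Module (AffineHecke q d₂)ᵐᵒᵖ M₂]
    [IsScalarTower K (AffineHecke q d₂)ᵐᵒᵖ M₂] :
    M₁ ⊗[K] M₂ →ₗ[K] Laurent K (d₁ + d₂) ⊗[K] TensorPower K (m + n) (d₁ + d₂) →ₗ[K]
      SchurWeyl m n hq d₁ M₁ ⊗[K] SchurWeyl m n hq d₂ M₂ :=
  TensorProduct.curry (outer m n hq d₁ d₂ M₁ M₂ ∘ₗ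
    TensorProduct.map
      (TensorProduct.lift ((MulOpposite.opLinearEquiv K).symm.toLinearMap ∘ₗ
        (jointEval q d₁ d₂ M₁ M₂).toLinearMap).flip)
      (concat K (m + n) d₁ d₂).symm.toLinearMap ∘ₗ
    (TensorProduct.assoc K (M₁ ⊗[K] M₂) (Laurent K (d₁ + d₂))
      (TensorPower K (m + n) (d₁ + d₂))).symm.toLinearMap)

theorem joint_tmul (μ : M₁ ⊗[K] M₂) (f : Laurent K (d₁ + d₂))
    (v : TensorPower K (m + n) (d₁ + d₂)) :
    joint m n hq d₁ d₂ M₁ M₂ μ (f ⊗ₜ v) = outer m n hq d₁ d₂ M₁ M₂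
      ((jointEval q d₁ d₂ M₁ M₂ f).unop μ ⊗ₜ (concat K (m + n) d₁ d₂).symm v) := rfl

/-- The Bernstein relation makes the pairing balanced over a generator `T_i`. -/
theorem joint_T (i : Fin (d₁ + d₂ - 1)) (t : (Module.End K (M₁ ⊗[K] M₂))ᵐᵒᵖ)
    (ht : HeckePair (q - q⁻¹) t (jointY q d₁ d₂ M₁ M₂ (upper i) : (Module.End K (M₁ ⊗[K] M₂))ᵐᵒᵖ)
      (jointY q d₁ d₂ M₁ M₂ (lower i) : (Module.End K (M₁ ⊗[K] M₂))ᵐᵒᵖ))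
    (ht' : ∀ j, j ≠ lower i → j ≠ upper i →
      Commute (jointY q d₁ d₂ M₁ M₂ j : (Module.End K (M₁ ⊗[K] M₂))ᵐᵒᵖ) t)
    (hb : ∀ μ v, outer m n hq d₁ d₂ M₁ M₂ (t.unop μ ⊗ₜ (concat K (m + n) d₁ d₂).symm v) =
      outer m n hq d₁ d₂ M₁ M₂ (μ ⊗ₜ
        (concat K (m + n) d₁ d₂).symm (braiding m n q (lower i) (upper i) v)))
    (μ : M₁ ⊗[K] M₂) (p : Laurent K (d₁ + d₂) ⊗[K] TensorPower K (m + n) (d₁ + d₂)) :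
    joint m n hq d₁ d₂ M₁ M₂ (t.unop μ) p = joint m n hq d₁ d₂ M₁ M₂ μ
      (polyAction m n hq (d₁ + d₂) (AffineHecke.gen q (.T i)) p) := by
  induction p with
  | zero => simp
  | add a b ha hb => simp only [map_add, ha, hb]
  | tmul f v =>
    have h := congrArg MulOpposite.unop (bernstein (jointEval q d₁ d₂ M₁ M₂) (lower_ne_upper i)
      (by simpa only [jointEval_y] using ht) (by simpa only [jointEval_y] using ht') f)
    rw [MulOpposite.unop_mul, MulOpposite.unop_add, MulOpposite.unop_mul, MulOpposite.unop_smul] at h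
    have h' := LinearMap.congr_fun h μ
    rw [Module.End.mul_apply, LinearMap.add_apply, Module.End.mul_apply, LinearMap.smul_apply] at h'
    rw [polyAction_T, map_add, map_smul, joint_tmul, joint_tmul, joint_tmul, h',
      TensorProduct.add_tmul, ← TensorProduct.smul_tmul', map_add, map_smul, hb]

theorem shiftHom_gen {s d D : ℕ} (h : s + d ≤ D) (g : HeckeGen d) :
    shiftHom q h (AffineHecke.gen q g) = AffineHecke.gen q (shiftGen h g) :=
  AffineHecke.lift_gen _ _ _

theorem joint_y (j : Fin (d₁ + d₂)) (μ : M₁ ⊗[K] M₂)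
    (p : Laurent K (d₁ + d₂) ⊗[K] TensorPower K (m + n) (d₁ + d₂)) :
    joint m n hq d₁ d₂ M₁ M₂
        ((jointY q d₁ d₂ M₁ M₂ j : (Module.End K (M₁ ⊗[K] M₂))ᵐᵒᵖ).unop μ) p =
      joint m n hq d₁ d₂ M₁ M₂ μ
        (polyAction m n hq (d₁ + d₂) (AffineHecke.gen q (.y j)) p) := by
  induction p with
  | zero => simp
  | add a b ha hb => simp only [map_add, ha, hb]
  | tmul f v =>
    rw [polyAction_y, joint_tmul, joint_tmul, map_mul, jointEval_y]
    rfl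

theorem joint_yInv (j : Fin (d₁ + d₂)) (μ : M₁ ⊗[K] M₂)
    (p : Laurent K (d₁ + d₂) ⊗[K] TensorPower K (m + n) (d₁ + d₂)) :
    joint m n hq d₁ d₂ M₁ M₂
        ((((jointY q d₁ d₂ M₁ M₂ j)⁻¹ : ((Module.End K (M₁ ⊗[K] M₂))ᵐᵒᵖ)ˣ) :
          (Module.End K (M₁ ⊗[K] M₂))ᵐᵒᵖ).unop μ) p =
      joint m n hq d₁ d₂ M₁ M₂ μ
        (polyAction m n hq (d₁ + d₂) (AffineHecke.gen q (.yInv j)) p) := by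
  induction p with
  | zero => simp
  | add a b ha hb => simp only [map_add, ha, hb]
  | tmul f v =>
    rw [polyAction_yInv, joint_tmul, joint_tmul, map_mul, jointEval_yInv]
    rfl

/-- A homomorphism into the operators on `M₁ ⊗ M₂` for which the pairing is balanced on the
generators. -/
theorem joint_of_gen {d : ℕ} (φ : AffineHecke q d →ₐ[K] (Module.End K (M₁ ⊗[K] M₂))ᵐᵒᵖ)
    (ψ : AffineHecke q d →ₐ[K] AffineHecke q (d₁ + d₂))
    (h : ∀ g μ p, joint m n hq d₁ d₂ M₁ M₂ ((φ (AffineHecke.gen q g)).unop μ) p =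
      joint m n hq d₁ d₂ M₁ M₂ μ (polyAction m n hq (d₁ + d₂) (ψ (AffineHecke.gen q g)) p))
    (a : AffineHecke q d) : ∀ (μ : M₁ ⊗[K] M₂)
    (p : Laurent K (d₁ + d₂) ⊗[K] TensorPower K (m + n) (d₁ + d₂)),
    joint m n hq d₁ d₂ M₁ M₂ ((φ a).unop μ) p =
      joint m n hq d₁ d₂ M₁ M₂ μ (polyAction m n hq (d₁ + d₂) (ψ a) p) := by
  induction a using AffineHecke.induction with
  | hg g => exact h g
  | h1 => intro μ p; simp
  | hs c a ih => intro μ p; simp only [map_smul, MulOpposite.unop_smul, LinearMap.smul_apply, ih]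
  | ha a b iha ihb =>
    intro μ p
    simp only [map_add, MulOpposite.unop_add, LinearMap.add_apply, iha, ihb]
  | hm a b iha ihb =>
    intro μ p
    rw [map_mul, MulOpposite.unop_mul, Module.End.mul_apply, ihb, iha, map_mul, map_mul,
      Module.End.mul_apply]

/-- The pairing is balanced over `H^a_{d₁}`. -/
theorem joint_left (a : AffineHecke q d₁) (μ : M₁ ⊗[K] M₂)
    (p : Laurent K (d₁ + d₂) ⊗[K] TensorPower K (m + n) (d₁ + d₂)) :
    joint m n hq d₁ d₂ M₁ M₂ ((actLeft q d₁ M₁ M₂ a).unop μ) p = joint m n hq d₁ d₂ M₁ M₂ μ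
      (polyAction m n hq (d₁ + d₂) (shiftHom q (show 0 + d₁ ≤ d₁ + d₂ by omega) a) p) := by
  refine joint_of_gen hq _ _ (fun g μ p => ?_) a μ p
  rw [shiftHom_gen]
  cases g with
  | T i =>
    have e1 : lower (⟨0 + i.val, by omega⟩ : Fin (d₁ + d₂ - 1)) = Fin.castAdd d₂ (lower i) :=
      Fin.ext (by simp [lower])
    have e2 : upper (⟨0 + i.val, by omega⟩ : Fin (d₁ + d₂ - 1)) = Fin.castAdd d₂ (upper i) :=
      Fin.ext (by simp [upper])
    refine joint_T hq _ _ ?_ ?_ ?_ μ p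
    · rw [e1, e2, jointY_left, jointY_left]
      exact (AffineHecke.pair_y hq i).map _
    · intro j
      rw [e1, e2]
      refine Fin.addCases (fun j => ?_) (fun j => ?_) j
      · intro h1 h2
        rw [jointY_left]
        exact (show Commute _ _ from AffineHecke.rel (.y_T j i (fun h => h1 (h ▸ rfl))
          (fun h => h2 (h ▸ rfl)))).map _
      · intro _ _
        rw [jointY_right]
        exact (actLeft_commute _ _).symm
    · intro μ v
      obtain ⟨v, rfl⟩ := (concat K (m + n) d₁ d₂).surjective v
      rw [LinearEquiv.symm_apply_apply, outer_T_left, e1, e2]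
      congr 2
      rw [LinearEquiv.eq_symm_apply, braiding_concat_left]
  | y j =>
    have e : (⟨0 + j.val, by omega⟩ : Fin (d₁ + d₂)) = Fin.castAdd d₂ j := Fin.ext (by simp)
    rw [shiftGen, e, ← joint_y, jointY_left]
  | yInv j =>
    have e : (⟨0 + j.val, by omega⟩ : Fin (d₁ + d₂)) = Fin.castAdd d₂ j := Fin.ext (by simp)
    rw [shiftGen, e, ← joint_yInv, jointY, Fin.append_left]
    rfl

/-- The pairing is balanced over `H^a_{d₂}`. -/
theorem joint_right (b : AffineHecke q d₂) (μ : M₁ ⊗[K] M₂)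
    (p : Laurent K (d₁ + d₂) ⊗[K] TensorPower K (m + n) (d₁ + d₂)) :
    joint m n hq d₁ d₂ M₁ M₂ ((actRight q d₂ M₁ M₂ b).unop μ) p = joint m n hq d₁ d₂ M₁ M₂ μ
      (polyAction m n hq (d₁ + d₂) (shiftHom q (le_refl (d₁ + d₂)) b) p) := by
  refine joint_of_gen hq _ _ (fun g μ p => ?_) b μ p
  rw [shiftHom_gen]
  cases g with
  | T i =>
    have e1 : lower (⟨d₁ + i.val, by omega⟩ : Fin (d₁ + d₂ - 1)) = Fin.natAdd d₁ (lower i) := rfl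
    have e2 : upper (⟨d₁ + i.val, by omega⟩ : Fin (d₁ + d₂ - 1)) = Fin.natAdd d₁ (upper i) := rfl
    refine joint_T hq _ _ ?_ ?_ ?_ μ p
    · rw [e1, e2, jointY_right, jointY_right]
      exact (AffineHecke.pair_y hq i).map _
    · intro j
      rw [e1, e2]
      refine Fin.addCases (fun j => ?_) (fun j => ?_) j
      · intro _ _
        rw [jointY_left]
        exact actLeft_commute _ _
      · intro h1 h2
        rw [jointY_right]
        exact (show Commute _ _ from AffineHecke.rel (.y_T j i (fun h => h1 (h ▸ rfl))
          (fun h => h2 (h ▸ rfl)))).map _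
    · intro μ v
      obtain ⟨v, rfl⟩ := (concat K (m + n) d₁ d₂).surjective v
      rw [LinearEquiv.symm_apply_apply, outer_T_right, e1, e2]
      congr 2
      rw [LinearEquiv.eq_symm_apply, braiding_concat_right]
  | y j =>
    have e : (⟨d₁ + j.val, by omega⟩ : Fin (d₁ + d₂)) = Fin.natAdd d₁ j := rfl
    rw [shiftGen, e, ← joint_y, jointY_right]
  | yInv j =>
    have e : (⟨d₁ + j.val, by omega⟩ : Fin (d₁ + d₂)) = Fin.natAdd d₁ j := rfl
    rw [shiftGen, e, ← joint_yInv, jointY, Fin.append_right]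
    rfl

end Joint

/-! ### The isomorphism -/

section Iso
variable {K : Type u} [Field K] {m n d₁ d₂ : ℕ} {q : K} (hq : q ≠ 0)
  {M₁ : Type u} [AddCommGroup M₁] [Module K M₁] [Module (AffineHecke q d₁)ᵐᵒᵖ M₁]
  [IsScalarTower K (AffineHecke q d₁)ᵐᵒᵖ M₁]
  {M₂ : Type u} [AddCommGroup M₂] [Module K M₂] [Module (AffineHecke q d₂)ᵐᵒᵖ M₂]
  [IsScalarTower K (AffineHecke q d₂)ᵐᵒᵖ M₂]

theorem Induced.mk_left (a : AffineHecke q d₁) (h : AffineHecke q (d₁ + d₂)) (x : M₁) (y : M₂) :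
    (Submodule.Quotient.mk (h ⊗ₜ ((MulOpposite.op a • x) ⊗ₜ y)) : Induced q d₁ d₂ M₁ M₂) =
      Submodule.Quotient.mk
        ((shiftHom q (show 0 + d₁ ≤ d₁ + d₂ by omega) a * h) ⊗ₜ (x ⊗ₜ y)) := by
  rw [Submodule.Quotient.eq]
  exact Submodule.subset_span ⟨a, 1, h, x, y, by simp⟩

theorem Induced.mk_right (b : AffineHecke q d₂) (h : AffineHecke q (d₁ + d₂)) (x : M₁) (y : M₂) :
    (Submodule.Quotient.mk (h ⊗ₜ (x ⊗ₜ (MulOpposite.op b • y))) : Induced q d₁ d₂ M₁ M₂) =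
      Submodule.Quotient.mk ((shiftHom q (le_refl (d₁ + d₂)) b * h) ⊗ₜ (x ⊗ₜ y)) := by
  rw [Submodule.Quotient.eq]
  exact Submodule.subset_span ⟨1, b, h, x, y, by simp⟩

theorem Induced.op_smul_mk (h h' : AffineHecke q (d₁ + d₂)) (μ : M₁ ⊗[K] M₂) :
    MulOpposite.op h' • (Submodule.Quotient.mk (h ⊗ₜ μ) : Induced q d₁ d₂ M₁ M₂) =
      Submodule.Quotient.mk ((h * h') ⊗ₜ μ) := rfl

/-- The map `M₁ ⊗ M₂ → I^a(M₁, M₂)`. -/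
def Induced.unit (q : K) (d₁ d₂ : ℕ) (M₁ M₂ : Type u) [AddCommGroup M₁] [Module K M₁]
    [Module (AffineHecke q d₁)ᵐᵒᵖ M₁] [AddCommGroup M₂] [Module K M₂]
    [Module (AffineHecke q d₂)ᵐᵒᵖ M₂] : M₁ ⊗[K] M₂ →ₗ[K] Induced q d₁ d₂ M₁ M₂ :=
  ((inductionRelations q d₁ d₂ M₁ M₂).mkQ.restrictScalars K) ∘ₗ
    TensorProduct.mk K (AffineHecke q (d₁ + d₂)) (M₁ ⊗[K] M₂) 1

/-- The map `(M₁ ⊗ V^{⊗ d₁}) ⊗ (M₂ ⊗ V^{⊗ d₂}) → ℱ(I^a(M₁, M₂))`. -/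
def preTensorToInduced (m n : ℕ) (hq : q ≠ 0) (d₁ d₂ : ℕ) (M₁ M₂ : Type u) [AddCommGroup M₁]
    [Module K M₁] [Module (AffineHecke q d₁)ᵐᵒᵖ M₁] [AddCommGroup M₂] [Module K M₂]
    [Module (AffineHecke q d₂)ᵐᵒᵖ M₂] :
    M₁ ⊗[K] TensorPower K (m + n) d₁ →ₗ[K] M₂ ⊗[K] TensorPower K (m + n) d₂ →ₗ[K]
      SchurWeyl m n hq (d₁ + d₂) (Induced q d₁ d₂ M₁ M₂) :=
  TensorProduct.curry ((balancedRelations m n hq (d₁ + d₂) (Induced q d₁ d₂ M₁ M₂)).mkQ ∘ₗ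
    TensorProduct.map (Induced.unit q d₁ d₂ M₁ M₂) (concat K (m + n) d₁ d₂).toLinearMap ∘ₗ
    (TensorProduct.tensorTensorTensorComm K M₁ _ M₂ _).toLinearMap)

theorem preTensorToInduced_tmul (x : M₁) (y : M₂) (v : TensorPower K (m + n) d₁)
    (w : TensorPower K (m + n) d₂) :
    preTensorToInduced m n hq d₁ d₂ M₁ M₂ (x ⊗ₜ v) (y ⊗ₜ w) = Submodule.Quotient.mk
      ((Submodule.Quotient.mk (1 ⊗ₜ (x ⊗ₜ y)) : Induced q d₁ d₂ M₁ M₂) ⊗ₜ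
        concat K (m + n) d₁ d₂ (v ⊗ₜ w)) := rfl

theorem balanced_shift_left (i : Fin (d₁ - 1)) (x : M₁) (y : M₂) (v : TensorPower K (m + n) d₁)
    (w : TensorPower K (m + n) d₂) :
    preTensorToInduced m n hq d₁ d₂ M₁ M₂
        ((MulOpposite.op (AffineHecke.gen q (.T i)) • x) ⊗ₜ v) (y ⊗ₜ w) =
      preTensorToInduced m n hq d₁ d₂ M₁ M₂
        (x ⊗ₜ braiding m n q (lower i) (upper i) v) (y ⊗ₜ w) := by
  have e1 : lower (⟨0 + i.val, by omega⟩ : Fin (d₁ + d₂ - 1)) = Fin.castAdd d₂ (lower i) :=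
    Fin.ext (by simp [lower])
  have e2 : upper (⟨0 + i.val, by omega⟩ : Fin (d₁ + d₂ - 1)) = Fin.castAdd d₂ (upper i) :=
    Fin.ext (by simp [upper])
  rw [preTensorToInduced_tmul, preTensorToInduced_tmul, Induced.mk_left, shiftHom_gen, mul_one,
    ← one_mul (AffineHecke.gen q _), ← Induced.op_smul_mk, shiftGen, balanced_T, e1, e2,
    braiding_concat_left]
  rfl

theorem balanced_shift_right (i : Fin (d₂ - 1)) (x : M₁) (y : M₂) (v : TensorPower K (m + n) d₁)
    (w : TensorPower K (m + n) d₂) :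
    preTensorToInduced m n hq d₁ d₂ M₁ M₂ (x ⊗ₜ v)
        ((MulOpposite.op (AffineHecke.gen q (.T i)) • y) ⊗ₜ w) =
      preTensorToInduced m n hq d₁ d₂ M₁ M₂ (x ⊗ₜ v)
        (y ⊗ₜ braiding m n q (lower i) (upper i) w) := by
  have e1 : lower (⟨d₁ + i.val, by omega⟩ : Fin (d₁ + d₂ - 1)) = Fin.natAdd d₁ (lower i) := rfl
  have e2 : upper (⟨d₁ + i.val, by omega⟩ : Fin (d₁ + d₂ - 1)) = Fin.natAdd d₁ (upper i) := rfl
  rw [preTensorToInduced_tmul, preTensorToInduced_tmul, Induced.mk_right, shiftHom_gen, mul_one,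
    ← one_mul (AffineHecke.gen q _), ← Induced.op_smul_mk, shiftGen, balanced_T, e1, e2,
    braiding_concat_right]
  rfl

theorem preTensorToInduced_balanced_left :
    balancedRelations m n hq d₁ M₁ ≤ LinearMap.ker (preTensorToInduced m n hq d₁ d₂ M₁ M₂) :=
  balancedRelations_le hq _ fun i x v => TensorProduct.ext' fun y w =>
    balanced_shift_left hq i x y v w

theorem preTensorToInduced_balanced_right :
    balancedRelations m n hq d₂ M₂ ≤ LinearMap.ker ((balancedRelations m n hq d₁ M₁).liftQ _
      (preTensorToInduced_balanced_left (d₂ := d₂) (M₂ := M₂) hq)).flip :=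
  balancedRelations_le hq _ fun i y w => Submodule.linearMap_qext _ <| TensorProduct.ext' fun x v =>
    balanced_shift_right hq i x y v w

/-- The map `ℱ(M₁) ⊗ ℱ(M₂) → ℱ(I^a(M₁, M₂))`,
`(x ⊗ v) ⊗ (y ⊗ w) ↦ (1 ⊗ (x ⊗ y)) ⊗ (v ⊗ w)`. -/
def tensorToInduced (m n : ℕ) (hq : q ≠ 0) (d₁ d₂ : ℕ) (M₁ M₂ : Type u) [AddCommGroup M₁]
    [Module K M₁] [Module (AffineHecke q d₁)ᵐᵒᵖ M₁] [IsScalarTower K (AffineHecke q d₁)ᵐᵒᵖ M₁]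
    [AddCommGroup M₂] [Module K M₂] [Module (AffineHecke q d₂)ᵐᵒᵖ M₂]
    [IsScalarTower K (AffineHecke q d₂)ᵐᵒᵖ M₂] :
    SchurWeyl m n hq d₁ M₁ ⊗[K] SchurWeyl m n hq d₂ M₂ →ₗ[K]
      SchurWeyl m n hq (d₁ + d₂) (Induced q d₁ d₂ M₁ M₂) :=
  TensorProduct.lift ((balancedRelations m n hq d₂ M₂).liftQ _
    (preTensorToInduced_balanced_right (M₁ := M₁) hq)).flip

theorem tensorToInduced_tmul (x : M₁) (y : M₂) (v : TensorPower K (m + n) d₁)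
    (w : TensorPower K (m + n) d₂) :
    tensorToInduced m n hq d₁ d₂ M₁ M₂
        (Submodule.Quotient.mk (x ⊗ₜ v) ⊗ₜ Submodule.Quotient.mk (y ⊗ₜ w)) =
      Submodule.Quotient.mk ((Submodule.Quotient.mk (1 ⊗ₜ (x ⊗ₜ y)) : Induced q d₁ d₂ M₁ M₂) ⊗ₜ
        concat K (m + n) d₁ d₂ (v ⊗ₜ w)) := rfl

/-- Linear maps on `ℱ(M₁) ⊗ ℱ(M₂)` agree if they agree on the classes of pure tensors. -/
theorem ext_schurWeyl_tmul {W : Type*} [AddCommGroup W] [Module K W]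
    {F G : SchurWeyl m n hq d₁ M₁ ⊗[K] SchurWeyl m n hq d₂ M₂ →ₗ[K] W}
    (h : ∀ x v y w, F (Submodule.Quotient.mk (x ⊗ₜ v) ⊗ₜ Submodule.Quotient.mk (y ⊗ₜ w)) =
      G (Submodule.Quotient.mk (x ⊗ₜ v) ⊗ₜ Submodule.Quotient.mk (y ⊗ₜ w))) : F = G := by
  refine TensorProduct.ext ?_
  refine Submodule.linearMap_qext _ (TensorProduct.ext' fun x v => ?_)
  exact Submodule.linearMap_qext _ (TensorProduct.ext' fun y w => h x v y w)

/-- `h ⊗ μ ↦ (v ↦ μ · h (1 ⊗ v))`. -/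
def preInducedToTensor (m n : ℕ) (hq : q ≠ 0) (d₁ d₂ : ℕ) (M₁ M₂ : Type u) [AddCommGroup M₁]
    [Module K M₁] [Module (AffineHecke q d₁)ᵐᵒᵖ M₁] [IsScalarTower K (AffineHecke q d₁)ᵐᵒᵖ M₁]
    [AddCommGroup M₂] [Module K M₂] [Module (AffineHecke q d₂)ᵐᵒᵖ M₂]
    [IsScalarTower K (AffineHecke q d₂)ᵐᵒᵖ M₂] :
    AffineHecke q (d₁ + d₂) ⊗[K] (M₁ ⊗[K] M₂) →ₗ[K]
      TensorPower K (m + n) (d₁ + d₂) →ₗ[K] SchurWeyl m n hq d₁ M₁ ⊗[K] SchurWeyl m n hq d₂ M₂ :=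
  TensorProduct.lift <| LinearMap.mk₂ K
    (fun h μ => joint m n hq d₁ d₂ M₁ M₂ μ ∘ₗ polyAction m n hq (d₁ + d₂) h ∘ₗ
      TensorProduct.mk K (Laurent K (d₁ + d₂)) (TensorPower K (m + n) (d₁ + d₂)) 1)
    (fun h h' μ => by ext; simp) (fun c h μ => by ext; simp)
    (fun h μ μ' => by ext; simp) (fun c h μ => by ext; simp)

theorem preInducedToTensor_tmul (h : AffineHecke q (d₁ + d₂)) (μ : M₁ ⊗[K] M₂)
    (v : TensorPower K (m + n) (d₁ + d₂)) :
    preInducedToTensor m n hq d₁ d₂ M₁ M₂ (h ⊗ₜ μ) v =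
      joint m n hq d₁ d₂ M₁ M₂ μ (polyAction m n hq (d₁ + d₂) h (1 ⊗ₜ v)) := rfl

theorem preInducedToTensor_relations :
    (inductionRelations q d₁ d₂ M₁ M₂).restrictScalars K ≤
      LinearMap.ker (preInducedToTensor m n hq d₁ d₂ M₁ M₂) := by
  intro t ht
  rw [Submodule.restrictScalars_mem] at ht
  rw [LinearMap.mem_ker]
  suffices H : ∀ r : (AffineHecke q (d₁ + d₂))ᵐᵒᵖ,
      preInducedToTensor m n hq d₁ d₂ M₁ M₂ (r • t) = 0 by simpa using H 1
  refine Submodule.span_induction (p := fun t _ => ∀ r : (AffineHecke q (d₁ + d₂))ᵐᵒᵖ,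
      preInducedToTensor m n hq d₁ d₂ M₁ M₂ (r • t) = 0) ?_ ?_ ?_ ?_ ht
  · rintro _ ⟨a, b, h, x, y, rfl⟩ r
    refine LinearMap.ext fun v => ?_
    rw [smul_sub, TensorProduct.smul_tmul', TensorProduct.smul_tmul', map_sub,
      LinearMap.sub_apply, preInducedToTensor_tmul, preInducedToTensor_tmul, LinearMap.zero_apply,
      sub_eq_zero]
    have e : (MulOpposite.op a • x) ⊗ₜ[K] (MulOpposite.op b • y) =
        (actRight q d₂ M₁ M₂ b).unop ((actLeft q d₁ M₁ M₂ a).unop (x ⊗ₜ y)) := rfl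
    rw [e, joint_right, joint_left, ← Module.End.mul_apply, ← Module.End.mul_apply, ← map_mul,
      ← map_mul]
    simp only [MulOpposite.smul_eq_mul_unop, mul_assoc]
  · intro r; rw [smul_zero, map_zero]
  · intro s t _ _ hs ht r
    rw [smul_add, map_add, hs, ht, add_zero]
  · intro a t _ ht r
    rw [smul_smul]; exact ht _

/-- Linear maps on `ℱ(I^a(M₁, M₂))` from balanced maps. -/
theorem SchurWeyl.exists_lift_induced {W : Type*} [AddCommGroup W] [Module K W]
    (L : AffineHecke q (d₁ + d₂) ⊗[K] (M₁ ⊗[K] M₂) →ₗ[K]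
      TensorPower K (m + n) (d₁ + d₂) →ₗ[K] W)
    (hL : (inductionRelations q d₁ d₂ M₁ M₂).restrictScalars K ≤ LinearMap.ker L)
    (hL' : ∀ h μ i v, L ((h * AffineHecke.gen q (.T i)) ⊗ₜ μ) v =
      L (h ⊗ₜ μ) (braiding m n q (lower i) (upper i) v)) :
    ∃ F : SchurWeyl m n hq (d₁ + d₂) (Induced q d₁ d₂ M₁ M₂) →ₗ[K] W, ∀ h μ v,
      F (Submodule.Quotient.mk ((Submodule.Quotient.mk (h ⊗ₜ μ) : Induced q d₁ d₂ M₁ M₂) ⊗ₜ v)) =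
        L (h ⊗ₜ μ) v := by
  let L₁ : Induced q d₁ d₂ M₁ M₂ →ₗ[K] TensorPower K (m + n) (d₁ + d₂) →ₗ[K] W :=
    ((inductionRelations q d₁ d₂ M₁ M₂).restrictScalars K).liftQ L hL ∘ₗ
      (Submodule.Quotient.restrictScalarsEquiv K
        (inductionRelations q d₁ d₂ M₁ M₂)).symm.toLinearMap
  have hL₁ : ∀ h μ v, L₁ (Submodule.Quotient.mk (h ⊗ₜ μ)) v = L (h ⊗ₜ μ) v := fun h μ v => rfl
  refine ⟨(balancedRelations m n hq (d₁ + d₂) (Induced q d₁ d₂ M₁ M₂)).liftQ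
    (TensorProduct.lift L₁) (balancedRelations_le hq _ fun i ξ v => ?_), fun h μ v => hL₁ h μ v⟩
  rw [TensorProduct.lift.tmul, TensorProduct.lift.tmul]
  obtain ⟨t, rfl⟩ := Submodule.Quotient.mk_surjective _ ξ
  induction t with
  | zero => simp
  | add a b ha hb =>
    rw [Submodule.Quotient.mk_add, smul_add, map_add, map_add, LinearMap.add_apply, ha, hb,
      LinearMap.add_apply]
  | tmul h μ => rw [Induced.op_smul_mk, hL₁, hL₁, hL']

/-- The map `ℱ(I^a(M₁, M₂)) → ℱ(M₁) ⊗ ℱ(M₂)`, `(h ⊗ μ) ⊗ v ↦ μ · h (1 ⊗ v)`, with `h` acting on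
the Laurent polynomials with values in `V^{⊗ (d₁ + d₂)}`, which are then evaluated on
`M₁ ⊗ M₂`. -/
theorem exists_inducedToTensor :
    ∃ L : SchurWeyl m n hq (d₁ + d₂) (Induced q d₁ d₂ M₁ M₂) →ₗ[K]
      SchurWeyl m n hq d₁ M₁ ⊗[K] SchurWeyl m n hq d₂ M₂, ∀ h μ v,
      L (Submodule.Quotient.mk ((Submodule.Quotient.mk (h ⊗ₜ μ) : Induced q d₁ d₂ M₁ M₂) ⊗ₜ v)) =
        joint m n hq d₁ d₂ M₁ M₂ μ (polyAction m n hq (d₁ + d₂) h (1 ⊗ₜ v)) := by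
  refine SchurWeyl.exists_lift_induced hq (preInducedToTensor m n hq d₁ d₂ M₁ M₂)
    (preInducedToTensor_relations hq) fun h μ i v => ?_
  rw [preInducedToTensor_tmul, preInducedToTensor_tmul, map_mul, Module.End.mul_apply,
    polyAction_T, map_one, demazure_one, TensorProduct.zero_tmul, smul_zero, add_zero]

/-- The map has a left inverse. -/
theorem tensorToInduced_injective : Function.Injective (tensorToInduced m n hq d₁ d₂ M₁ M₂) := by
  obtain ⟨L, hL⟩ := exists_inducedToTensor (d₁ := d₁) (d₂ := d₂) (M₁ := M₁) (M₂ := M₂)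
    (m := m) (n := n) hq
  have h : L ∘ₗ tensorToInduced m n hq d₁ d₂ M₁ M₂ = LinearMap.id := by
    refine ext_schurWeyl_tmul hq fun x v y w => ?_
    rw [LinearMap.comp_apply, tensorToInduced_tmul, hL, map_one, Module.End.one_apply, joint_tmul,
      map_one, LinearEquiv.symm_apply_apply]
    rfl
  exact Function.LeftInverse.injective fun t => LinearMap.congr_fun h t

/-- In `(h ⊗ (x ⊗ y)) ⊗ v` with `h` a lattice monomial times a monomial in the `T_i`, the first factor is
absorbed by `x ⊗ y` and the second by `v`. -/
theorem tensorToInduced_surjective :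
    Function.Surjective (tensorToInduced m n hq d₁ d₂ M₁ M₂) := by
  rw [← LinearMap.range_eq_top, eq_top_iff]
  set S := LinearMap.range (tensorToInduced m n hq d₁ d₂ M₁ M₂)
  have key : ∀ h : AffineHecke q (d₁ + d₂), AffineHecke.IsNormal q (d₁ + d₂) h → ∀ x y v,
      (Submodule.Quotient.mk ((Submodule.Quotient.mk (h ⊗ₜ (x ⊗ₜ y)) : Induced q d₁ d₂ M₁ M₂) ⊗ₜ v) :
        SchurWeyl m n hq (d₁ + d₂) (Induced q d₁ d₂ M₁ M₂)) ∈ S := by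
    intro h hh
    induction hh with
    | one =>
      intro x y v
      obtain ⟨v, rfl⟩ := (concat K (m + n) d₁ d₂).surjective v
      induction v with
      | zero =>
        rw [LinearEquiv.map_zero, TensorProduct.tmul_zero, Submodule.Quotient.mk_zero]
        exact S.zero_mem
      | add a b ha hb =>
        rw [LinearEquiv.map_add, TensorProduct.tmul_add, Submodule.Quotient.mk_add]
        exact S.add_mem ha hb
      | tmul v w => exact ⟨_, tensorToInduced_tmul hq x y v w⟩
    | y_mul j _ ih =>
      intro x y v
      refine Fin.addCases (fun j => ?_) (fun j => ?_) j
      · have e : (⟨0 + j.val, by omega⟩ : Fin (d₁ + d₂)) = Fin.castAdd d₂ j := Fin.ext (by simp)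
        have := ih (MulOpposite.op (AffineHecke.gen q (.y j)) • x) y v
        rw [Induced.mk_left, shiftHom_gen, shiftGen, e] at this
        exact this
      · have := ih x (MulOpposite.op (AffineHecke.gen q (.y j)) • y) v
        rw [Induced.mk_right, shiftHom_gen, shiftGen] at this
        exact this
    | yInv_mul j _ ih =>
      intro x y v
      refine Fin.addCases (fun j => ?_) (fun j => ?_) j
      · have e : (⟨0 + j.val, by omega⟩ : Fin (d₁ + d₂)) = Fin.castAdd d₂ j := Fin.ext (by simp)
        have := ih (MulOpposite.op (AffineHecke.gen q (.yInv j)) • x) y v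
        rw [Induced.mk_left, shiftHom_gen, shiftGen, e] at this
        exact this
      · have := ih x (MulOpposite.op (AffineHecke.gen q (.yInv j)) • y) v
        rw [Induced.mk_right, shiftHom_gen, shiftGen] at this
        exact this
    | mul_T i _ ih =>
      intro x y v
      rw [← Induced.op_smul_mk, balanced_T]
      exact ih x y _
    | add _ _ ih ih' =>
      intro x y v
      rw [TensorProduct.add_tmul, Submodule.Quotient.mk_add, TensorProduct.add_tmul,
        Submodule.Quotient.mk_add]
      exact S.add_mem (ih x y v) (ih' x y v)
    | smul c _ ih =>
      intro x y v
      have := S.smul_mem c (ih x y v)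
      exact this
  rintro t -
  obtain ⟨t, rfl⟩ := Submodule.Quotient.mk_surjective _ t
  induction t with
  | zero => rw [Submodule.Quotient.mk_zero]; exact S.zero_mem
  | add a b ha hb => rw [Submodule.Quotient.mk_add]; exact S.add_mem ha hb
  | tmul ξ v =>
    obtain ⟨t, rfl⟩ := Submodule.Quotient.mk_surjective _ ξ
    induction t with
    | zero =>
      rw [Submodule.Quotient.mk_zero, TensorProduct.zero_tmul, Submodule.Quotient.mk_zero]
      exact S.zero_mem
    | add a b ha hb =>
      rw [Submodule.Quotient.mk_add, TensorProduct.add_tmul, Submodule.Quotient.mk_add]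
      exact S.add_mem ha hb
    | tmul h μ =>
      induction μ with
      | zero =>
        rw [TensorProduct.tmul_zero, Submodule.Quotient.mk_zero, TensorProduct.zero_tmul,
          Submodule.Quotient.mk_zero]
        exact S.zero_mem
      | add a b ha hb =>
        rw [TensorProduct.tmul_add, Submodule.Quotient.mk_add, TensorProduct.add_tmul,
          Submodule.Quotient.mk_add]
        exact S.add_mem ha hb
      | tmul x y => exact key h (AffineHecke.isNormal hq h) x y v

/-- The isomorphism between `ℱ(I^a(M₁, M₂))` and `ℱ(M₁) ⊗ ℱ(M₂)`. -/
def inducedEquiv (m n : ℕ) (hq : q ≠ 0) (d₁ d₂ : ℕ) (M₁ M₂ : Type u) [AddCommGroup M₁]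
    [Module K M₁] [Module (AffineHecke q d₁)ᵐᵒᵖ M₁] [IsScalarTower K (AffineHecke q d₁)ᵐᵒᵖ M₁]
    [AddCommGroup M₂] [Module K M₂] [Module (AffineHecke q d₂)ᵐᵒᵖ M₂]
    [IsScalarTower K (AffineHecke q d₂)ᵐᵒᵖ M₂] :
    SchurWeyl m n hq (d₁ + d₂) (Induced q d₁ d₂ M₁ M₂) ≃ₗ[K]
      SchurWeyl m n hq d₁ M₁ ⊗[K] SchurWeyl m n hq d₂ M₂ :=
  (LinearEquiv.ofBijective (tensorToInduced m n hq d₁ d₂ M₁ M₂)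
    ⟨tensorToInduced_injective hq, tensorToInduced_surjective hq⟩).symm

end Iso

/-! ### Equivariance and naturality -/

section Action
variable {K : Type u} [Field K] {q : K} {hq : q ≠ 0} {d : ℕ} {m n : ℕ}
  {Γ : AddSubgroup (WeightLattice m n)} {hΓ : ∀ i, root m n i ∈ Γ}
  {M : Type u} [AddCommGroup M] [Module K M] [Module (AffineHecke q d)ᵐᵒᵖ M]
  [IsScalarTower K (AffineHecke q d)ᵐᵒᵖ M]
  {ρ : AffineQuantum q Γ hΓ →ₐ[K] Module.End K (SchurWeyl m n hq d M)}

theorem IsSchurWeylAction.sigma_mk (h : IsSchurWeylAction hq Γ hΓ d M ρ) (x : M)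
    (v : TensorPower K (m + n) d) :
    ρ (.gen q Γ hΓ .sigma) (Submodule.Quotient.mk (x ⊗ₜ v)) =
      Submodule.Quotient.mk (x ⊗ₜ siteMap (fun _ => natRep q Γ .sigma) v) := by
  rw [h, schurWeylOperator_eq (hΓ := hΓ)]
  simp only [iteratedRep, Fin.is_lt, if_true, siteOp]
  rfl

theorem IsSchurWeylAction.sigma_pow_mk (h : IsSchurWeylAction hq Γ hΓ d M ρ) (p : ℕ) (x : M)
    (v : TensorPower K (m + n) d) :
    ρ (.gen q Γ hΓ .sigma ^ p) (Submodule.Quotient.mk (x ⊗ₜ v)) =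
      Submodule.Quotient.mk (x ⊗ₜ siteMap (fun _ => natRep q Γ .sigma ^ p) v) := by
  induction p generalizing v with
  | zero =>
    simp only [pow_zero, map_one, Module.End.one_apply]
    rw [show (fun _ : Fin d => (1 : Matrix (Fin (m + n)) (Fin (m + n)) K)) = 1 from rfl,
      siteMap_one, Module.End.one_apply]
  | succ p ih =>
    rw [pow_succ, map_mul, Module.End.mul_apply, h.sigma_mk, ih, ← Module.End.mul_apply,
      siteMap_mul]
    rfl

theorem IsSchurWeylAction.K_mk (h : IsSchurWeylAction hq Γ hΓ d M ρ) (γ : Γ) (x : M)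
    (v : TensorPower K (m + n) d) :
    ρ (.gen q Γ hΓ (.K γ)) (Submodule.Quotient.mk (x ⊗ₜ v)) =
      Submodule.Quotient.mk (x ⊗ₜ siteMap (fun _ => natRep q Γ (.K γ)) v) := by
  rw [h, schurWeylOperator_eq (hΓ := hΓ)]
  simp only [iteratedRep, Fin.is_lt, if_true, siteOp]
  rfl

theorem IsSchurWeylAction.E_mk (h : IsSchurWeylAction hq Γ hΓ d M ρ) (i : Fin (m + n)) (x : M)
    (v : TensorPower K (m + n) d) :
    ρ (.gen q Γ hΓ (.E i)) (Submodule.Quotient.mk (x ⊗ₜ v)) =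
      ∑ k, Submodule.Quotient.mk
        ((if i.val = 0 then MulOpposite.op (AffineHecke.gen q (.yInv k)) • x else x) ⊗ₜ
          siteMap (siteE q hΓ i k) v) := by
  rw [h, schurWeylOperator_eq (hΓ := hΓ), iteratedRep_E_eq, LinearMap.sum_apply]
  refine (map_sum (balancedRelations m n hq d M).mkQ _ _).trans (Finset.sum_congr rfl fun k _ => ?_)
  split_ifs <;> rfl

theorem IsSchurWeylAction.F_mk (h : IsSchurWeylAction hq Γ hΓ d M ρ) (i : Fin (m + n)) (x : M)
    (v : TensorPower K (m + n) d) :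
    ρ (.gen q Γ hΓ (.F i)) (Submodule.Quotient.mk (x ⊗ₜ v)) =
      ∑ k, Submodule.Quotient.mk
        ((if i.val = 0 then MulOpposite.op (AffineHecke.gen q (.y k)) • x else x) ⊗ₜ
          siteMap (siteF q hΓ i k) v) := by
  rw [h, schurWeylOperator_eq (hΓ := hΓ), iteratedRep_F_eq, LinearMap.sum_apply]
  refine (map_sum (balancedRelations m n hq d M).mkQ _ _).trans (Finset.sum_congr rfl fun k _ => ?_)
  split_ifs <;> rfl

end Action

section Equivariance
variable {K : Type u} [Field K] {m n d₁ d₂ : ℕ} {q : K} {hq : q ≠ 0}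
  {Γ : AddSubgroup (WeightLattice m n)} {hΓ : ∀ i, root m n i ∈ Γ}
  {M₁ : Type u} [AddCommGroup M₁] [Module K M₁] [Module (AffineHecke q d₁)ᵐᵒᵖ M₁]
  [IsScalarTower K (AffineHecke q d₁)ᵐᵒᵖ M₁]
  {M₂ : Type u} [AddCommGroup M₂] [Module K M₂] [Module (AffineHecke q d₂)ᵐᵒᵖ M₂]
  [IsScalarTower K (AffineHecke q d₂)ᵐᵒᵖ M₂]

theorem Induced.op_shift_left (a : AffineHecke q d₁) (x : M₁) (y : M₂) :
    MulOpposite.op (shiftHom q (show 0 + d₁ ≤ d₁ + d₂ by omega) a) •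
        (Submodule.Quotient.mk (1 ⊗ₜ (x ⊗ₜ y)) : Induced q d₁ d₂ M₁ M₂) =
      Submodule.Quotient.mk (1 ⊗ₜ ((MulOpposite.op a • x) ⊗ₜ y)) := by
  rw [Induced.mk_left, Induced.op_smul_mk, one_mul, mul_one]

theorem Induced.op_shift_right (b : AffineHecke q d₂) (x : M₁) (y : M₂) :
    MulOpposite.op (shiftHom q (le_refl (d₁ + d₂)) b) •
        (Submodule.Quotient.mk (1 ⊗ₜ (x ⊗ₜ y)) : Induced q d₁ d₂ M₁ M₂) =
      Submodule.Quotient.mk (1 ⊗ₜ (x ⊗ₜ (MulOpposite.op b • y))) := by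
  rw [Induced.mk_right, Induced.op_smul_mk, one_mul, mul_one]

theorem shiftHom_y_left (k : Fin d₁) :
    shiftHom q (show 0 + d₁ ≤ d₁ + d₂ by omega) (AffineHecke.gen q (.y k)) =
      AffineHecke.gen q (.y (Fin.castAdd d₂ k)) := by
  rw [shiftHom_gen, shiftGen]
  congr 2
  exact Fin.ext (Nat.zero_add _)

theorem shiftHom_yInv_left (k : Fin d₁) :
    shiftHom q (show 0 + d₁ ≤ d₁ + d₂ by omega) (AffineHecke.gen q (.yInv k)) =
      AffineHecke.gen q (.yInv (Fin.castAdd d₂ k)) := by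
  rw [shiftHom_gen, shiftGen]
  congr 2
  exact Fin.ext (Nat.zero_add _)

theorem shiftHom_y_right (k : Fin d₂) :
    shiftHom q (le_refl (d₁ + d₂)) (AffineHecke.gen q (.y k)) =
      AffineHecke.gen q (.y (Fin.natAdd d₁ k)) := shiftHom_gen _ _

theorem shiftHom_yInv_right (k : Fin d₂) :
    shiftHom q (le_refl (d₁ + d₂)) (AffineHecke.gen q (.yInv k)) =
      AffineHecke.gen q (.yInv (Fin.natAdd d₁ k)) := shiftHom_gen _ _

/-- The map intertwines the comultiplication of the two actions with the action on
`ℱ(I^a(M₁, M₂))`. -/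
theorem tensorToInduced_equivariant
    {ρ₁ : AffineQuantum q Γ hΓ →ₐ[K] Module.End K (SchurWeyl m n hq d₁ M₁)}
    {ρ₂ : AffineQuantum q Γ hΓ →ₐ[K] Module.End K (SchurWeyl m n hq d₂ M₂)}
    {ρ : AffineQuantum q Γ hΓ →ₐ[K]
      Module.End K (SchurWeyl m n hq (d₁ + d₂) (Induced q d₁ d₂ M₁ M₂))}
    (h₁ : IsSchurWeylAction hq Γ hΓ d₁ M₁ ρ₁) (h₂ : IsSchurWeylAction hq Γ hΓ d₂ M₂ ρ₂)
    (h : IsSchurWeylAction hq Γ hΓ (d₁ + d₂) (Induced q d₁ d₂ M₁ M₂) ρ) (g : Gen Γ) :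
    ρ (.gen q Γ hΓ g) ∘ₗ tensorToInduced m n hq d₁ d₂ M₁ M₂ =
      tensorToInduced m n hq d₁ d₂ M₁ M₂ ∘ₗ tensorOperator q Γ hΓ ρ₁ ρ₂ g := by
  refine ext_schurWeyl_tmul hq fun x v y w => ?_
  rw [LinearMap.comp_apply, LinearMap.comp_apply, tensorToInduced_tmul]
  cases g with
  | sigma =>
    rw [h.sigma_mk, tensorOperator, TensorProduct.map_tmul, h₁.sigma_mk, h₂.sigma_mk,
      tensorToInduced_tmul, siteMap_concat]
  | K γ =>
    rw [h.K_mk, tensorOperator, TensorProduct.map_tmul, h₁.K_mk, h₂.K_mk,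
      tensorToInduced_tmul, siteMap_concat]
  | E i =>
    rw [h.E_mk, tensorOperator, LinearMap.add_apply, TensorProduct.map_tmul,
      TensorProduct.map_tmul, map_mul ρ₁, Module.End.mul_apply, h₁.sigma_pow_mk, h₁.K_mk, h₁.E_mk,
      h₂.E_mk, Module.End.one_apply, TensorProduct.sum_tmul, TensorProduct.tmul_sum, map_add,
      map_sum, map_sum, Fin.sum_univ_add]
    congr 1
    · refine Finset.sum_congr rfl fun k _ => ?_
      have e1 : (fun l => siteE q hΓ i (Fin.castAdd d₂ k) (Fin.castAdd d₂ l)) = siteE q hΓ i k := by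
        funext l; simp only [siteE, Fin.lt_def, Fin.ext_iff, Fin.val_castAdd]
      have e2 : (fun l : Fin d₂ => siteE q hΓ i (Fin.castAdd d₂ k) (Fin.natAdd d₁ l)) = 1 := by
        funext l
        have := k.isLt
        simp only [siteE, Fin.lt_def, Fin.ext_iff, Fin.val_castAdd, Fin.val_natAdd, Pi.one_apply]
        rw [if_neg (by omega), if_neg (by omega)]
      rw [siteMap_concat, tensorToInduced_tmul, e1, e2, siteMap_one, Module.End.one_apply]
      congr 2
      split_ifs
      · rw [← shiftHom_yInv_left, Induced.op_shift_left]
      · rfl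
    · refine Finset.sum_congr rfl fun k _ => ?_
      have e1 : (fun l => siteE q hΓ i (Fin.natAdd d₁ k) (Fin.natAdd d₁ l)) = siteE q hΓ i k := by
        funext l; simp only [siteE, Fin.lt_def, Fin.ext_iff, Fin.val_natAdd,
          Nat.add_lt_add_iff_left, Nat.add_left_cancel_iff]
      have e2 : (fun l : Fin d₁ => siteE q hΓ i (Fin.natAdd d₁ k) (Fin.castAdd d₂ l)) =
          fun _ => natRep q Γ (.K ⟨root m n i, hΓ i⟩) * natRep q Γ .sigma ^ nodeParity m n i := by
        funext l
        have := l.isLt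
        simp only [siteE, Fin.lt_def, Fin.val_castAdd, Fin.val_natAdd]
        rw [if_pos (by omega)]
      rw [siteMap_concat, tensorToInduced_tmul, e1, e2, ← Module.End.mul_apply, siteMap_mul]
      congr 2
      split_ifs
      · rw [← shiftHom_yInv_right, Induced.op_shift_right]
      · rfl
  | F i =>
    rw [h.F_mk, tensorOperator, LinearMap.add_apply, TensorProduct.map_tmul,
      TensorProduct.map_tmul, h₁.sigma_pow_mk, h₂.K_mk, h₁.F_mk,
      h₂.F_mk, TensorProduct.sum_tmul, TensorProduct.tmul_sum, map_add,
      map_sum, map_sum, Fin.sum_univ_add]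
    congr 1
    · refine Finset.sum_congr rfl fun k _ => ?_
      have e1 : (fun l => siteF q hΓ i (Fin.castAdd d₂ k) (Fin.castAdd d₂ l)) = siteF q hΓ i k := by
        funext l; simp only [siteF, Fin.lt_def, Fin.ext_iff, Fin.val_castAdd]
      have e2 : (fun l : Fin d₂ => siteF q hΓ i (Fin.castAdd d₂ k) (Fin.natAdd d₁ l)) =
          fun _ => natRep q Γ (.K (-⟨root m n i, hΓ i⟩)) := by
        funext l
        have := k.isLt
        simp only [siteF, Fin.lt_def, Fin.ext_iff, Fin.val_castAdd, Fin.val_natAdd]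
        rw [if_neg (by omega), if_neg (by omega)]
      rw [siteMap_concat, tensorToInduced_tmul, e1, e2]
      congr 2
      split_ifs
      · rw [← shiftHom_y_left, Induced.op_shift_left]
      · rfl
    · refine Finset.sum_congr rfl fun k _ => ?_
      have e1 : (fun l => siteF q hΓ i (Fin.natAdd d₁ k) (Fin.natAdd d₁ l)) = siteF q hΓ i k := by
        funext l; simp only [siteF, Fin.lt_def, Fin.ext_iff, Fin.val_natAdd,
          Nat.add_lt_add_iff_left, Nat.add_left_cancel_iff]
      have e2 : (fun l : Fin d₁ => siteF q hΓ i (Fin.natAdd d₁ k) (Fin.castAdd d₂ l)) =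
          fun _ => natRep q Γ .sigma ^ nodeParity m n i := by
        funext l
        have := l.isLt
        simp only [siteF, Fin.lt_def, Fin.val_castAdd, Fin.val_natAdd]
        rw [if_pos (by omega)]
      rw [siteMap_concat, tensorToInduced_tmul, e1, e2]
      congr 2
      split_ifs
      · rw [← shiftHom_y_right, Induced.op_shift_right]
      · rfl

theorem tensorToInduced_natural {N₁ : Type u} [AddCommGroup N₁] [Module K N₁]
    [Module (AffineHecke q d₁)ᵐᵒᵖ N₁] [IsScalarTower K (AffineHecke q d₁)ᵐᵒᵖ N₁]
    {N₂ : Type u} [AddCommGroup N₂] [Module K N₂] [Module (AffineHecke q d₂)ᵐᵒᵖ N₂]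
    [IsScalarTower K (AffineHecke q d₂)ᵐᵒᵖ N₂]
    (f₁ : M₁ →ₗ[(AffineHecke q d₁)ᵐᵒᵖ] N₁) (f₂ : M₂ →ₗ[(AffineHecke q d₂)ᵐᵒᵖ] N₂) :
    SchurWeyl.map m n hq (d₁ + d₂) (Induced.map q d₁ d₂ f₁ f₂) ∘ₗ
        tensorToInduced m n hq d₁ d₂ M₁ M₂ =
      tensorToInduced m n hq d₁ d₂ N₁ N₂ ∘ₗ
        TensorProduct.map (SchurWeyl.map m n hq d₁ f₁) (SchurWeyl.map m n hq d₂ f₂) :=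
  ext_schurWeyl_tmul hq fun _ _ _ _ => rfl

end Equivariance

end

end SuperSchurWeyl

theorem proposition17p1 {K : Type u} [Field K] [CharZero K] (q : K) (hq : q ≠ 0)
    (hroot : ∀ k : ℕ, 0 < k → q ^ k ≠ 1) (m n : ℕ) (hm : 2 ≤ m) (hn : 2 ≤ n)
    (Γ : AddSubgroup (WeightLattice m n)) (hΓ : ∀ i, root m n i ∈ Γ)
    (d₁ d₂ : ℕ) (hd₁ : 1 ≤ d₁) (hd₂ : 1 ≤ d₂) :
    (∀ (d : ℕ) (_ : 1 ≤ d) (M : Type u) [AddCommGroup M] [Module K M]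
      [Module (AffineHecke q d)ᵐᵒᵖ M] [IsScalarTower K (AffineHecke q d)ᵐᵒᵖ M],
      ∃! ρ : AffineQuantum q Γ hΓ →ₐ[K] Module.End K (SchurWeyl m n hq d M),
        IsSchurWeylAction hq Γ hΓ d M ρ) ∧
    ∃ e : ∀ (M₁ M₂ : Type u)
        [AddCommGroup M₁] [Module K M₁] [Module (AffineHecke q d₁)ᵐᵒᵖ M₁]
        [IsScalarTower K (AffineHecke q d₁)ᵐᵒᵖ M₁] [FiniteDimensional K M₁]
        [AddCommGroup M₂] [Module K M₂] [Module (AffineHecke q d₂)ᵐᵒᵖ M₂]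
        [IsScalarTower K (AffineHecke q d₂)ᵐᵒᵖ M₂] [FiniteDimensional K M₂],
        SchurWeyl m n hq (d₁ + d₂) (Induced q d₁ d₂ M₁ M₂) ≃ₗ[K]
          SchurWeyl m n hq d₁ M₁ ⊗[K] SchurWeyl m n hq d₂ M₂,
      (∀ (M₁ M₂ : Type u)
        [AddCommGroup M₁] [Module K M₁] [Module (AffineHecke q d₁)ᵐᵒᵖ M₁]
        [IsScalarTower K (AffineHecke q d₁)ᵐᵒᵖ M₁] [FiniteDimensional K M₁]
        [AddCommGroup M₂] [Module K M₂] [Module (AffineHecke q d₂)ᵐᵒᵖ M₂]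
        [IsScalarTower K (AffineHecke q d₂)ᵐᵒᵖ M₂] [FiniteDimensional K M₂]
        (ρ₁ : AffineQuantum q Γ hΓ →ₐ[K] Module.End K (SchurWeyl m n hq d₁ M₁))
        (ρ₂ : AffineQuantum q Γ hΓ →ₐ[K] Module.End K (SchurWeyl m n hq d₂ M₂))
        (ρ : AffineQuantum q Γ hΓ →ₐ[K]
          Module.End K (SchurWeyl m n hq (d₁ + d₂) (Induced q d₁ d₂ M₁ M₂))),
        IsSchurWeylAction hq Γ hΓ d₁ M₁ ρ₁ → IsSchurWeylAction hq Γ hΓ d₂ M₂ ρ₂ →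
        IsSchurWeylAction hq Γ hΓ (d₁ + d₂) (Induced q d₁ d₂ M₁ M₂) ρ →
        ∃ τ : AffineQuantum q Γ hΓ →ₐ[K]
            Module.End K (SchurWeyl m n hq d₁ M₁ ⊗[K] SchurWeyl m n hq d₂ M₂),
          IsTensorAction q Γ hΓ ρ₁ ρ₂ τ ∧
          ∀ (u : AffineQuantum q Γ hΓ)
            (x : SchurWeyl m n hq (d₁ + d₂) (Induced q d₁ d₂ M₁ M₂)),
            e M₁ M₂ (ρ u x) = τ u (e M₁ M₂ x)) ∧
      (∀ (M₁ M₂ N₁ N₂ : Type u)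
        [AddCommGroup M₁] [Module K M₁] [Module (AffineHecke q d₁)ᵐᵒᵖ M₁]
        [IsScalarTower K (AffineHecke q d₁)ᵐᵒᵖ M₁] [FiniteDimensional K M₁]
        [AddCommGroup M₂] [Module K M₂] [Module (AffineHecke q d₂)ᵐᵒᵖ M₂]
        [IsScalarTower K (AffineHecke q d₂)ᵐᵒᵖ M₂] [FiniteDimensional K M₂]
        [AddCommGroup N₁] [Module K N₁] [Module (AffineHecke q d₁)ᵐᵒᵖ N₁]
        [IsScalarTower K (AffineHecke q d₁)ᵐᵒᵖ N₁] [FiniteDimensional K N₁]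
        [AddCommGroup N₂] [Module K N₂] [Module (AffineHecke q d₂)ᵐᵒᵖ N₂]
        [IsScalarTower K (AffineHecke q d₂)ᵐᵒᵖ N₂] [FiniteDimensional K N₂]
        (f₁ : M₁ →ₗ[(AffineHecke q d₁)ᵐᵒᵖ] N₁) (f₂ : M₂ →ₗ[(AffineHecke q d₂)ᵐᵒᵖ] N₂)
        (x : SchurWeyl m n hq (d₁ + d₂) (Induced q d₁ d₂ M₁ M₂)),
        e N₁ N₂ (SchurWeyl.map m n hq (d₁ + d₂) (Induced.map q d₁ d₂ f₁ f₂) x) =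
          TensorProduct.map (SchurWeyl.map m n hq d₁ f₁) (SchurWeyl.map m n hq d₂ f₂)
            (e M₁ M₂ x)) := by
  refine ⟨fun d _ M _ _ _ _ =>
      existsUnique_isSchurWeylAction hq (hroot 2 two_pos) hm hn,
    fun M₁ M₂ _ _ _ _ _ _ _ _ _ _ => inducedEquiv m n hq d₁ d₂ M₁ M₂, ?_, ?_⟩
  · intro M₁ M₂ _ _ _ _ _ _ _ _ _ _ ρ₁ ρ₂ ρ h₁ h₂ h
    refine ⟨((inducedEquiv m n hq d₁ d₂ M₁ M₂).conjAlgEquiv K).toAlgHom.comp ρ, fun g => ?_,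
      fun u x => ?_⟩
    · refine LinearMap.ext fun t => ?_
      change inducedEquiv m n hq d₁ d₂ M₁ M₂
        (ρ (.gen q Γ hΓ g) (tensorToInduced m n hq d₁ d₂ M₁ M₂ t)) = _
      have e := LinearMap.congr_fun (tensorToInduced_equivariant h₁ h₂ h g) t
      rw [LinearMap.comp_apply, LinearMap.comp_apply] at e
      rw [e]
      exact (inducedEquiv m n hq d₁ d₂ M₁ M₂).apply_symm_apply _
    · change _ = inducedEquiv m n hq d₁ d₂ M₁ M₂ (ρ u
        ((inducedEquiv m n hq d₁ d₂ M₁ M₂).symm (inducedEquiv m n hq d₁ d₂ M₁ M₂ x)))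
      rw [LinearEquiv.symm_apply_apply]
  · intro M₁ M₂ N₁ N₂ _ _ _ _ _ _ _ _ _ _ _ _ _ _ _ _ _ _ _ _ f₁ f₂ x
    obtain ⟨t, rfl⟩ := (inducedEquiv m n hq d₁ d₂ M₁ M₂).symm.surjective x
    rw [LinearEquiv.apply_symm_apply, ← LinearEquiv.eq_symm_apply]
    exact LinearMap.congr_fun (tensorToInduced_natural f₁ f₂) t
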